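/- A metric Lie algebra $(\mathfrak g,\mathsf Q)$ is a real Lie algebra $\mathfrak g$ with an inner product $\mathsf Q$; it corresponds to the simply connected Lie group $G$ of $\mathfrak g$ with the left-invariant Riemannian metric $g$ that equals $\mathsf Q$ at the identity. Two of them are equivalent up to isometry and scaling if there are a diffeomorphism $f:G\to G'$ and $c>0$ with $g=c\,f^*g'$. Let $\mathcal M$ be the set of three-dimensional, nonabelian, unimodular metric Lie algebras modulo isometry and scaling. For $a\in\mathbb R^3\setminus\{0\}$ let $\tilde\Psi(a)\in\mathcal M$ be the class of the metric Lie algebra with an orthonormal basis such that $[e_2,e_3]=a_1e_1$, $[e_3,e_1]=a_2e_2$, $[e_1,e_2]=a_3e_3$; give $\mathcal M$ the quotient topology of the (surjective) map $\tilde\Psi:\mathbb R^3\setminus\{0\}\to\mathcal M$. A flow on $\mathcal M$ determined by the Ricci flow (a normalized Ricci flow) is a continuous flow $(\phi_t)_{t\in\mathbb R}$ on $\mathcal M$ such that, for every solution $(\mathfrak g,\mathsf Q_t)$, $t\in I$, $0\in I$, of $\frac{d}{dt}\mathsf Q_t=-2\operatorname{Rc}(\mathsf Q_t)$ on an open interval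 $I$, with $\mathfrak g$ three-dimensional, nonabelian and unimodular, there is a continuous strictly increasing $s:I\to\mathbb R$ with $s(0)=0$ and $\phi_{s(t)}[\mathfrak g,\mathsf Q_0]=[\mathfrak g,\mathsf Q_t]$ for all $t\in I$. **Theorem A.** Such flows exist. The space $\mathcal M$ is the disjoint union of * four points $p_1,p_2,p_3,p_4$; * six nonempty sets $T_{1,2},T_{1,3},T'_{1,3},T_{1,4},T_{2,3},T_{3,4}$; * three connected two-dimensional open sets $B_{1,4},B_{1,3},B'_{1,3}$ (each homeomorphic to an open subset of the plane), such that for every flow $\phi_t$ on $\mathcal M$ determined by the Ricci flow: * the points $p_1,p_2,p_3,p_4$ are fixed by $\phi_t$; * each $T_{i,j}$ and $T'_{i,j}$ is a one-dimensional trajectory of $\phi_t$ (a single orbit, whose orbit map $\mathbb R\to\mathcal M$ is a topological embedding), and every $p$ in it has $\lim_{t\to-\infty}\phi_t(p)=p_i$ and $\lim_{t\to\infty}\phi_t(p)=p_j$; * each $B_{i,j}$ and $B'_{i,j}$ is invariant under $\phi_t$, and every $p$ in it has $\lim_{t\to-\infty}\phi_t(p)=p_i$ and $\lim_{t\to\infty}\phi_t(p)=p_j$;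 * the stable set $\{x:\lim_{t\to\infty}\phi_t(x)=p_2\}$ of $p_2$ is $\{p_2\}\cup T_{1,2}$, and its unstable set $\{x:\lim_{t\to-\infty}\phi_t(x)=p_2\}$ is $\{p_2\}\cup T_{2,3}$. -/

import Mathlib

open scoped Manifold ContDiff Topology

noncomputable section

/-- A three-dimensional metric Lie algebra: a Lie bracket and an inner product on the vector space
`ℝ³`. Both are arbitrary, so up to a choice of basis this is every real Lie algebra of dimension
three with every inner product on it. -/
structure MetricLieAlgebra where
  /-- the Lie bracket -/
  bracket : (Fin 3 → ℝ) →ₗ[ℝ] (Fin 3 → ℝ) →ₗ[ℝ] (Fin 3 → ℝ)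
  bracket_self : ∀ x, bracket x x = 0
  jacobi : ∀ x y z,
    bracket x (bracket y z) + bracket y (bracket z x) + bracket z (bracket x y) = 0
  /-- the inner product -/
  metric : LinearMap.BilinForm ℝ (Fin 3 → ℝ)
  metric_symm : ∀ x y, metric x y = metric y x
  metric_pos : ∀ x, x ≠ 0 → 0 < metric x x

namespace MetricLieAlgebra

/-- Unimodular: every `ad x` has trace zero. -/
def IsUnimodular (A : MetricLieAlgebra) : Prop :=
  ∀ x, LinearMap.trace ℝ (Fin 3 → ℝ) (A.bracket x) = 0

def IsNonabelian (A : MetricLieAlgebra) : Prop :=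
  ∃ x y, A.bracket x y ≠ 0

theorem metric_nondegenerate (A : MetricLieAlgebra) : A.metric.Nondegenerate := by
  have key : ∀ x, A.metric x x = 0 → x = 0 := fun x hx => by
    by_contra h
    exact (A.metric_pos x h).ne' hx
  exact ⟨fun x hx => key x (hx x), fun x hx => key x (hx x)⟩

/-! ### Levi-Civita connection and Ricci tensor of the left-invariant metric -/

/-- The functional
`z ↦ ½ (⟨[x, y], z⟩ - ⟨[y, z], x⟩ + ⟨[z, x], y⟩)`, which by the Koszul formula is `⟨∇ₓ y, z⟩` for
left-invariant vector fields. -/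
def koszul (A : MetricLieAlgebra) (x y : Fin 3 → ℝ) : Module.Dual ℝ (Fin 3 → ℝ) :=
  (1 / 2 : ℝ) • (A.metric (A.bracket x y) - A.metric.flip x ∘ₗ A.bracket y
    + A.metric.flip y ∘ₗ A.bracket.flip x)

/-- The Levi-Civita connection `∇ₓ y` on left-invariant vector fields: the vector with
`⟨∇ₓ y, z⟩ = koszul x y z` for all `z`. -/
def conn (A : MetricLieAlgebra) (x y : Fin 3 → ℝ) : Fin 3 → ℝ :=
  (LinearMap.BilinForm.toDual A.metric A.metric_nondegenerate).symm (A.koszul x y)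

/-- The curvature `R(x, y) z = ∇ₓ ∇_y z - ∇_y ∇ₓ z - ∇_[x, y] z`. -/
def curvature (A : MetricLieAlgebra) (x y z : Fin 3 → ℝ) : Fin 3 → ℝ :=
  A.conn x (A.conn y z) - A.conn y (A.conn x z) - A.conn (A.bracket x y) z

/-- The Ricci tensor: `Ric(x, y)` is the trace of `z ↦ R(z, x) y`. -/
def ricci (A : MetricLieAlgebra) (x y : Fin 3 → ℝ) : ℝ :=
  ∑ i, A.curvature (Pi.single i 1) x y i

/-! ### Isometry and scaling -/

/-- A simply connected Lie group, with Lie algebra identified with the Lie algebra `A`. -/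
structure GroupModel (A : MetricLieAlgebra) where
  G : Type
  [top : TopologicalSpace G]
  [t2 : T2Space G]
  [simplyConnected : SimplyConnectedSpace G]
  [charted : ChartedSpace (EuclideanSpace ℝ (Fin 3)) G]
  [group : Group G]
  [lieGroup : LieGroup (𝓡 3) ∞ G]
  /-- the identification of the Lie algebra of `G` with the Lie algebra `A` -/
  toAlg : GroupLieAlgebra (𝓡 3) G ≃ₗ[ℝ] (Fin 3 → ℝ)
  map_bracket : ∀ u v : GroupLieAlgebra (𝓡 3) G, toAlg ⁅u, v⁆ = A.bracket (toAlg u) (toAlg v)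

attribute [instance] GroupModel.top GroupModel.t2 GroupModel.simplyConnected GroupModel.charted
  GroupModel.group GroupModel.lieGroup

/-- The left-invariant Riemannian metric on `G` that is the inner product of `A` at the identity:
tangent vectors at `p` are carried to the identity by left translation by `p⁻¹`. -/
def GroupModel.riemannianMetric {A : MetricLieAlgebra} (M : A.GroupModel) (p : M.G)
    (u v : TangentSpace (𝓡 3) p) : ℝ :=
  let τ : TangentSpace (𝓡 3) p → GroupLieAlgebra (𝓡 3) M.G :=
    fun w => mfderiv (𝓡 3) (𝓡 3) (fun y : M.G => p⁻¹ * y) p w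
  A.metric (M.toAlg (τ u)) (M.toAlg (τ v))

/-- The corresponding simply connected Lie groups with left-invariant metrics `g`, `g'` are
isometric up to scaling: there are a diffeomorphism `f` and `c > 0` with `g = c f^* g'`. -/
def Homothetic (A A' : MetricLieAlgebra) : Prop :=
  ∃ (M : A.GroupModel) (M' : A'.GroupModel) (f : Diffeomorph (𝓡 3) (𝓡 3) M.G M'.G ∞) (c : ℝ),
    0 < c ∧ ∀ (p : M.G) (u v : TangentSpace (𝓡 3) p),
      M.riemannianMetric p u v =
        c * M'.riemannianMetric (f p) (mfderiv (𝓡 3) (𝓡 3) f p u) (mfderiv (𝓡 3) (𝓡 3) f p v)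

/-- Isomorphism of metric Lie algebras up to scaling (this includes changes of the basis through
which a Lie algebra is identified with `ℝ³`). By Lie's theorems it integrates to an isometry, up to
scaling, of the simply connected Lie groups. -/
def IsomorphicUpToScaling (A A' : MetricLieAlgebra) : Prop :=
  ∃ (L : (Fin 3 → ℝ) ≃ₗ[ℝ] (Fin 3 → ℝ)) (c : ℝ), 0 < c ∧
    (∀ x y, L (A.bracket x y) = A'.bracket (L x) (L y)) ∧
    ∀ x y, A.metric x y = c * A'.metric (L x) (L y)

end MetricLieAlgebra

/-- Three-dimensional nonabelian unimodular metric Lie algebras. -/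
abbrev UnimodularMLA : Type :=
  {A : MetricLieAlgebra // A.IsUnimodular ∧ A.IsNonabelian}

/-- The space `𝓜` of three-dimensional nonabelian unimodular metric Lie algebras up to isometry
(of the simply connected Lie groups with left-invariant metrics) and scaling. `Quot` is the
quotient by the equivalence relation generated by the given relation. -/
def Moduli : Type :=
  Quot fun A A' : UnimodularMLA =>
    A.1.IsomorphicUpToScaling A'.1 ∨ A.1.Homothetic A'.1

/-- The class of a metric Lie algebra in `𝓜`. -/
def Moduli.mk (A : UnimodularMLA) : Moduli := Quot.mk _ A

/-- The bracket `[e₂, e₃] = a₁ e₁`, `[e₃, e₁] = a₂ e₂`, `[e₁, e₂] = a₃ e₃`. -/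
def milnorBracket (a : Fin 3 → ℝ) : (Fin 3 → ℝ) →ₗ[ℝ] (Fin 3 → ℝ) →ₗ[ℝ] (Fin 3 → ℝ) :=
  LinearMap.mk₂ ℝ (fun x y => a * crossProduct x y)
    (by intro x x' y; simp [mul_add])
    (by intro c x y; simp)
    (by intro x y y'; simp [mul_add])
    (by intro c x y; simp)

/-- The metric Lie algebra with orthonormal basis `e₁, e₂, e₃` and structure constants
`a₁, a₂, a₃`. -/
def milnorAlgebra (a : Fin 3 → ℝ) : MetricLieAlgebra where
  bracket := milnorBracket a
  bracket_self x := by simp [milnorBracket]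
  jacobi x y z := by
    ext i
    fin_cases i <;> simp [milnorBracket, cross_apply] <;> ring
  metric := dotProductBilin ℝ ℝ
  metric_symm x y := by simp [dotProduct_comm]
  metric_pos x hx := by
    simpa using Matrix.dotProduct_star_self_pos_iff.2 hx

theorem milnorAlgebra_isUnimodular (a : Fin 3 → ℝ) : (milnorAlgebra a).IsUnimodular := by
  intro x
  rw [LinearMap.trace_eq_matrix_trace ℝ (Pi.basisFun ℝ (Fin 3))]
  simp [Matrix.trace, Fin.sum_univ_three, milnorAlgebra, milnorBracket,
    cross_apply]

theorem milnorAlgebra_isNonabelian {a : Fin 3 → ℝ} (ha : a ≠ 0) :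
    (milnorAlgebra a).IsNonabelian := by
  by_contra h
  simp only [MetricLieAlgebra.IsNonabelian, not_exists, not_not] at h
  apply ha
  ext i
  fin_cases i
  · simpa [milnorAlgebra, milnorBracket, cross_apply] using
      congrFun (h ![0, 1, 0] ![0, 0, 1]) 0
  · simpa [milnorAlgebra, milnorBracket, cross_apply] using
      congrFun (h ![0, 0, 1] ![1, 0, 0]) 1
  · simpa [milnorAlgebra, milnorBracket, cross_apply] using
      congrFun (h ![1, 0, 0] ![0, 1, 0]) 2

/-- The map `ℝ³ ∖ {0} → 𝓜` from structure constants. -/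
def milnorMap (a : {a : Fin 3 → ℝ // a ≠ 0}) : Moduli :=
  Moduli.mk ⟨milnorAlgebra a.1, milnorAlgebra_isUnimodular a.1, milnorAlgebra_isNonabelian a.2⟩

/-- The topology of `𝓜`: the quotient topology from the space `ℝ³ ∖ {0}` of structure constants
(equivalently, from its quotient by scaling and permutations). -/
instance : TopologicalSpace Moduli :=
  TopologicalSpace.coinduced milnorMap inferInstance

/-! ### Ricci flow -/

/-- `A t`, for `t` in the open interval `I` around `0`, is a solution of the Ricci flow
`∂Q/∂t = -2 Ric(Q)` of inner products on a fixed Lie algebra. -/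
structure IsRicciFlow (A : ℝ → UnimodularMLA) (I : Set ℝ) : Prop where
  isOpen : IsOpen I
  ordConnected : I.OrdConnected
  zero_mem : 0 ∈ I
  bracket_eq : ∀ t ∈ I, (A t).1.bracket = (A 0).1.bracket
  hasDerivAt : ∀ t ∈ I, ∀ x y,
    HasDerivAt (fun s => (A s).1.metric x y) (-2 * (A t).1.ricci x y) t

/-- `φ` is a flow on `𝓜` determined by the Ricci flow: the orbits are, up to an
orientation-preserving continuous change of time (which may depend on the orbit), the curves in
`𝓜` of solutions of the Ricci flow. -/
def IsNormalizedRicciFlow (φ : Flow ℝ Moduli) : Prop :=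
  ∀ (A : ℝ → UnimodularMLA) (I : Set ℝ), IsRicciFlow A I →
    ∃ s : ℝ → ℝ, s 0 = 0 ∧ ContinuousOn s I ∧ StrictMonoOn s I ∧
      ∀ t ∈ I, φ (s t) (Moduli.mk (A 0)) = Moduli.mk (A t)

/-- The orbit of each point of `S` runs from `p` (as `t → -∞`) to `q` (as `t → ∞`). -/
def RunsFromTo (φ : Flow ℝ Moduli) (S : Set Moduli) (p q : Moduli) : Prop :=
  ∀ x ∈ S, Filter.Tendsto (fun t => φ t x) Filter.atBot (𝓝 p) ∧
    Filter.Tendsto (fun t => φ t x) Filter.atTop (𝓝 q)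

/-- `T` is a one-dimensional trajectory: it is a single orbit, and the orbit map is a topological
embedding of the line. -/
def IsOneDimTrajectory (φ : Flow ℝ Moduli) (T : Set Moduli) : Prop :=
  T.Nonempty ∧ ∀ x ∈ T, φ.orbit x = T ∧ Topology.IsEmbedding (fun t : ℝ => φ t x)

/-- `B` is a connected two-dimensional open subset of `𝓜`: open, connected, and homeomorphic to an
open subset of the plane. -/
def IsConnectedPlanarOpen (B : Set Moduli) : Prop :=
  IsOpen B ∧ IsConnected B ∧ ∃ e : B → ℝ × ℝ, Topology.IsOpenEmbedding e

end

/-! In dimension three a unimodular bracket has the form `N (x × y)` with `N` symmetric in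
orthonormal coordinates, so an orthonormal basis diagonalizes it and `𝓜` is a quotient of `ℝ³ ∖
{0}`. The fibres are the orbits of permutations and nonzero factors. The delicate point is that an
isometry of the groups need not be a homomorphism. The two left-invariant frames are therefore
compared in one coordinate patch: their transition matrix is orthogonal, its first derivatives are
determined by the structure constants (`transition_derivative`), and symmetry of its second
derivatives equates the Ricci tensors (`adjugate_eq_of_compatibility`). The structure constants can
be recovered from this (`milnorInvariant_eq_of_frames`). Hence `Moduli.invariant` is injective and
`𝓜` is Hausdorff.

A metric that is diagonal in a Milnor frame stays diagonal under the Ricci flow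
(`IsRicciFlow.gram_offDiagonal`), and its structure constants follow a cubic vector field on `ℝ³`.
Divided by `‖a‖ ^ 2`, this field is homogeneous of degree one, globally Lipschitz and equivariant,
so its flow is complete and descends to `Moduli.ricciFlow`. Conversely, one solution of the Ricci
flow covers each whole orbit (`Moduli.exists_isRicciFlow`). Any other normalized Ricci flow is thus
a time change of this one, orbit by orbit, and orbits between rest points keep their limits
(`Flow.IsReparametrization.heteroclinic`).

Each class has exactly one representative `(1, u, v)` in `normalForms`, and there the flow is, up to
a positive factor, `u' = u (1 - u) (1 + u - v)`, `v' = v (1 - v) (1 + v - u)`. The rest points are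
`(0, 0)` (Heisenberg group), `(0, -1)` (Sol), `(1, 0)` (flat) and `(1, 1)` (round sphere). The lines
`u = 0`, `u = 1`, `v = 0` and `u = v` are invariant, and monotonicity of the coordinates gives
limits, which must be rest points.

In the strip `0 < u < 1`, `v < 0`, orbits that meet `u - v < 1` come from `(0, 0)`. Orbits that meet
`v < -1` escape backwards to `v = -∞`, which is again the class of `(0, 0)`. These two sets are
open, disjoint and nonempty, so they do not exhaust the connected strip. What remains comes from
`(0, -1)`. It is a single orbit, because the logarithmic distance of two orbits, as graphs over `u`,
does not increase with `u` and starts at zero (`IsChartSolution.exists_eq_of_separatrix`). -/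

/-! ### Structure constants up to scaling and permutation -/

/-- Structure constants that differ by a permutation and a nonzero factor. -/
def MilnorEquiv (a b : Fin 3 → ℝ) : Prop :=
  ∃ (c : ℝ) (σ : Equiv.Perm (Fin 3)), c ≠ 0 ∧ ∀ i, b i = c * a (σ i)

/-- A complete invariant of structure constants up to scaling and permutation. -/
noncomputable def milnorInvariant (a : Fin 3 → ℝ) : ℝ × ℝ × ℝ :=
  let N := a 0 ^ 2 + a 1 ^ 2 + a 2 ^ 2
  let s := a 0 + a 1 + a 2
  let p := a 0 * a 1 * a 2
  (s ^ 2 / N, s * p / N ^ 2, p ^ 2 / N ^ 3)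

theorem sum_sq_pos {a : Fin 3 → ℝ} (ha : a ≠ 0) : 0 < a 0 ^ 2 + a 1 ^ 2 + a 2 ^ 2 := by
  by_contra h
  apply ha
  have h0 : a 0 = 0 := by nlinarith [sq_nonneg (a 0), sq_nonneg (a 1), sq_nonneg (a 2)]
  have h1 : a 1 = 0 := by nlinarith [sq_nonneg (a 0), sq_nonneg (a 1), sq_nonneg (a 2)]
  have h2 : a 2 = 0 := by nlinarith [sq_nonneg (a 0), sq_nonneg (a 1), sq_nonneg (a 2)]
  ext i; fin_cases i <;> simp [h0, h1, h2]

/-- Each component is a quotient of symmetric functions of the same even degree (2, 4, 6), so a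
factor of either sign cancels. -/
theorem milnorInvariant_eq_of_symmetric {a b : Fin 3 → ℝ} {c : ℝ} (hc : c ≠ 0)
    (h1 : b 0 + b 1 + b 2 = c * (a 0 + a 1 + a 2))
    (h2 : b 0 ^ 2 + b 1 ^ 2 + b 2 ^ 2 = c ^ 2 * (a 0 ^ 2 + a 1 ^ 2 + a 2 ^ 2))
    (h3 : b 0 * b 1 * b 2 = c ^ 3 * (a 0 * a 1 * a 2)) :
    milnorInvariant b = milnorInvariant a := by
  simp only [milnorInvariant, h1, h2, h3, Prod.mk.injEq]
  refine ⟨?_, ?_, ?_⟩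
  · rw [mul_pow, mul_div_mul_left _ _ (pow_ne_zero 2 hc)]
  · rw [show c * (a 0 + a 1 + a 2) * (c ^ 3 * (a 0 * a 1 * a 2)) =
      c ^ 4 * ((a 0 + a 1 + a 2) * (a 0 * a 1 * a 2)) by ring, mul_pow, ← pow_mul,
      mul_div_mul_left _ _ (pow_ne_zero _ hc)]
  · generalize a 0 * a 1 * a 2 = p
    generalize a 0 ^ 2 + a 1 ^ 2 + a 2 ^ 2 = N
    rw [mul_pow, mul_pow, ← pow_mul, ← pow_mul, mul_div_mul_left _ _ (pow_ne_zero _ hc)]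

/-- By Vieta, `b 0` is a root of the cubic with roots `a i`. Once it is matched, the other two
entries have known sum and product. -/
theorem eq_perm_of_symmetric_eq {a b : Fin 3 → ℝ}
    (h1 : b 0 + b 1 + b 2 = a 0 + a 1 + a 2)
    (h2 : b 0 * b 1 + b 1 * b 2 + b 2 * b 0 = a 0 * a 1 + a 1 * a 2 + a 2 * a 0)
    (h3 : b 0 * b 1 * b 2 = a 0 * a 1 * a 2) :
    ∃ σ : Equiv.Perm (Fin 3), ∀ i, b i = a (σ i) := by
  have two : ∀ x y z w : ℝ, x + y = z + w → x * y = z * w → (x = z ∧ y = w) ∨ (x = w ∧ y = z) := by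
    intro x y z w hs hp
    have : (x - z) * (x - w) = 0 := by
      have hy : y = z + w - x := by linarith
      rw [hy] at hp; linarith
    rcases mul_eq_zero.1 this with h | h
    · left; exact ⟨by linarith, by linarith⟩
    · right; exact ⟨by linarith, by linarith⟩
  have root : (b 0 - a 0) * ((b 0 - a 1) * (b 0 - a 2)) = 0 := by
    have e1 : b 1 + b 2 = a 0 + a 1 + a 2 - b 0 := by linarith
    have e2 : b 1 * b 2 = a 0 * a 1 + a 1 * a 2 + a 2 * a 0 - b 0 * (b 1 + b 2) := by linarith
    rw [e1] at e2
    have e3 : b 0 * (b 1 * b 2) = a 0 * a 1 * a 2 := by linarith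
    rw [e2] at e3
    linarith
  have red : ∀ x y z : ℝ, b 0 = x → x + y + z = a 0 + a 1 + a 2 →
      x * y + y * z + z * x = a 0 * a 1 + a 1 * a 2 + a 2 * a 0 →
      (b 1 = y ∧ b 2 = z) ∨ (b 1 = z ∧ b 2 = y) := by
    intro x y z hx hs hp
    apply two
    · linarith
    · have e1 : b 1 + b 2 = y + z := by linarith
      have e2 : b 1 * b 2 = a 0 * a 1 + a 1 * a 2 + a 2 * a 0 - b 0 * (b 1 + b 2) := by linarith
      rw [e1, hx] at e2
      linarith
  have fin : ∀ σ : Equiv.Perm (Fin 3), b 0 = a (σ 0) → b 1 = a (σ 1) → b 2 = a (σ 2) →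
      ∃ σ : Equiv.Perm (Fin 3), ∀ i, b i = a (σ i) := by
    intro σ e0 e1 e2
    exact ⟨σ, fun i => by fin_cases i <;> assumption⟩
  rcases mul_eq_zero.1 root with h | h
  · have h0 : b 0 = a 0 := by linarith
    rcases red _ (a 1) (a 2) h0 (by ring) (by ring) with ⟨e1, e2⟩ | ⟨e1, e2⟩
    · exact fin 1 h0 e1 e2
    · exact fin (Equiv.swap 1 2) (by simpa [Equiv.swap_apply_of_ne_of_ne] using h0)
        (by simpa using e1) (by simpa using e2)
  rcases mul_eq_zero.1 h with h | h
  · have h0 : b 0 = a 1 := by linarith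
    rcases red _ (a 0) (a 2) h0 (by ring) (by ring) with ⟨e1, e2⟩ | ⟨e1, e2⟩
    · exact fin (Equiv.swap 0 1) (by simpa using h0) (by simpa using e1)
        (by simpa [Equiv.swap_apply_of_ne_of_ne] using e2)
    · exact fin (finRotate 3) (by simpa using h0) (by simpa using e1) (by simpa using e2)
  · have h0 : b 0 = a 2 := by linarith
    rcases red _ (a 0) (a 1) h0 (by ring) (by ring) with ⟨e1, e2⟩ | ⟨e1, e2⟩
    · exact fin (finRotate 3)⁻¹
        (by rwa [show (finRotate 3)⁻¹ (0 : Fin 3) = 2 by decide])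
        (by rwa [show (finRotate 3)⁻¹ (1 : Fin 3) = 0 by decide])
        (by rwa [show (finRotate 3)⁻¹ (2 : Fin 3) = 1 by decide])
    · exact fin (Equiv.swap 0 2) (by simpa using h0)
        (by simpa [Equiv.swap_apply_of_ne_of_ne] using e1) (by simpa using e2)

theorem MilnorEquiv.symm {a b : Fin 3 → ℝ} (h : MilnorEquiv a b) : MilnorEquiv b a := by
  obtain ⟨c, σ, hc, h⟩ := h
  exact ⟨c⁻¹, σ⁻¹, inv_ne_zero hc, fun i => by rw [h]; simp [hc]⟩

theorem perm_sum {f : Fin 3 → ℝ} (σ : Equiv.Perm (Fin 3)) :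
    f (σ 0) + f (σ 1) + f (σ 2) = f 0 + f 1 + f 2 := by
  have := Equiv.sum_comp σ f
  simpa [Fin.sum_univ_three] using this

theorem perm_prod {f : Fin 3 → ℝ} (σ : Equiv.Perm (Fin 3)) :
    f (σ 0) * f (σ 1) * f (σ 2) = f 0 * f 1 * f 2 := by
  have := Equiv.prod_comp σ f
  simpa [Fin.prod_univ_three] using this

theorem milnorInvariant_eq_iff {a b : Fin 3 → ℝ} (ha : a ≠ 0) (hb : b ≠ 0) :
    milnorInvariant a = milnorInvariant b ↔ MilnorEquiv a b := by
  constructor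
  · intro h
    have hN := sum_sq_pos ha
    have hN' := sum_sq_pos hb
    simp only [milnorInvariant, Prod.mk.injEq] at h
    obtain ⟨h1, h2, h3⟩ := h
    set N := a 0 ^ 2 + a 1 ^ 2 + a 2 ^ 2 with hNd
    set N' := b 0 ^ 2 + b 1 ^ 2 + b 2 ^ 2 with hNd'
    set s := a 0 + a 1 + a 2 with hs
    set s' := b 0 + b 1 + b 2 with hs'
    set p := a 0 * a 1 * a 2 with hp
    set p' := b 0 * b 1 * b 2 with hp'
    obtain ⟨c, hc, hcN⟩ : ∃ c : ℝ, 0 < c ∧ N' = c ^ 2 * N :=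
      ⟨Real.sqrt (N' / N), Real.sqrt_pos.2 (div_pos hN' hN), by
        rw [Real.sq_sqrt (div_pos hN' hN).le]; field_simp⟩
    have hc0 : c ≠ 0 := hc.ne'
    have k1 : s' ^ 2 = (c * s) ^ 2 := by
      rw [hcN] at h1; field_simp at h1; linarith
    have k2 : s' * p' = (c * s) * (c ^ 3 * p) := by
      rw [hcN] at h2; field_simp at h2; linarith
    have k3 : p' ^ 2 = (c ^ 3 * p) ^ 2 := by
      rw [hcN] at h3; field_simp at h3; linarith
    -- The norms fix the factor up to sign. The mixed component `s * p / N ^ 2` ties the signs for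
    -- `s` and `p` together: if they disagree, one of the two is zero and imposes no sign.
    have key : ∃ d : ℝ, d ≠ 0 ∧ d ^ 2 = c ^ 2 ∧ s' = d * s ∧ p' = d ^ 3 * p := by
      rcases sq_eq_sq_iff_eq_or_eq_neg.1 k1 with e1 | e1 <;>
      rcases sq_eq_sq_iff_eq_or_eq_neg.1 k3 with e3 | e3
      · exact ⟨c, hc0, rfl, e1, e3⟩
      · have : s = 0 ∨ p = 0 := by
          rw [e1, e3] at k2
          have : c ^ 4 * (s * p) = 0 := by linarith
          rcases mul_eq_zero.1 this with h | h
          · exact absurd h (pow_ne_zero _ hc0)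
          · exact mul_eq_zero.1 h
        rcases this with h | h
        · exact ⟨-c, neg_ne_zero.2 hc0, by ring, by rw [e1, h]; ring, by rw [e3]; ring⟩
        · exact ⟨c, hc0, by ring, e1, by rw [e3, h]; ring⟩
      · have : s = 0 ∨ p = 0 := by
          rw [e1, e3] at k2
          have : c ^ 4 * (s * p) = 0 := by linarith
          rcases mul_eq_zero.1 this with h | h
          · exact absurd h (pow_ne_zero _ hc0)
          · exact mul_eq_zero.1 h
        rcases this with h | h
        · exact ⟨c, hc0, by ring, by rw [e1, h]; ring, by rw [e3]⟩
        · exact ⟨-c, neg_ne_zero.2 hc0, by ring, by rw [e1]; ring, by rw [e3, h]; ring⟩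
      · exact ⟨-c, neg_ne_zero.2 hc0, by ring, by rw [e1]; ring, by rw [e3]; ring⟩
    obtain ⟨d, hd, hdc, e1, e3⟩ := key
    obtain ⟨σ, hσ⟩ := eq_perm_of_symmetric_eq (a := fun i => d * a i) (b := b)
      (by linear_combination e1 + d * hs - hs') (by
        have : b 0 ^ 2 + b 1 ^ 2 + b 2 ^ 2 = d ^ 2 * (a 0 ^ 2 + a 1 ^ 2 + a 2 ^ 2) := by
          rw [← hNd', ← hNd, hcN, hdc]
        have e1' : (b 0 + b 1 + b 2) ^ 2 = (d * (a 0 + a 1 + a 2)) ^ 2 := by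
          rw [← hs', e1]
        linear_combination (1 / 2) * e1' - (1 / 2) * this)
      (by rw [← hp', e3, hp]; ring)
    exact ⟨d, σ, hd, hσ⟩
  · rintro ⟨c, σ, hc, h⟩
    refine (milnorInvariant_eq_of_symmetric hc ?_ ?_ ?_).symm
    · rw [h, h, h, ← perm_sum (f := a) σ]; ring
    · rw [h, h, h, ← perm_sum (f := fun i => a i ^ 2) σ]; ring
    · rw [h, h, h, ← perm_prod (f := a) σ]; ring

/-! ### Isomorphisms of Milnor algebras -/

@[simp]
theorem milnorBracket_apply (a x y : Fin 3 → ℝ) :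
    milnorBracket a x y = a * crossProduct x y := rfl

@[simp]
theorem milnorAlgebra_bracket (a : Fin 3 → ℝ) : (milnorAlgebra a).bracket = milnorBracket a := rfl

@[simp]
theorem milnorAlgebra_metric (a x y : Fin 3 → ℝ) : (milnorAlgebra a).metric x y = x ⬝ᵥ y := rfl

open Matrix in
-- Paired with a third vector this is multiplicativity of the determinant. It is the source of the
-- orientation factors below.
theorem transpose_mulVec_cross (M : Matrix (Fin 3) (Fin 3) ℝ) (x y : Fin 3 → ℝ) :
    Mᵀ *ᵥ (crossProduct (M *ᵥ x) (M *ᵥ y)) = M.det • crossProduct x y := by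
  ext i
  fin_cases i <;>
  simp [cross_apply, Matrix.mulVec, dotProduct, Fin.sum_univ_three, Matrix.det_fin_three] <;> ring

open Matrix in
-- Every vector is a sum of three cross products. This principle turns identities between brackets
-- into identities between matrices.
theorem exists_cross_eq (z : Fin 3 → ℝ) (P : (Fin 3 → ℝ) → Prop)
    (h0 : ∀ x y, P (crossProduct x y)) (hadd : ∀ x y, P x → P y → P (x + y)) : P z := by
  have : z = crossProduct ![0, z 0, 0] ![0, 0, 1] + (crossProduct ![0, 0, z 1] ![1, 0, 0] +
      crossProduct ![z 2, 0, 0] ![0, 1, 0]) := by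
    ext i; fin_cases i <;> simp [cross_apply]
  rw [this]
  exact hadd _ _ (h0 _ _) (hadd _ _ (h0 _ _) (h0 _ _))

open Matrix in
/-- Diagonal matrices that are conjugate up to a factor have the same invariant. -/
theorem milnorInvariant_eq_of_conj {a b : Fin 3 → ℝ} {M N : Matrix (Fin 3) (Fin 3) ℝ} {c : ℝ}
    (hc : c ≠ 0) (hMN : M * N = 1)
    (h : diagonal a = c • (N * diagonal b * M)) : milnorInvariant a = milnorInvariant b := by
  have h1 : trace (diagonal a) = c * trace (diagonal b) := by
    rw [h, trace_smul, trace_mul_comm, ← Matrix.mul_assoc, hMN, Matrix.one_mul, smul_eq_mul]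
  have h2 : trace (diagonal a * diagonal a) = c ^ 2 * trace (diagonal b * diagonal b) := by
    have : diagonal a * diagonal a = c ^ 2 • (N * (diagonal b * diagonal b) * M) := by
      rw [h, smul_mul_smul_comm, ← sq]
      congr 1
      calc N * diagonal b * M * (N * diagonal b * M)
          = N * diagonal b * (M * N) * diagonal b * M := by simp only [Matrix.mul_assoc]
        _ = _ := by rw [hMN]; simp only [Matrix.mul_assoc, Matrix.one_mul]
    rw [this, trace_smul, trace_mul_comm, ← Matrix.mul_assoc, hMN, Matrix.one_mul, smul_eq_mul]
  have h3 : det (diagonal a) = c ^ 3 * det (diagonal b) := by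
    have hd : N.det * M.det = 1 := by rw [mul_comm, ← det_mul, hMN, det_one]
    rw [h, det_smul, det_mul, det_mul, Fintype.card_fin]
    linear_combination (c ^ 3 * (diagonal b).det) * hd
  rw [diagonal_mul_diagonal, diagonal_mul_diagonal] at h2
  simp only [trace_diagonal, det_diagonal, Fin.sum_univ_three, Fin.prod_univ_three] at h1 h2 h3
  exact milnorInvariant_eq_of_symmetric hc h1 (by linear_combination h2) h3

open Matrix in
-- A matrix `M` that preserves the metric up to `c` has inverse `c • Mᵀ`. The cofactor rule for
-- cross products then turns compatibility with the brackets into conjugacy of the two diagonal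
-- matrices, up to the factor `c * M.det`.
theorem milnorInvariant_eq_of_isomorphic {a b : Fin 3 → ℝ}
    (h : (milnorAlgebra a).IsomorphicUpToScaling (milnorAlgebra b)) :
    milnorInvariant a = milnorInvariant b := by
  obtain ⟨L, c, hc, hbr, hm⟩ := h
  simp only [milnorAlgebra_bracket, milnorBracket_apply, milnorAlgebra_metric] at hbr hm
  set M := LinearMap.toMatrix' (L : (Fin 3 → ℝ) →ₗ[ℝ] (Fin 3 → ℝ)) with hM
  have hL : ∀ x, L x = M *ᵥ x := fun x => by simp [hM]
  simp only [hL] at hbr hm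
  have hMM : c • (Mᵀ * M) = 1 := by
    ext i j
    have := hm (Pi.single i 1) (Pi.single j 1)
    simp only [mulVec_single_one] at this
    simp only [Matrix.smul_apply, smul_eq_mul]
    rw [one_apply, ← Pi.single_apply]
    rw [single_one_dotProduct] at this
    simpa [Matrix.mul_apply, dotProduct, Matrix.col] using this.symm
  have hMM' : M * (c • Mᵀ) = 1 := by
    rw [mul_eq_one_comm, Matrix.smul_mul]; exact hMM
  have hdet : M.det ≠ 0 := by
    intro h0
    have := congrArg det hMM'
    simp [det_mul, h0] at this
  have hconj : ∀ z, M *ᵥ (a * z) = (c * M.det) • (b * (M *ᵥ z)) := by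
    intro z
    refine exists_cross_eq z (fun z => M *ᵥ (a * z) = (c * M.det) • (b * (M *ᵥ z)))
      (fun x y => ?_) (fun x y hx hy => ?_)
    · rw [hbr]
      have : crossProduct (M *ᵥ x) (M *ᵥ y) = (c * M.det) • M *ᵥ crossProduct x y := by
        rw [mul_smul, ← mulVec_smul, ← transpose_mulVec_cross, mulVec_mulVec, ← smul_mulVec,
          ← Matrix.mul_smul, hMM', one_mulVec]
      rw [this, mul_smul_comm]
    · rw [mul_add, mulVec_add, hx, hy, mulVec_add, mul_add, smul_add]
  have hmat : M * diagonal a = (c * M.det) • (diagonal b * M) := by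
    apply Matrix.ext_of_mulVec_single
    intro i
    rw [smul_mulVec, ← mulVec_mulVec, ← mulVec_mulVec]
    have hd : ∀ d z : Fin 3 → ℝ, diagonal d *ᵥ z = d * z := fun d z => by
      ext j; simp [mulVec_diagonal]
    rw [hd, hd, hconj]
  refine milnorInvariant_eq_of_conj (mul_ne_zero hc.ne' hdet) hMM' ?_
  calc diagonal a = (c • Mᵀ) * M * diagonal a := by
        rw [mul_eq_one_comm.1 hMM', Matrix.one_mul]
    _ = _ := by rw [Matrix.mul_assoc, hmat, Matrix.mul_smul, Matrix.mul_assoc]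

open Matrix in
-- Permuting coordinates multiplies the cross product by the sign of the permutation. The map is
-- therefore the permutation times `s * c⁻¹`, and the factor `c ^ 2` restores the metric.
theorem MilnorEquiv.isomorphic {a b : Fin 3 → ℝ} (h : MilnorEquiv a b) :
    (milnorAlgebra a).IsomorphicUpToScaling (milnorAlgebra b) := by
  obtain ⟨c, σ, hc, h⟩ := h
  set s : ℝ := ((Equiv.Perm.sign σ : ℤ) : ℝ) with hs
  have hs2 : s * s = 1 := by
    rw [hs, ← Int.cast_mul]; simp
  have hs0 : s ≠ 0 := by rintro h0; simp [h0] at hs2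
  have hsc : s * c⁻¹ ≠ 0 := mul_ne_zero hs0 (inv_ne_zero hc)
  refine ⟨(LinearEquiv.funCongrLeft ℝ ℝ σ).trans (LinearEquiv.smulOfNeZero ℝ _ _ hsc), c ^ 2,
    by positivity, fun x y => ?_, fun x y => ?_⟩
  · have hcross : crossProduct (fun i => x (σ i)) (fun i => y (σ i)) =
        s • fun i => crossProduct x y (σ i) := by
      have := transpose_mulVec_cross (Equiv.Perm.permMatrix ℝ σ) x y
      rw [transpose_permMatrix, det_permutation] at this
      simp only [permMatrix_mulVec] at this
      ext i
      have h2 := congrFun this (σ i)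
      simp only [Function.comp_apply, Equiv.Perm.coe_inv, Equiv.symm_apply_apply] at h2
      rw [hs]
      exact h2
    have hb : b = fun i => c * a (σ i) := funext h
    have e : ∀ z : Fin 3 → ℝ, LinearEquiv.funCongrLeft ℝ ℝ σ z = fun i => z (σ i) := fun z => rfl
    simp only [milnorAlgebra_bracket, milnorBracket_apply, LinearEquiv.trans_apply, e,
      LinearEquiv.smulOfNeZero_apply, LinearMap.map_smul, LinearMap.smul_apply, hcross]
    ext i
    simp only [hb, Pi.smul_apply, Pi.mul_apply, smul_eq_mul]
    field_simp
    linear_combination (-(a (σ i) * (crossProduct x y) (σ i))) * hs2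
  · have e : ∀ z : Fin 3 → ℝ, LinearEquiv.funCongrLeft ℝ ℝ σ z = fun i => z (σ i) := fun z => rfl
    have hd : (fun i => x (σ i)) ⬝ᵥ (fun i => y (σ i)) = x ⬝ᵥ y :=
      Equiv.sum_comp σ (fun i => x i * y i)
    simp only [milnorAlgebra_metric, LinearEquiv.trans_apply, e,
      LinearEquiv.smulOfNeZero_apply, smul_dotProduct, dotProduct_smul, hd, smul_eq_mul]
    field_simp
    linear_combination (-(x ⬝ᵥ y)) * hs2

/-! ### Milnor frames -/

namespace MetricLieAlgebra

/-- `L` identifies `A` isometrically with the Milnor algebra of `a`. -/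
structure IsMilnorFrame (A : MetricLieAlgebra) (a : Fin 3 → ℝ)
    (L : (Fin 3 → ℝ) ≃ₗ[ℝ] (Fin 3 → ℝ)) : Prop where
  map_bracket : ∀ x y, L (A.bracket x y) = a * crossProduct (L x) (L y)
  metric_eq : ∀ x y, A.metric x y = L x ⬝ᵥ L y

theorem exists_orthonormal_coordinates (A : MetricLieAlgebra) :
    ∃ L : (Fin 3 → ℝ) ≃ₗ[ℝ] (Fin 3 → ℝ), ∀ x y, A.metric x y = L x ⬝ᵥ L y := by
  obtain ⟨v, hv⟩ := LinearMap.BilinForm.exists_orthogonal_basis (B := A.metric)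
    ⟨fun x y => by simpa using A.metric_symm x y⟩
  let v' : Module.Basis (Fin 3) ℝ (Fin 3 → ℝ) := v.reindex (finCongr (by simp))
  have hv' : ∀ i j, i ≠ j → A.metric (v' i) (v' j) = 0 := fun i j hij => by
    simp only [v', Module.Basis.reindex_apply]
    exact hv (fun h => hij ((finCongr _).symm.injective h))
  have hpos : ∀ i, 0 < A.metric (v' i) (v' i) := fun i => A.metric_pos _ (v'.ne_zero i)
  have hs : ∀ i, Real.sqrt (A.metric (v' i) (v' i)) ≠ 0 := fun i => (Real.sqrt_pos.2 (hpos i)).ne'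
  let b := v'.isUnitSMul (w := fun i => (Real.sqrt (A.metric (v' i) (v' i)))⁻¹)
    (fun i => (inv_ne_zero (hs i)).isUnit)
  have hb : ∀ i j, A.metric (b i) (b j) = if i = j then 1 else 0 := by
    intro i j
    simp only [b, Module.Basis.isUnitSMul_apply, map_smul, LinearMap.smul_apply, smul_eq_mul]
    split_ifs with h
    · subst h
      have := Real.mul_self_sqrt (hpos i).le
      have := hs i
      field_simp
      rw [sq]; linarith
    · rw [hv' i j h]; simp
  refine ⟨b.equivFun, fun x y => ?_⟩
  conv_lhs => rw [← b.sum_equivFun x, ← b.sum_equivFun y]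
  simp only [map_sum, LinearMap.sum_apply, map_smul, LinearMap.smul_apply, hb, dotProduct,
    smul_eq_mul, mul_ite, mul_one, mul_zero, Finset.sum_ite_eq',
    Finset.mem_univ, if_true]
  exact Finset.sum_congr rfl fun i _ => mul_comm _ _

/-- A bilinear alternating bracket on `ℝ³` factors through the cross product. -/
theorem exists_matrix_of_alternating
    (β : (Fin 3 → ℝ) →ₗ[ℝ] (Fin 3 → ℝ) →ₗ[ℝ] (Fin 3 → ℝ)) (hβ : ∀ x, β x x = 0) :
    ∃ N : Matrix (Fin 3) (Fin 3) ℝ, (∀ x y, β x y = N.mulVec (crossProduct x y)) ∧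
      ((∀ x, LinearMap.trace ℝ (Fin 3 → ℝ) (β x) = 0) → N.IsSymm) := by
  have hsw : ∀ x y, β x y = - β y x := fun x y => by
    have := hβ (x + y)
    simp only [map_add, LinearMap.add_apply, hβ, zero_add, add_zero] at this
    exact eq_neg_of_add_eq_zero_right this
  let e : Fin 3 → (Fin 3 → ℝ) := fun i => Pi.single i 1
  let N : Matrix (Fin 3) (Fin 3) ℝ := Matrix.of fun i j =>
    ![β (e 1) (e 2) i, β (e 2) (e 0) i, β (e 0) (e 1) i] j
  have hx : ∀ x : Fin 3 → ℝ, x = x 0 • e 0 + x 1 • e 1 + x 2 • e 2 := fun x => by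
    ext i; fin_cases i <;> simp [e]
  have hN : ∀ x y, β x y = N.mulVec (crossProduct x y) := by
    intro x y
    conv_lhs => rw [hx x, hx y]
    simp only [map_add, map_smul, LinearMap.add_apply, LinearMap.smul_apply, hβ]
    rw [hsw (e 1) (e 0), hsw (e 2) (e 1), hsw (e 0) (e 2)]
    ext i
    simp [N, Matrix.mulVec, dotProduct, Fin.sum_univ_three, cross_apply]
    ring
  refine ⟨N, hN, fun htr => ?_⟩
  have ht : ∀ x, ∑ i, β x (e i) i = 0 := fun x => by
    rw [← htr x, LinearMap.trace_eq_matrix_trace ℝ (Pi.basisFun ℝ (Fin 3))]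
    simp [Matrix.trace, e]
  -- The trace of `ad eᵢ` is a difference of two mirror off-diagonal entries of `N`, so
  -- unimodularity is symmetry of `N`.
  have h0 := ht (e 0)
  have h1 := ht (e 1)
  have h2 := ht (e 2)
  simp only [hN, Fin.sum_univ_three] at h0 h1 h2
  simp [e, Matrix.mulVec, dotProduct, Fin.sum_univ_three, cross_apply] at h0 h1 h2
  ext i j
  simp only [Matrix.transpose_apply]
  fin_cases i <;> fin_cases j <;> simp <;> linarith

open Matrix in
-- The spectral theorem diagonalizes the symmetric matrix `N` of the bracket. An eigenbasis of the
-- other orientation changes the sign of the cross product, hence the factor `U.det` on the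
-- eigenvalues.
theorem exists_isMilnorFrame (A : MetricLieAlgebra) (hA : A.IsUnimodular) :
    ∃ a L, A.IsMilnorFrame a L := by
  obtain ⟨P, hP⟩ := A.exists_orthonormal_coordinates
  let β : (Fin 3 → ℝ) →ₗ[ℝ] (Fin 3 → ℝ) →ₗ[ℝ] (Fin 3 → ℝ) :=
    LinearMap.mk₂ ℝ (fun x y => P (A.bracket (P.symm x) (P.symm y)))
      (by intros; simp) (by intros; simp) (by intros; simp) (by intros; simp)
  have hβ' : ∀ x y, β x y = P (A.bracket (P.symm x) (P.symm y)) := fun _ _ => rfl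
  obtain ⟨N, hN, hsym⟩ := exists_matrix_of_alternating β
    (fun x => by rw [hβ', A.bracket_self, map_zero])
  have hsymm : N.IsSymm := hsym fun x => by
    have : β x = P.conj (A.bracket (P.symm x)) := by ext; simp [hβ', LinearEquiv.conj_apply]
    rw [this, LinearMap.trace_conj', hA]
  have hH : N.IsHermitian := by
    rw [Matrix.IsHermitian, conjTranspose_eq_transpose_of_trivial]; exact hsymm
  obtain ⟨U, d, hUU, hspec⟩ : ∃ (U : Matrix (Fin 3) (Fin 3) ℝ) (d : Fin 3 → ℝ), Uᵀ * U = 1 ∧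
      N = U * diagonal d * Uᵀ := by
    refine ⟨hH.eigenvectorUnitary.1, hH.eigenvalues, ?_, ?_⟩
    · have := Unitary.coe_star_mul_self hH.eigenvectorUnitary
      rwa [star_eq_conjTranspose, conjTranspose_eq_transpose_of_trivial] at this
    · have := hH.spectral_theorem
      rw [Unitary.conjStarAlgAut_apply, star_eq_conjTranspose,
        conjTranspose_eq_transpose_of_trivial] at this
      exact this
  have hUU' : U * Uᵀ = 1 := mul_eq_one_comm.1 hUU
  let Q : (Fin 3 → ℝ) ≃ₗ[ℝ] (Fin 3 → ℝ) :=
    LinearEquiv.ofLinearMap (toLin' Uᵀ) (toLin' U)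
      (by rw [← toLin'_mul, hUU, toLin'_one]) (by rw [← toLin'_mul, hUU', toLin'_one])
  have hQ : ∀ x, Q x = Uᵀ *ᵥ x := fun _ => rfl
  refine ⟨U.det • d, P.trans Q, fun x y => ?_, fun x y => ?_⟩
  · have h1 : P (A.bracket x y) = N *ᵥ crossProduct (P x) (P y) := by
      rw [← hN, hβ']; simp
    have hback : ∀ z, z = U *ᵥ (Uᵀ *ᵥ z) := fun z => by rw [mulVec_mulVec, hUU', one_mulVec]
    simp only [LinearEquiv.trans_apply, hQ, h1]
    have h2 := transpose_mulVec_cross U (Uᵀ *ᵥ P x) (Uᵀ *ᵥ P y)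
    rw [← hback, ← hback] at h2
    rw [hspec, mulVec_mulVec, ← Matrix.mul_assoc, ← Matrix.mul_assoc, hUU, Matrix.one_mul,
      ← mulVec_mulVec, h2]
    ext i
    simp [mulVec_diagonal]
    ring
  · simp only [LinearEquiv.trans_apply, hQ, hP]
    rw [mulVec_transpose, ← dotProduct_mulVec, mulVec_mulVec, hUU', one_mulVec]

theorem IsMilnorFrame.isomorphic {A : MetricLieAlgebra} {a : Fin 3 → ℝ}
    {L : (Fin 3 → ℝ) ≃ₗ[ℝ] (Fin 3 → ℝ)} (h : A.IsMilnorFrame a L) :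
    A.IsomorphicUpToScaling (milnorAlgebra a) :=
  ⟨L, 1, one_pos, h.map_bracket, fun x y => by simp [h.metric_eq]⟩

theorem IsMilnorFrame.ne_zero {A : MetricLieAlgebra} {a : Fin 3 → ℝ}
    {L : (Fin 3 → ℝ) ≃ₗ[ℝ] (Fin 3 → ℝ)} (h : A.IsMilnorFrame a L) (hA : A.IsNonabelian) :
    a ≠ 0 := by
  rintro rfl
  obtain ⟨x, y, hxy⟩ := hA
  apply hxy
  apply L.injective
  rw [h.map_bracket, zero_mul, map_zero]

theorem IsomorphicUpToScaling.symm {A B : MetricLieAlgebra} (h : A.IsomorphicUpToScaling B) :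
    B.IsomorphicUpToScaling A := by
  obtain ⟨L, c, hc, hb, hm⟩ := h
  refine ⟨L.symm, c⁻¹, inv_pos.2 hc, fun x y => ?_, fun x y => ?_⟩
  · apply L.injective; simp [hb]
  · rw [hm]; simp [hc.ne']

theorem IsomorphicUpToScaling.trans {A B C : MetricLieAlgebra} (h : A.IsomorphicUpToScaling B)
    (h' : B.IsomorphicUpToScaling C) : A.IsomorphicUpToScaling C := by
  obtain ⟨L, c, hc, hb, hm⟩ := h
  obtain ⟨L', c', hc', hb', hm'⟩ := h'
  refine ⟨L.trans L', c * c', mul_pos hc hc', fun x y => ?_, fun x y => ?_⟩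
  · simp [hb, hb']
  · simp [hm, hm', mul_assoc]

end MetricLieAlgebra

/-! ### Pairs of orthonormal frames with Milnor structure constants -/

/-- The numbers `μᵢ = (a₁ + a₂ + a₃) / 2 - aᵢ`. -/
noncomputable def milnorMu (a : Fin 3 → ℝ) (i : Fin 3) : ℝ := (a 0 + a 1 + a 2) / 2 - a i

/-- The skew matrix of a vector. -/
def skewMatrix (p : Fin 3 → ℝ) : Matrix (Fin 3) (Fin 3) ℝ :=
  !![0, p 2, -p 1; -p 2, 0, p 0; p 1, -p 0, 0]

open Matrix

/-- The matrix, in the frame of rows of the orthogonal matrix `A`, of the operator with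
eigenvalues `μᵢ` in the standard frame; the sign makes it independent of the orientation. -/
noncomputable def rotatedMu (A : Matrix (Fin 3) (Fin 3) ℝ) (b : Fin 3 → ℝ) :
    Matrix (Fin 3) (Fin 3) ℝ :=
  A.det • (A * diagonal (milnorMu b) * Aᵀ)

/-- The difference of the connection forms of the two frames. -/
noncomputable def connDiff (A : Matrix (Fin 3) (Fin 3) ℝ) (a b : Fin 3 → ℝ) :
    Matrix (Fin 3) (Fin 3) ℝ :=
  diagonal (milnorMu a) - rotatedMu A b

theorem adjugate_of_orthogonal {A : Matrix (Fin 3) (Fin 3) ℝ} (hA : A * Aᵀ = 1) :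
    A.adjugate = A.det • Aᵀ := by
  have hA' : Aᵀ * A = 1 := mul_eq_one_comm.1 hA
  calc A.adjugate = Aᵀ * (A * A.adjugate) := by rw [← Matrix.mul_assoc, hA', Matrix.one_mul]
    _ = _ := by rw [mul_adjugate, Matrix.mul_smul, Matrix.mul_one]

theorem det_mul_self_of_orthogonal {A : Matrix (Fin 3) (Fin 3) ℝ} (hA : A * Aᵀ = 1) :
    A.det * A.det = 1 := by
  have := congrArg det hA
  rwa [det_mul, det_transpose, det_one] at this

theorem rotatedMu_isSymm (A : Matrix (Fin 3) (Fin 3) ℝ) (b : Fin 3 → ℝ) :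
    (rotatedMu A b).IsSymm := by
  simp [rotatedMu, Matrix.IsSymm, transpose_mul, Matrix.mul_assoc]

/-- Since `b i` is the sum of all `μ j` minus `μ i`, the structure constants are recovered from the
`μ`-matrix by a formula that survives conjugation. -/
theorem rotatedMu_add {A : Matrix (Fin 3) (Fin 3) ℝ} (hA : A * Aᵀ = 1) (b : Fin 3 → ℝ) :
    A.det • (A * diagonal b * Aᵀ) = (rotatedMu A b).trace • 1 - rotatedMu A b := by
  have hA' : Aᵀ * A = 1 := mul_eq_one_comm.1 hA
  have h1 : diagonal b = ((b 0 + b 1 + b 2) / 2) • (1 : Matrix (Fin 3) (Fin 3) ℝ) -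
      diagonal (milnorMu b) := by
    ext i j
    by_cases h : i = j
    · subst h; simp [milnorMu]
    · simp [h]
  have h2 : (rotatedMu A b).trace = A.det * ((b 0 + b 1 + b 2) / 2) := by
    rw [rotatedMu, trace_smul, trace_mul_comm, ← Matrix.mul_assoc, hA', Matrix.one_mul,
      trace_diagonal, Fin.sum_univ_three, smul_eq_mul]
    simp only [milnorMu]
    ring
  rw [h2, h1, Matrix.mul_sub, Matrix.sub_mul, smul_sub, ← rotatedMu, Matrix.mul_smul,
    Matrix.mul_one, Matrix.smul_mul, hA, smul_smul]

/-- The derivatives of the transition matrix of two orthonormal frames are determined by the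
structure constants of the frames. -/
theorem transition_derivative {A : Matrix (Fin 3) (Fin 3) ℝ} (hA : A * Aᵀ = 1)
    {a b : Fin 3 → ℝ} {D : Fin 3 → Matrix (Fin 3) (Fin 3) ℝ}
    (hD : ∀ k, D k * Aᵀ + A * (D k)ᵀ = 0)
    (h0 : ∀ l, D 1 2 l - D 2 1 l + b l * crossProduct (A 1) (A 2) l = a 0 * A 0 l)
    (h1 : ∀ l, D 2 0 l - D 0 2 l + b l * crossProduct (A 2) (A 0) l = a 1 * A 1 l)
    (h2 : ∀ l, D 0 1 l - D 1 0 l + b l * crossProduct (A 0) (A 1) l = a 2 * A 2 l) (k : Fin 3) :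
    D k = skewMatrix (connDiff A a b k) * A := by
  have hA' : Aᵀ * A = 1 := mul_eq_one_comm.1 hA
  set O : Fin 3 → Matrix (Fin 3) (Fin 3) ℝ := fun k => D k * Aᵀ with hO
  have hskew : ∀ k i j, O k i j = - O k j i := by
    intro k i j
    have h := congrFun (congrFun (hD k) i) j
    have e : A * (D k)ᵀ = (O k)ᵀ := by simp [hO, transpose_mul]
    rw [e] at h
    simp only [Matrix.add_apply, transpose_apply, Matrix.zero_apply] at h
    linarith
  have hcof := adjugate_of_orthogonal hA
  set S := A.det • (A * diagonal b * Aᵀ) with hS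
  have hSe : ∀ i q, S i q = A.det * ∑ l, A i l * b l * A q l := by
    intro i q
    simp [hS, Matrix.mul_apply, diagonal_apply]
  have hAe : ∀ i q, ∑ l, A i l * A q l = if i = q then 1 else 0 := by
    intro i q
    have := congrFun (congrFun hA i) q
    simpa [Matrix.mul_apply, one_apply] using this
  have hOe : ∀ k i q, O k i q = ∑ l, D k i l * A q l := by
    intro k i q; simp [hO, Matrix.mul_apply]
  have c0 : ∀ l, crossProduct (A 1) (A 2) l = A.det * A 0 l := by
    intro l
    have := congrFun (congrFun hcof l) 0
    rw [adjugate_fin_three] at this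
    fin_cases l <;> simp [cross_apply] at this ⊢ <;> linarith
  have c1 : ∀ l, crossProduct (A 2) (A 0) l = A.det * A 1 l := by
    intro l
    have := congrFun (congrFun hcof l) 1
    rw [adjugate_fin_three] at this
    fin_cases l <;> simp [cross_apply] at this ⊢ <;> linarith
  have c2 : ∀ l, crossProduct (A 0) (A 1) l = A.det * A 2 l := by
    intro l
    have := congrFun (congrFun hcof l) 2
    rw [adjugate_fin_three] at this
    fin_cases l <;> simp [cross_apply] at this ⊢ <;> linarith
  have hbr : ∀ (i j n : Fin 3), (∀ l, D i j l - D j i l + b l * (A.det * A n l) = a n * A n l) →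
      ∀ q, O i j q - O j i q + S n q = a n * if n = q then 1 else 0 := by
    intro i j n h q
    rw [hOe, hOe, hSe, ← hAe, Finset.mul_sum, Finset.mul_sum, ← Finset.sum_sub_distrib,
      ← Finset.sum_add_distrib]
    exact Finset.sum_congr rfl fun l _ => by linear_combination (A q l) * h l
  have e0 := hbr 1 2 0 (fun l => by rw [← c0]; exact h0 l)
  have e1 := hbr 2 0 1 (fun l => by rw [← c1]; exact h1 l)
  have e2 := hbr 0 1 2 (fun l => by rw [← c2]; exact h2 l)
  have hR : rotatedMu A b = (S.trace / 2) • 1 - S := by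
    have h := rotatedMu_add hA b
    have ht : S.trace = 2 * (rotatedMu A b).trace := by
      rw [hS, h, trace_sub, trace_smul, trace_one]
      simp; ring
    rw [hS] at ht ⊢
    rw [ht, h]
    module
  have hSs : ∀ i j, S i j = S j i := by
    intro i j; rw [hSe, hSe]; congr 1; exact Finset.sum_congr rfl fun l _ => by ring
  -- The three skew matrices `O k` have nine independent entries, and the three bracket equations
  -- are nine linear equations for them. This is the uniqueness of a torsion-free metric connection.
  have key : O k = skewMatrix (connDiff A a b k) := by
    have s01 := hSs 0 1
    have s02 := hSs 0 2
    have s12 := hSs 1 2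
    have t : S.trace = S 0 0 + S 1 1 + S 2 2 := by simp [trace, Fin.sum_univ_three]
    have hd : ∀ k i, O k i i = 0 := fun k i => by have := hskew k i i; linarith
    have k00 := e0 0; have k01 := e0 1; have k02 := e0 2
    have k10 := e1 0; have k11 := e1 1; have k12 := e1 2
    have k20 := e2 0; have k21 := e2 1; have k22 := e2 2
    simp [hd] at k00 k01 k02 k10 k11 k12 k20 k21 k22
    have q0 := hskew 0; have q1 := hskew 1; have q2 := hskew 2
    have q001 := q0 1 0; have q002 := q0 2 0; have q012 := q0 2 1
    have q101 := q1 1 0; have q102 := q1 2 0; have q112 := q1 2 1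
    have q201 := q2 1 0; have q202 := q2 2 0; have q212 := q2 2 1
    ext i j
    rw [connDiff, hR]
    fin_cases k <;> fin_cases i <;> fin_cases j <;>
      simp [skewMatrix, milnorMu, t, hd] <;> linarith
  rw [← key, hO, Matrix.mul_assoc, hA', Matrix.mul_one]

/-- The compatibility equations of the connection forms say that the two frames have the same
curvature. -/
theorem adjugate_eq_of_compatibility {R P : Matrix (Fin 3) (Fin 3) ℝ} {a : Fin 3 → ℝ}
    (hR : R.IsSymm) (hP : P = diagonal (milnorMu a) - R)
    {DR : Fin 3 → Matrix (Fin 3) (Fin 3) ℝ}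
    (hDR : ∀ m, DR m = skewMatrix (P m) * R + R * (skewMatrix (P m))ᵀ)
    (h0 : skewMatrix (-DR 1 2) - skewMatrix (-DR 2 1) + (skewMatrix (P 2) * skewMatrix (P 1) -
      skewMatrix (P 1) * skewMatrix (P 2)) = a 0 • skewMatrix (P 0))
    (h1 : skewMatrix (-DR 2 0) - skewMatrix (-DR 0 2) + (skewMatrix (P 0) * skewMatrix (P 2) -
      skewMatrix (P 2) * skewMatrix (P 0)) = a 1 • skewMatrix (P 1))
    (h2 : skewMatrix (-DR 0 1) - skewMatrix (-DR 1 0) + (skewMatrix (P 1) * skewMatrix (P 0) -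
      skewMatrix (P 0) * skewMatrix (P 1)) = a 2 • skewMatrix (P 2)) :
    R.adjugate = (diagonal (milnorMu a)).adjugate := by
  have r10 : R 1 0 = R 0 1 := congrFun (congrFun hR 0) 1
  have r20 : R 2 0 = R 0 2 := congrFun (congrFun hR 0) 2
  have r21 : R 2 1 = R 1 2 := congrFun (congrFun hR 1) 2
  -- Both sides of each compatibility equation are skew, so these three entries carry all of its
  -- content.
  have key : ∀ {X Y : Matrix (Fin 3) (Fin 3) ℝ}, X = Y → X 1 2 = Y 1 2 ∧ X 2 0 = Y 2 0 ∧
    X 0 1 = Y 0 1 := by rintro X _ rfl; exact ⟨rfl, rfl, rfl⟩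
  obtain ⟨e00, e01, e02⟩ := key h0
  obtain ⟨e10, e11, e12⟩ := key h1
  obtain ⟨e20, e21, e22⟩ := key h2
  simp [hDR, hP, skewMatrix, Matrix.mul_apply, Fin.sum_univ_three, vecMul, dotProduct, r10, r20, r21,
    milnorMu] at e00 e01 e02 e10 e11 e12 e20 e21 e22
  rw [adjugate_fin_three, adjugate_fin_three]
  ext i j
  fin_cases i <;> fin_cases j <;> simp [r10, r20, r21, milnorMu]
  · linear_combination (1 / 2) * (e11 + e22)
  · linear_combination (-1 / 2) * (e01)
  · linear_combination (-1 / 2) * (e02)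
  · linear_combination (-1 / 2) * (e01)
  · linear_combination (1 / 2) * (e00 + e22)
  · linear_combination (-1 / 2) * (e12)
  · linear_combination (-1 / 2) * (e02)
  · linear_combination (-1 / 2) * (e12)
  · linear_combination (1 / 2) * (e00 + e11)

/-- By `rotatedMu_add` the matrices of structure constants are conjugate up to a sign, which the
invariant ignores. -/
theorem milnorInvariant_eq_of_rotatedMu {A : Matrix (Fin 3) (Fin 3) ℝ} (hA : A * Aᵀ = 1)
    {a b : Fin 3 → ℝ} {s : ℝ} (hs : s * s = 1) (h : rotatedMu A b = s • diagonal (milnorMu a)) :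
    milnorInvariant a = milnorInvariant b := by
  have hA' : Aᵀ * A = 1 := mul_eq_one_comm.1 hA
  have hdet := det_mul_self_of_orthogonal hA
  have h1 := rotatedMu_add hA b
  have h2 : (s • diagonal (milnorMu a)).trace • (1 : Matrix (Fin 3) (Fin 3) ℝ) -
      s • diagonal (milnorMu a) = s • diagonal a := by
    ext i j
    by_cases hij : i = j
    · subst hij
      simp [trace_smul, trace_diagonal, Fin.sum_univ_three, milnorMu]; ring
    · simp [hij]
  rw [h, h2] at h1
  have h0 : s * A.det ≠ 0 := by
    intro h0
    have : (s * A.det) * (s * A.det) = 1 := by linear_combination hs + s * s * hdet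
    rw [h0] at this; simp at this
  refine milnorInvariant_eq_of_conj h0 (M := Aᵀ) (N := A) hA' ?_
  rw [mul_smul, h1, smul_smul, hs, one_smul]

/-- Vanishing of all products `μ j * μ k` is the Ricci-flat case. At most one `μ` is nonzero, so the
constants are a multiple of a permutation of `(1, 1, 0)`. Curvature says nothing more here, but
there is only one class. -/
theorem milnorInvariant_of_adjugate_eq_zero {a : Fin 3 → ℝ} (ha : a ≠ 0)
    (h : (diagonal (milnorMu a)).adjugate = 0) : milnorInvariant a = (2, 0, 0) := by
  have h00 := congrFun (congrFun h 0) 0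
  have h11 := congrFun (congrFun h 1) 1
  have h22 := congrFun (congrFun h 2) 2
  rw [adjugate_fin_three] at h00 h11 h22
  simp at h00 h11 h22
  set x := milnorMu a 0 with hx
  set y := milnorMu a 1 with hy
  set z := milnorMu a 2 with hz
  have e0 : a 0 = y + z := by simp only [hy, hz, milnorMu]; ring
  have e1 : a 1 = x + z := by simp only [hx, hz, milnorMu]; ring
  have e2 : a 2 = x + y := by simp only [hx, hy, milnorMu]; ring
  have hyz : y * z = 0 := mul_eq_zero.2 h00
  have hxz : x * z = 0 := mul_eq_zero.2 h11
  have hxy : x * y = 0 := mul_eq_zero.2 h22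
  have hN := sum_sq_pos ha
  have hN2 : a 0 ^ 2 + a 1 ^ 2 + a 2 ^ 2 = 2 * (x + y + z) ^ 2 := by
    rw [e0, e1, e2]; linear_combination (-2) * (hyz + hxz + hxy)
  have hp : a 0 * a 1 * a 2 = 0 := by
    rw [e0, e1, e2]
    linear_combination (x + y + 2 * z) * hxy + (y + z) * hyz + (x + z) * hxz
  have hs : (a 0 + a 1 + a 2) ^ 2 = 4 * (x + y + z) ^ 2 := by rw [e0, e1, e2]; ring
  rw [hN2] at hN
  have : (x + y + z) ^ 2 ≠ 0 := by
    intro h0; rw [h0] at hN; simp at hN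
  simp only [milnorInvariant, hN2, hp, hs]
  rw [mul_div_mul_right _ _ this]
  norm_num

/-- The second derivative of `h` is symmetric, so only the derivatives of the fields survive. -/
theorem fderiv_commutator {E : Type*} [NormedAddCommGroup E] [NormedSpace ℝ E] {h : E → ℝ}
    {X Y : E → E} {x : E} (hh : ContDiffAt ℝ 2 h x) (hX : DifferentiableAt ℝ X x)
    (hY : DifferentiableAt ℝ Y x) :
    fderiv ℝ (fun y => fderiv ℝ h y (Y y)) x (X x) -
      fderiv ℝ (fun y => fderiv ℝ h y (X y)) x (Y x) =
        fderiv ℝ h x (VectorField.lieBracket ℝ X Y x) := by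
  have hd : DifferentiableAt ℝ (fderiv ℝ h) x :=
    (hh.fderiv_right (m := 1) (by norm_num)).differentiableAt one_ne_zero
  have hsym : IsSymmSndFDerivAt ℝ h x := hh.isSymmSndFDerivAt (by simp)
  rw [fderiv_clm_apply hd hY, fderiv_clm_apply hd hX]
  simp [VectorField.lieBracket, hsym.eq (X x) (Y x)]

/-! ### Transition matrix of two Milnor frames: first derivatives -/

section Frames

variable {E : Type*} [NormedAddCommGroup E] [NormedSpace ℝ E]

/-- Vector fields on an open set with the brackets of a Milnor frame. -/
structure IsMilnorFrameOn (V : Fin 3 → E → E) (a : Fin 3 → ℝ) (U : Set E) : Prop where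
  contDiffAt : ∀ i, ∀ x ∈ U, ContDiffAt ℝ 2 (V i) x
  bracket₀ : ∀ x ∈ U, VectorField.lieBracket ℝ (V 1) (V 2) x = a 0 • V 0 x
  bracket₁ : ∀ x ∈ U, VectorField.lieBracket ℝ (V 2) (V 0) x = a 1 • V 1 x
  bracket₂ : ∀ x ∈ U, VectorField.lieBracket ℝ (V 0) (V 1) x = a 2 • V 2 x

variable {U : Set E} {V W : Fin 3 → E → E} {A : E → Matrix (Fin 3) (Fin 3) ℝ} {a b : Fin 3 → ℝ}

theorem lieBracket_of_transition (hU : IsOpen U) (hW : IsMilnorFrameOn W b U)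
    (hA : ∀ i j, ∀ x ∈ U, ContDiffAt ℝ 2 (fun y => A y i j) x)
    (hVW : ∀ x ∈ U, ∀ i, V i x = ∑ j, A x i j • W j x) {x : E} (hx : x ∈ U) (i j : Fin 3) :
    VectorField.lieBracket ℝ (V i) (V j) x =
      ∑ l, (fderiv ℝ (fun y => A y j l) x (V i x) - fderiv ℝ (fun y => A y i l) x (V j x) +
        b l * crossProduct (A x i) (A x j) l) • W l x := by
  have hAd : ∀ i j, DifferentiableAt ℝ (fun y => A y i j) x := fun i j =>
    (hA i j x hx).differentiableAt two_ne_zero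
  have hWd : ∀ i, DifferentiableAt ℝ (W i) x := fun i =>
    (hW.contDiffAt i x hx).differentiableAt two_ne_zero
  have hfd : ∀ i v, fderiv ℝ (V i) x v =
      ∑ l, (A x i l • fderiv ℝ (W l) x v + fderiv ℝ (fun y => A y i l) x v • W l x) := by
    intro i v
    have he : V i =ᶠ[𝓝 x] fun y => ∑ l, A y i l • W l y := by
      filter_upwards [hU.mem_nhds hx] with y hy using hVW y hy i
    rw [he.fderiv_eq, fderiv_fun_sum fun l _ => (hAd i l).fun_smul (hWd l)]
    simp only [_root_.sum_apply]
    refine Finset.sum_congr rfl fun l _ => ?_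
    rw [fderiv_fun_smul (hAd i l) (hWd l)]
    simp
  have b0 := hW.bracket₀ x hx
  have b1 := hW.bracket₁ x hx
  have b2 := hW.bracket₂ x hx
  simp only [VectorField.lieBracket] at b0 b1 b2
  rw [sub_eq_iff_eq_add] at b0 b1 b2
  rw [VectorField.lieBracket, hfd j, hfd i]
  -- The terms in which the fields `W` are differentiated combine to the brackets of `W`.
  have key : ∑ l, A x j l • fderiv ℝ (W l) x (V i x) - ∑ l, A x i l • fderiv ℝ (W l) x (V j x) =
      ∑ l, (b l * crossProduct (A x i) (A x j) l) • W l x := by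
    simp only [hVW x hx i, hVW x hx j, Fin.sum_univ_three, map_add, map_smul, b0, b1, b2,
      cross_apply]
    simp
    module
  simp only [Finset.sum_add_distrib, add_smul, sub_smul, Finset.sum_sub_distrib, ← key]
  abel

/-- Comparing coefficients of `W` in the brackets of `V`, together with the derivative of `A * Aᵀ =
1`, gives the linear system that `transition_derivative` solves. -/
theorem fderiv_transition (hU : IsOpen U) (hV : IsMilnorFrameOn V a U) (hW : IsMilnorFrameOn W b U)
    (hA : ∀ i j, ∀ x ∈ U, ContDiffAt ℝ 2 (fun y => A y i j) x)
    (hind : ∀ x ∈ U, LinearIndependent ℝ fun i => W i x)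
    (hVW : ∀ x ∈ U, ∀ i, V i x = ∑ j, A x i j • W j x) (horth : ∀ x ∈ U, A x * (A x)ᵀ = 1)
    {x : E} (hx : x ∈ U) (k i l : Fin 3) :
    fderiv ℝ (fun y => A y i l) x (V k x) =
      (skewMatrix (connDiff (A x) a b k) * A x) i l := by
  have hAd : ∀ i j, DifferentiableAt ℝ (fun y => A y i j) x := fun i j =>
    (hA i j x hx).differentiableAt two_ne_zero
  have hcomp : ∀ (i j n : Fin 3),
      VectorField.lieBracket ℝ (V i) (V j) x = a n • V n x → ∀ l,
        fderiv ℝ (fun y => A y j l) x (V i x) - fderiv ℝ (fun y => A y i l) x (V j x) +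
        b l * crossProduct (A x i) (A x j) l = a n * A x n l := by
    intro i j n h l
    rw [lieBracket_of_transition hU hW hA hVW hx, hVW x hx n, Finset.smul_sum] at h
    have h' := sub_eq_zero.2 h
    rw [← Finset.sum_sub_distrib] at h'
    simp only [smul_smul, ← sub_smul] at h'
    exact sub_eq_zero.1 (Fintype.linearIndependent_iff.1 (hind x hx) _ h' l)
  have := transition_derivative (horth x hx) (a := a) (b := b)
    (D := fun k => Matrix.of fun i l => fderiv ℝ (fun y => A y i l) x (V k x)) ?_
    (hcomp 1 2 0 (hV.bracket₀ x hx)) (hcomp 2 0 1 (hV.bracket₁ x hx))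
    (hcomp 0 1 2 (hV.bracket₂ x hx)) k
  · exact congrFun (congrFun this i) l
  · intro k
    ext i j
    have he : (fun y => ∑ l, A y i l * A y j l) =ᶠ[𝓝 x]
        fun _ => (1 : Matrix (Fin 3) (Fin 3) ℝ) i j := by
      filter_upwards [hU.mem_nhds hx] with y hy
      rw [← horth y hy, mul_apply]; rfl
    have h0 : fderiv ℝ (fun y => ∑ l, A y i l * A y j l) x (V k x) = 0 := by
      rw [he.fderiv_eq]; simp
    rw [fderiv_fun_sum fun l _ => (hAd i l).fun_mul (hAd j l)] at h0
    simp only [fderiv_fun_mul (hAd i _) (hAd j _)] at h0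
    simp only [Matrix.add_apply, Matrix.mul_apply, transpose_apply, of_apply, Matrix.zero_apply,
      ← Finset.sum_add_distrib]
    rw [← h0]
    simp only [_root_.sum_apply]
    refine Finset.sum_congr rfl fun l _ => ?_
    simp; ring

end Frames

/-! ### Second derivatives and comparison of curvature -/

section Frames

variable {E : Type*} [NormedAddCommGroup E] [NormedSpace ℝ E]
variable {U : Set E} {V W : Fin 3 → E → E} {A : E → Matrix (Fin 3) (Fin 3) ℝ} {a b : Fin 3 → ℝ}

theorem rotatedMu_apply (A : Matrix (Fin 3) (Fin 3) ℝ) (b : Fin 3 → ℝ) (i j : Fin 3) :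
    rotatedMu A b i j = A.det * ∑ l, A i l * milnorMu b l * A j l := by
  simp [rotatedMu, Matrix.mul_apply, diagonal_apply]

theorem differentiableAt_det {x : E}
    (hA : ∀ i j, DifferentiableAt ℝ (fun y => A y i j) x) :
    DifferentiableAt ℝ (fun y => (A y).det) x := by
  simp only [det_fin_three]
  have h := fun i j => hA i j
  fun_prop

theorem differentiableAt_rotatedMu {x : E}
    (hA : ∀ i j, DifferentiableAt ℝ (fun y => A y i j) x) (b : Fin 3 → ℝ) (i j : Fin 3) :
    DifferentiableAt ℝ (fun y => rotatedMu (A y) b i j) x := by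
  simp only [rotatedMu_apply]
  have h1 := differentiableAt_det hA
  have h := fun i j => hA i j
  fun_prop

/-- The determinant squares to one, so its derivative vanishes and only the two factors `A`
contribute. -/
theorem fderiv_rotatedMu (hU : IsOpen U) (horth : ∀ x ∈ U, A x * (A x)ᵀ = 1) {x : E} (hx : x ∈ U)
    (hA : ∀ i j, DifferentiableAt ℝ (fun y => A y i j) x) {v : E} {O : Matrix (Fin 3) (Fin 3) ℝ}
    (hO : ∀ i l, fderiv ℝ (fun y => A y i l) x v = (O * A x) i l) (b : Fin 3 → ℝ) (i j : Fin 3) :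
    fderiv ℝ (fun y => rotatedMu (A y) b i j) x v =
      (O * rotatedMu (A x) b + rotatedMu (A x) b * Oᵀ) i j := by
  have hdd := differentiableAt_det hA
  have hdet : fderiv ℝ (fun y => (A y).det) x v = 0 := by
    have he : (fun y => (A y).det * (A y).det) =ᶠ[𝓝 x] fun _ => 1 := by
      filter_upwards [hU.mem_nhds hx] with y hy using det_mul_self_of_orthogonal (horth y hy)
    have h0 : fderiv ℝ (fun y => (A y).det * (A y).det) x v = 0 := by rw [he.fderiv_eq]; simp
    rw [fderiv_fun_mul hdd hdd] at h0
    have h1 := det_mul_self_of_orthogonal (horth x hx)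
    simp at h0
    rcases h0 with h0 | h0
    · rw [h0] at h1; simp at h1
    · exact h0
  have hterm : ∀ l, DifferentiableAt ℝ (fun y => A y i l * milnorMu b l * A y j l) x := fun l =>
    ((hA i l).mul_const _).fun_mul (hA j l)
  simp only [rotatedMu_apply]
  rw [fderiv_fun_mul hdd (DifferentiableAt.fun_sum fun l _ => hterm l),
    fderiv_fun_sum fun l _ => hterm l]
  simp only [fderiv_fun_mul ((hA i _).mul_const _) (hA j _), fderiv_mul_const (hA i _)]
  simp only [_root_.add_apply, _root_.smul_apply, hdet,
    _root_.sum_apply, hO, smul_eq_mul]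
  simp only [Matrix.add_apply, Matrix.mul_apply, transpose_apply, rotatedMu_apply,
    Fin.sum_univ_three]
  ring

/-- The first derivatives of `A` are functions of `A` itself, hence so are the second ones. Their
symmetry, tested by `fderiv_commutator`, becomes the compatibility equations once the invertible
factor `A` is cancelled. The diagonal adjugate has entries `μ j * μ k`, half the Ricci curvatures.
-/
theorem adjugate_rotatedMu (hU : IsOpen U) (hV : IsMilnorFrameOn V a U) (hW : IsMilnorFrameOn W b U)
    (hA : ∀ i j, ∀ x ∈ U, ContDiffAt ℝ 2 (fun y => A y i j) x)
    (hind : ∀ x ∈ U, LinearIndependent ℝ fun i => W i x)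
    (hVW : ∀ x ∈ U, ∀ i, V i x = ∑ j, A x i j • W j x) (horth : ∀ x ∈ U, A x * (A x)ᵀ = 1)
    {x : E} (hx : x ∈ U) :
    (rotatedMu (A x) b).adjugate = (diagonal (milnorMu a)).adjugate := by
  have hAd : ∀ i j, DifferentiableAt ℝ (fun y => A y i j) x := fun i j =>
    (hA i j x hx).differentiableAt two_ne_zero
  have hVd : ∀ i, DifferentiableAt ℝ (V i) x := fun i =>
    (hV.contDiffAt i x hx).differentiableAt two_ne_zero
  have hAA : (A x) * (A x)ᵀ = 1 := horth x hx
  set R := rotatedMu (A x) b with hR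
  set P := connDiff (A x) a b with hP
  set DR : Fin 3 → Matrix (Fin 3) (Fin 3) ℝ := fun m =>
    skewMatrix (P m) * R + R * (skewMatrix (P m))ᵀ with hDR
  have hfA : ∀ k i l, fderiv ℝ (fun y => A y i l) x (V k x) = (skewMatrix (P k) * A x) i l :=
    fun k i l => fderiv_transition hU hV hW hA hind hVW horth hx k i l
  have hfR : ∀ m i j, fderiv ℝ (fun y => rotatedMu (A y) b i j) x (V m x) = DR m i j :=
    fun m i j => fderiv_rotatedMu hU horth hx hAd (hfA m) b i j
  have hRd := differentiableAt_rotatedMu hAd b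
  have hPd : ∀ k j, DifferentiableAt ℝ (fun y => connDiff (A y) a b k j) x := fun k j => by
    simp only [connDiff, Matrix.sub_apply]
    exact (differentiableAt_const _).sub (hRd k j)
  have hfP : ∀ m k j, fderiv ℝ (fun y => connDiff (A y) a b k j) x (V m x) = - DR m k j := by
    intro m k j
    simp only [connDiff, Matrix.sub_apply]
    rw [fderiv_const_sub, _root_.neg_apply, hfR]
  have hSd : ∀ k i q, DifferentiableAt ℝ (fun y => skewMatrix (connDiff (A y) a b k) i q) x := by
    intro k i q
    fin_cases i <;> fin_cases q <;> simp [skewMatrix] <;> apply hPd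
  have hfS : ∀ m k i q, fderiv ℝ (fun y => skewMatrix (connDiff (A y) a b k) i q) x (V m x) =
      skewMatrix (- DR m k) i q := by
    intro m k i q
    fin_cases i <;> fin_cases q <;> simp [skewMatrix, hfP, fderiv_fun_neg]
  have hsecond : ∀ m k i l, fderiv ℝ (fun y => fderiv ℝ (fun z => A z i l) y (V k y)) x (V m x) =
      (skewMatrix (- DR m k) * A x + skewMatrix (P k) * (skewMatrix (P m) * A x)) i l := by
    intro m k i l
    have he : (fun y => fderiv ℝ (fun z => A z i l) y (V k y)) =ᶠ[𝓝 x]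
        fun y => ∑ q, skewMatrix (connDiff (A y) a b k) i q * A y q l := by
      filter_upwards [hU.mem_nhds hx] with y hy
      rw [fderiv_transition hU hV hW hA hind hVW horth hy k i l, Matrix.mul_apply]
    rw [he.fderiv_eq, fderiv_fun_sum fun q _ => (hSd k i q).fun_mul (hAd q l)]
    simp only [fderiv_fun_mul (hSd k i _) (hAd _ l)]
    simp only [_root_.sum_apply, _root_.add_apply,
      _root_.smul_apply, hfA, hfS, smul_eq_mul]
    rw [Matrix.add_apply, Matrix.mul_apply, Matrix.mul_apply, ← Finset.sum_add_distrib]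
    exact Finset.sum_congr rfl fun q _ => by ring
  have hcomm : ∀ m k n, VectorField.lieBracket ℝ (V m) (V k) x = a n • V n x →
      skewMatrix (- DR m k) - skewMatrix (- DR k m) + (skewMatrix (P k) * skewMatrix (P m) -
        skewMatrix (P m) * skewMatrix (P k)) = a n • skewMatrix (P n) := by
    intro m k n h
    have hm : (skewMatrix (- DR m k) - skewMatrix (- DR k m) +
        (skewMatrix (P k) * skewMatrix (P m) - skewMatrix (P m) * skewMatrix (P k))) * A x =
        (a n • skewMatrix (P n)) * A x := by
      ext i l
      have := fderiv_commutator (hA i l x hx) (hVd m) (hVd k)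
      rw [hsecond, hsecond, h, map_smul, hfA, smul_eq_mul] at this
      rw [Matrix.smul_mul, Matrix.smul_apply, smul_eq_mul, ← this]
      simp only [Matrix.add_mul, Matrix.sub_mul, Matrix.mul_assoc, Matrix.add_apply,
        Matrix.sub_apply]
      ring
    calc _ = (_ * A x) * (A x)ᵀ := by rw [Matrix.mul_assoc, hAA, Matrix.mul_one]
      _ = _ := by rw [hm, Matrix.mul_assoc, hAA, Matrix.mul_one]
  exact adjugate_eq_of_compatibility (rotatedMu_isSymm _ _) rfl (fun m => rfl)
    (hcomm 1 2 0 (hV.bracket₀ x hx)) (hcomm 2 0 1 (hV.bracket₁ x hx))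
    (hcomm 0 1 2 (hV.bracket₂ x hx))

/-- The hypotheses say that `R` kills the `i`-th row of the skew matrix, whose entries off `i` are,
up to sign, the `p j` with `j ≠ i`. The block of `R` complementary to `i` is invertible, because its
determinant is `R.adjugate i i`. -/
theorem skewMatrix_row_eq_zero {R : Matrix (Fin 3) (Fin 3) ℝ} {p : Fin 3 → ℝ} {i : Fin 3}
    (hR : ∀ j, R j i = 0) (hadj : R.adjugate i i ≠ 0)
    (h : ∀ j, (skewMatrix p * R + R * (skewMatrix p)ᵀ) j i = 0) : ∀ j, j ≠ i → p j = 0 := by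
  rw [adjugate_fin_three] at hadj
  have h0 := h 0
  have h1 := h 1
  have h2 := h 2
  have r0 := hR 0
  have r1 := hR 1
  have r2 := hR 2
  have key : ∀ (u v w z x y : ℝ), u * v - w * z ≠ 0 → u * x = w * y → z * x = v * y →
      x = 0 ∧ y = 0 := by
    intro u v w z x y h e1 e2
    constructor
    · exact (mul_eq_zero.1 (by linear_combination v * e1 - w * e2 :
        (u * v - w * z) * x = 0)).resolve_left h
    · exact (mul_eq_zero.1 (by linear_combination z * e1 - u * e2 :
        (u * v - w * z) * y = 0)).resolve_left h
  fin_cases i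
  · simp [Matrix.mul_apply, Fin.sum_univ_three, skewMatrix, vecMul, dotProduct]
      at h0 h1 h2 r0 r1 r2 hadj
    simp only [r0, r1, r2, mul_zero, neg_zero, add_zero, zero_add] at h0 h1 h2
    obtain ⟨e1, e2⟩ := key (R 1 1) (R 2 2) (R 1 2) (R 2 1) (p 2) (p 1) hadj
      (by linarith) (by linarith)
    intro j hj
    fin_cases j
    · exact absurd rfl hj
    · exact e2
    · exact e1
  · simp [Matrix.mul_apply, Fin.sum_univ_three, skewMatrix, vecMul, dotProduct]
      at h0 h1 h2 r0 r1 r2 hadj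
    simp only [r0, r1, r2, mul_zero, neg_zero, add_zero, zero_add] at h0 h1 h2
    obtain ⟨e1, e2⟩ := key (R 0 0) (R 2 2) (R 0 2) (R 2 0) (p 2) (p 0) hadj
      (by linarith) (by linarith)
    intro j hj
    fin_cases j
    · exact e2
    · exact absurd rfl hj
    · exact e1
  · simp [Matrix.mul_apply, Fin.sum_univ_three, skewMatrix, vecMul, dotProduct]
      at h0 h1 h2 r0 r1 r2 hadj
    simp only [r0, r1, r2, mul_zero, neg_zero, add_zero, zero_add] at h0 h1 h2
    obtain ⟨e1, e2⟩ := key (R 0 0) (R 1 1) (R 0 1) (R 1 0) (p 1) (p 0) hadj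
      (by linarith) (by linarith)
    intro j hj
    fin_cases j
    · exact e2
    · exact e1
    · exact absurd rfl hj

/-- Orthonormal frames of a metric with the brackets of Milnor frames have the same structure
constants up to a permutation and a factor. -/
theorem milnorInvariant_eq_of_frames (hU : IsOpen U) (hne : U.Nonempty) (ha : a ≠ 0) (hb : b ≠ 0)
    (hV : IsMilnorFrameOn V a U) (hW : IsMilnorFrameOn W b U)
    (hA : ∀ i j, ∀ x ∈ U, ContDiffAt ℝ 2 (fun y => A y i j) x)
    (hind : ∀ x ∈ U, LinearIndependent ℝ fun i => W i x)
    (hVW : ∀ x ∈ U, ∀ i, V i x = ∑ j, A x i j • W j x) (horth : ∀ x ∈ U, A x * (A x)ᵀ = 1) :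
    milnorInvariant a = milnorInvariant b := by
  obtain ⟨x, hx⟩ := hne
  have hadj : ∀ y ∈ U, (rotatedMu (A y) b).adjugate = (diagonal (milnorMu a)).adjugate :=
    fun y hy => adjugate_rotatedMu hU hV hW hA hind hVW horth hy
  have hAA : (A x) * (A x)ᵀ = 1 := horth x hx
  have hAA' : (A x)ᵀ * A x = 1 := mul_eq_one_comm.1 hAA
  set M := diagonal (milnorMu a) with hM
  set R := rotatedMu (A x) b with hR
  have hdetadj : ∀ X : Matrix (Fin 3) (Fin 3) ℝ, X.adjugate.det = X.det ^ 2 := fun X => by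
    simp [det_adjugate]
  have hdet2 : R.det ^ 2 = M.det ^ 2 := by rw [← hdetadj, ← hdetadj, hadj x hx]
  -- An invertible `R` is determined by its adjugate up to sign. In rank two the adjugate gives only
  -- the kernel direction and one minor, so derivatives are needed as well. In rank at most one both
  -- metrics are flat.
  by_cases hMd : M.det = 0
  · by_cases hC : M.adjugate = 0
    · rw [milnorInvariant_of_adjugate_eq_zero ha hC, milnorInvariant_of_adjugate_eq_zero hb]
      have hN : diagonal (milnorMu b) = (A x).det • ((A x)ᵀ * R * A x) := by
        rw [hR, rotatedMu, Matrix.mul_smul, Matrix.smul_mul, smul_smul,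
          det_mul_self_of_orthogonal hAA, one_smul]
        calc diagonal (milnorMu b) = ((A x)ᵀ * A x) * diagonal (milnorMu b) * ((A x)ᵀ * A x) := by
              rw [hAA', Matrix.one_mul, Matrix.mul_one]
          _ = _ := by simp only [Matrix.mul_assoc]
      rw [hN, adjugate_smul, adjugate_mul_distrib, adjugate_mul_distrib, hadj x hx, hC]
      simp
    · obtain ⟨i, hi⟩ : ∃ i, M.adjugate i i ≠ 0 := by
        by_contra! hcon
        apply hC
        ext i j
        by_cases hij : i = j
        · subst hij; exact hcon i
        · rw [hM, adjugate_fin_three]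
          fin_cases i <;> fin_cases j <;> simp at hij ⊢
      have hoff : ∀ {X : Matrix (Fin 3) (Fin 3) ℝ}, X.det = 0 → X.adjugate = M.adjugate →
          ∀ j, X j i = 0 := by
        intro X hX hXM j
        have h1 := congrFun (congrFun (mul_adjugate X) j) i
        rw [hX, zero_smul, hXM, Matrix.mul_apply] at h1
        have h2 : ∀ k, k ≠ i → M.adjugate k i = 0 := by
          intro k hk
          rw [hM, adjugate_fin_three]
          fin_cases i <;> fin_cases k <;> simp at hk ⊢
        rw [Finset.sum_eq_single i (fun k _ hk => by rw [h2 k hk, mul_zero]) (by simp)] at h1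
        exact (mul_eq_zero.1 h1).resolve_right hi
      have hRdet : ∀ y ∈ U, (rotatedMu (A y) b).det = 0 := by
        intro y hy
        have : (rotatedMu (A y) b).det ^ 2 = M.det ^ 2 := by rw [← hdetadj, ← hdetadj, hadj y hy]
        rw [hMd] at this
        simpa using this
      have hRi : ∀ y ∈ U, ∀ j, rotatedMu (A y) b j i = 0 := fun y hy =>
        hoff (hRdet y hy) (hadj y hy)
      have hAd : ∀ i j, DifferentiableAt ℝ (fun y => A y i j) x := fun i j =>
        (hA i j x hx).differentiableAt two_ne_zero
      -- Column `i` of the rotated matrix vanishes on all of `U`, so its derivative vanishes too.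
      -- The kernel direction cannot rotate, which kills the remaining entries of the connection
      -- difference.
      have hP : ∀ k j, j ≠ i → connDiff (A x) a b k j = 0 := by
        intro k
        refine skewMatrix_row_eq_zero (R := R) (hRi x hx) (by rw [hadj x hx]; exact hi) fun j => ?_
        rw [← fderiv_rotatedMu hU horth hx hAd
          (fun i l => fderiv_transition hU hV hW hA hind hVW horth hx k i l)]
        have he : (fun y => rotatedMu (A y) b j i) =ᶠ[𝓝 x] fun _ => 0 := by
          filter_upwards [hU.mem_nhds hx] with y hy using hRi y hy j
        rw [he.fderiv_eq]; simp
      have hP0 : connDiff (A x) a b = 0 := by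
        ext k j
        by_cases hj : j = i
        · subst hj
          rw [connDiff, Matrix.sub_apply, ← hM, hoff hMd rfl, hRi x hx]
          simp
        · exact hP k j hj
      refine milnorInvariant_eq_of_rotatedMu hAA (s := 1) (by norm_num) ?_
      rw [one_smul]
      exact (sub_eq_zero.1 hP0).symm
  · obtain ⟨s, hs, hsR⟩ : ∃ s : ℝ, s * s = 1 ∧ R.det = s * M.det := by
      rcases sq_eq_sq_iff_eq_or_eq_neg.1 hdet2 with h | h
      · exact ⟨1, by norm_num, by rw [h, one_mul]⟩
      · exact ⟨-1, by norm_num, by rw [h]; ring⟩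
    refine milnorInvariant_eq_of_rotatedMu hAA hs ?_
    have h1 : R * M.adjugate = (s • M) * M.adjugate := by
      rw [Matrix.smul_mul, mul_adjugate, ← hadj x hx, mul_adjugate, hsR, smul_smul]
    have h2 : (R * M.adjugate) * M = ((s • M) * M.adjugate) * M := by rw [h1]
    rw [Matrix.mul_assoc, Matrix.mul_assoc, adjugate_mul, Matrix.mul_smul, Matrix.mul_smul,
      Matrix.mul_one, Matrix.mul_one] at h2
    exact smul_right_injective _ hMd h2

end Frames

/-! ### Left-invariant frames in coordinates -/

section Coordinates

open VectorField

variable {E : Type*} [NormedAddCommGroup E] [NormedSpace ℝ E] [CompleteSpace E]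
  {H : Type*} [TopologicalSpace H] {I : ModelWithCorners ℝ E H}
  {G : Type*} [TopologicalSpace G] [ChartedSpace H G] [Group G] [LieGroup I (minSmoothness ℝ 3) G]

/-- Pullback commutes with brackets of vector fields, and left-invariant fields have the brackets of
the Lie algebra. -/
theorem isMilnorFrameOn_mpullback {e : Fin 3 → GroupLieAlgebra I G} {b : Fin 3 → ℝ}
    (h0 : ⁅e 1, e 2⁆ = b 0 • e 0) (h1 : ⁅e 2, e 0⁆ = b 1 • e 1) (h2 : ⁅e 0, e 1⁆ = b 2 • e 2)
    {h : E → G} {U : Set E} (hh : ∀ x ∈ U, ContMDiffAt 𝓘(ℝ, E) I 3 h x)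
    (hinv : ∀ x ∈ U, (mfderiv 𝓘(ℝ, E) I h x).IsInvertible) :
    IsMilnorFrameOn (fun i => mpullback 𝓘(ℝ, E) I h (mulInvariantVectorField (e i))) b U := by
  have hM : minSmoothness ℝ 3 = 3 := by simp
  have hM2 : minSmoothness ℝ 2 = 2 := by simp
  have hbr : ∀ i j k, ⁅e i, e j⁆ = b k • e k → ∀ x ∈ U,
      lieBracket ℝ (mpullback 𝓘(ℝ, E) I h (mulInvariantVectorField (e i)))
        (mpullback 𝓘(ℝ, E) I h (mulInvariantVectorField (e j))) x =
        b k • mpullback 𝓘(ℝ, E) I h (mulInvariantVectorField (e k)) x := by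
    intro i j k hij x hx
    have h1 := mpullback_mlieBracket (I := 𝓘(ℝ, E)) (I' := I)
      (V := mulInvariantVectorField (e i)) (W := mulInvariantVectorField (e j))
      (mdifferentiableAt_mulInvariantVectorField _) (mdifferentiableAt_mulInvariantVectorField _)
      (hh x hx) (by rw [hM2]; norm_num)
    rw [← mulInvariantVector_mlieBracket, ← GroupLieAlgebra.bracket_def, hij,
      mulInvariantVectorField_smul, mpullback_const_smul_apply] at h1
    rw [h1, ← mlieBracketWithin_univ, mlieBracketWithin_eq_lieBracketWithin]
    exact (congrFun lieBracketWithin_univ x).symm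
  refine ⟨fun i x hx => ?_, hbr 1 2 0 h0, hbr 2 0 1 h1, hbr 0 1 2 h2⟩
  rw [← contMDiffAt_vectorSpace_iff_contDiffAt]
  have h3 := contMDiffAt_mulInvariantVectorField (I := I) (e i) (g := h x)
  rw [hM2] at h3
  exact ContMDiffAt.mpullback_vectorField_preimage h3 (hh x hx) (hinv x hx) (by norm_num)

end Coordinates

/-! ### Homothetic left-invariant metrics have the same structure constants -/

namespace MetricLieAlgebra

variable {A : MetricLieAlgebra}

/-- The factor `k` is there to absorb the constant of a homothety, so that both frames become
orthonormal for one metric. -/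
theorem exists_scaled_frame {a : Fin 3 → ℝ} {L : (Fin 3 → ℝ) ≃ₗ[ℝ] (Fin 3 → ℝ)}
    (hL : A.IsMilnorFrame a L) (M : A.GroupModel) (k : ℝ) :
    ∃ e : Fin 3 → GroupLieAlgebra (𝓡 3) M.G, ⁅e 1, e 2⁆ = (k • a) 0 • e 0 ∧
      ⁅e 2, e 0⁆ = (k • a) 1 • e 1 ∧ ⁅e 0, e 1⁆ = (k • a) 2 • e 2 ∧
      ∀ i j, A.metric (M.toAlg (e i)) (M.toAlg (e j)) = if i = j then k ^ 2 else 0 := by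
  refine ⟨fun i => M.toAlg.symm (L.symm (k • Pi.single i 1)), ?_, ?_, ?_, fun i j => ?_⟩
  iterate 3
    · apply M.toAlg.injective
      rw [M.map_bracket]
      apply L.injective
      rw [hL.map_bracket]
      simp only [LinearEquiv.apply_symm_apply, map_smul]
      ext i; fin_cases i <;> simp [cross_apply, smul_eq_mul] <;> ring
  · simp only [LinearEquiv.apply_symm_apply, hL.metric_eq]
    by_cases h : i = j
    · subst h; simp; ring
    · simp [h]

/-- The left translation of a tangent vector to the identity, as an element of the Lie algebra. -/
noncomputable def GroupModel.toIdentity (M : A.GroupModel) (p : M.G)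
    (w : TangentSpace (𝓡 3) p) : Fin 3 → ℝ :=
  let τ : TangentSpace (𝓡 3) p → GroupLieAlgebra (𝓡 3) M.G :=
    fun w => mfderiv (𝓡 3) (𝓡 3) (fun y : M.G => p⁻¹ * y) p w
  M.toAlg (τ w)

theorem GroupModel.riemannianMetric_eq (M : A.GroupModel) (p : M.G)
    (u v : TangentSpace (𝓡 3) p) :
    M.riemannianMetric p u v = A.metric (M.toIdentity p u) (M.toIdentity p v) := rfl

theorem GroupModel.toIdentity_add (M : A.GroupModel) (p : M.G)
    (u v : TangentSpace (𝓡 3) p) :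
    M.toIdentity p (u + v) = M.toIdentity p u + M.toIdentity p v :=
  (congrArg M.toAlg (map_add (mfderiv (𝓡 3) (𝓡 3) (fun y : M.G => p⁻¹ * y) p) u v)).trans
    (map_add M.toAlg _ _)

theorem GroupModel.toIdentity_smul (M : A.GroupModel) (p : M.G) (r : ℝ)
    (u : TangentSpace (𝓡 3) p) :
    M.toIdentity p (r • u) = r • M.toIdentity p u :=
  (congrArg M.toAlg (map_smul (mfderiv (𝓡 3) (𝓡 3) (fun y : M.G => p⁻¹ * y) p) r u)).trans
    (map_smul M.toAlg _ _)

instance GroupModel.instLieGroupMinSmoothness (M : A.GroupModel) :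
    LieGroup (𝓡 3) (minSmoothness ℝ 3) M.G := by
  refine LieGroup.of_le (n := ∞) ?_
  rw [minSmoothness_of_isRCLikeNormedField]
  exact ENat.LEInfty.out

theorem GroupModel.toIdentity_mulInvariantVectorField (M : A.GroupModel) (p : M.G)
    (e : GroupLieAlgebra (𝓡 3) M.G) :
    M.toIdentity p (mulInvariantVectorField e p) = M.toAlg e := by
  have hne : minSmoothness ℝ 3 ≠ 0 := by simp
  have hid : (fun y : M.G => p⁻¹ * y) ∘ (fun y => p * y) = id := by ext x; simp
  have h1 := mfderiv_comp (I := 𝓡 3) (I' := 𝓡 3) (I'' := 𝓡 3) (1 : M.G)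
    (g := fun y : M.G => p⁻¹ * y) (f := fun y : M.G => p * y)
    (contMDiff_mul_left (n := minSmoothness ℝ 3).contMDiffAt.mdifferentiableAt hne)
    (contMDiff_mul_left (n := minSmoothness ℝ 3).contMDiffAt.mdifferentiableAt hne)
  rw [hid, mfderiv_id] at h1
  -- The chain rule gives the derivative at `p * 1`, the goal asks for it at `p`. A variable base
  -- point makes the two tangent spaces agree by substitution.
  have key : ∀ q : M.G, q = p * 1 →
      (mfderiv (𝓡 3) (𝓡 3) (fun y : M.G => p⁻¹ * y) q :
        EuclideanSpace ℝ (Fin 3) →L[ℝ] EuclideanSpace ℝ (Fin 3))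
        (mfderiv (𝓡 3) (𝓡 3) (fun y : M.G => p * y) 1 e) = e := by
    rintro q rfl
    exact (DFunLike.congr_fun h1 e).symm
  exact congrArg M.toAlg (key p (mul_one p).symm)

/-- Two orthonormal families of vectors are related by an orthogonal matrix. -/
theorem transition_mul_transpose {E : Type*} [AddCommGroup E] [Module ℝ E]
    {B : LinearMap.BilinForm ℝ E} {v w : Fin 3 → E} {P : Matrix (Fin 3) (Fin 3) ℝ}
    (hv : ∀ i j, B (v i) (v j) = if i = j then 1 else 0)
    (hw : ∀ i j, B (w i) (w j) = if i = j then 1 else 0)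
    (hvw : ∀ i, v i = ∑ j, P i j • w j) : P * Pᵀ = 1 := by
  ext i j
  rw [Matrix.one_apply, ← hv i j, hvw i, hvw j]
  simp [hw, Matrix.mul_apply, mul_comm]

theorem linearIndependent_of_orthonormal {E : Type*} [AddCommGroup E] [Module ℝ E]
    {B : LinearMap.BilinForm ℝ E} {w : Fin 3 → E}
    (hw : ∀ i j, B (w i) (w j) = if i = j then 1 else 0) : LinearIndependent ℝ w := by
  rw [Fintype.linearIndependent_iff]
  intro g hg i
  have := congrArg (fun x => B x (w i)) hg
  simpa [hw] using this

/-- The inner product on a coordinate space that is induced by a map into the group. -/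
noncomputable def GroupModel.pullbackForm (M : A.GroupModel)
    (h : EuclideanSpace ℝ (Fin 3) → M.G) (x : EuclideanSpace ℝ (Fin 3)) :
    LinearMap.BilinForm ℝ (EuclideanSpace ℝ (Fin 3)) :=
  let D : EuclideanSpace ℝ (Fin 3) →ₗ[ℝ] (Fin 3 → ℝ) :=
    { toFun := fun w => M.toIdentity (h x) (mfderiv 𝓘(ℝ, EuclideanSpace ℝ (Fin 3)) (𝓡 3) h x w)
      map_add' := fun u v =>
        (congrArg (M.toIdentity (h x)) (map_add (mfderiv _ (𝓡 3) h x) u v)).trans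
          (M.toIdentity_add _ _ _)
      map_smul' := fun r u =>
        (congrArg (M.toIdentity (h x)) (map_smul (mfderiv _ (𝓡 3) h x) r u)).trans
          (M.toIdentity_smul _ _ _) }
  A.metric.compl₁₂ D D

theorem GroupModel.pullbackForm_apply (M : A.GroupModel)
    (h : EuclideanSpace ℝ (Fin 3) → M.G) (x u v : EuclideanSpace ℝ (Fin 3)) :
    M.pullbackForm h x u v = M.riemannianMetric (h x)
      (mfderiv 𝓘(ℝ, EuclideanSpace ℝ (Fin 3)) (𝓡 3) h x u)
      (mfderiv 𝓘(ℝ, EuclideanSpace ℝ (Fin 3)) (𝓡 3) h x v) := rfl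

theorem GroupModel.pullbackForm_mpullback (M : A.GroupModel)
    {h : EuclideanSpace ℝ (Fin 3) → M.G} {x : EuclideanSpace ℝ (Fin 3)}
    (hinv : (mfderiv 𝓘(ℝ, EuclideanSpace ℝ (Fin 3)) (𝓡 3) h x).IsInvertible)
    (u v : GroupLieAlgebra (𝓡 3) M.G) :
    M.pullbackForm h x
      (VectorField.mpullback 𝓘(ℝ, EuclideanSpace ℝ (Fin 3)) (𝓡 3) h (mulInvariantVectorField u) x)
      (VectorField.mpullback 𝓘(ℝ, EuclideanSpace ℝ (Fin 3)) (𝓡 3) h (mulInvariantVectorField v) x)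
      = A.metric (M.toAlg u) (M.toAlg v) := by
  have key : ∀ w : GroupLieAlgebra (𝓡 3) M.G, mfderiv 𝓘(ℝ, EuclideanSpace ℝ (Fin 3)) (𝓡 3) h x
      (VectorField.mpullback 𝓘(ℝ, EuclideanSpace ℝ (Fin 3)) (𝓡 3) h
        (mulInvariantVectorField w) x) = mulInvariantVectorField w (h x) := by
    intro w
    exact DFunLike.congr_fun hinv.self_comp_inverse _
  refine (M.pullbackForm_apply h x _ _).trans ?_
  rw [key, key, M.riemannianMetric_eq,
    M.toIdentity_mulInvariantVectorField, M.toIdentity_mulInvariantVectorField]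

/-- Both left-invariant frames are pulled back to one patch of `ℝ³`, along the inverse chart `ψ` and
along `f ∘ ψ`. With the second frame scaled by `(√c)⁻¹`, both are orthonormal for the same metric
and `milnorInvariant_eq_of_frames` applies. -/
theorem milnorInvariant_eq_of_homothetic {A A' : MetricLieAlgebra} {a a' : Fin 3 → ℝ}
    {L L' : (Fin 3 → ℝ) ≃ₗ[ℝ] (Fin 3 → ℝ)} (hL : A.IsMilnorFrame a L)
    (hL' : A'.IsMilnorFrame a' L') (ha : a ≠ 0) (ha' : a' ≠ 0) (h : A.Homothetic A') :
    milnorInvariant a = milnorInvariant a' := by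
  obtain ⟨M, M', f, c, hc, hf⟩ := h
  obtain ⟨e, he0, he1, he2, hem⟩ := exists_scaled_frame hL M 1
  obtain ⟨e', he0', he1', he2', hem'⟩ := exists_scaled_frame hL' M' (√c)⁻¹
  rw [one_smul] at he0 he1 he2
  have hk : (√c)⁻¹ ≠ 0 := by positivity
  have hck : c * (√c)⁻¹ ^ 2 = 1 := by
    rw [inv_pow, Real.sq_sqrt hc.le, mul_inv_cancel₀ hc.ne']
  have hb : (√c)⁻¹ • a' ≠ 0 := smul_ne_zero hk ha'
  have hba : milnorInvariant a' = milnorInvariant ((√c)⁻¹ • a') :=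
    (milnorInvariant_eq_iff ha' hb).2 ⟨_, 1, hk, fun i => by simp⟩
  rw [hba]
  let E := EuclideanSpace ℝ (Fin 3)
  have : IsManifold (𝓡 3) ∞ M.G := inferInstance
  let ψ : E → M.G := (extChartAt (𝓡 3) (1 : M.G)).symm
  let U : Set E := (extChartAt (𝓡 3) (1 : M.G)).target
  have hU : IsOpen U := isOpen_extChartAt_target (1 : M.G)
  have hψ : ∀ x ∈ U, ContMDiffAt 𝓘(ℝ, E) (𝓡 3) ∞ ψ x := fun x hx =>
    (contMDiffOn_extChartAt_symm (1 : M.G)).contMDiffAt (hU.mem_nhds hx)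
  have hψi : ∀ x ∈ U, (mfderiv 𝓘(ℝ, E) (𝓡 3) ψ x).IsInvertible := by
    intro x hx
    have := isInvertible_mfderivWithin_extChartAt_symm (I := 𝓡 3) (x := (1 : M.G)) hx
    rwa [ModelWithCorners.range_eq_univ, mfderivWithin_univ] at this
  have hfψ : ∀ x ∈ U, ContMDiffAt 𝓘(ℝ, E) (𝓡 3) ∞ (f ∘ ψ) x := fun x hx =>
    f.contMDiff.contMDiffAt.comp x (hψ x hx)
  have hcomp : ∀ x ∈ U, mfderiv 𝓘(ℝ, E) (𝓡 3) (f ∘ ψ) x =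
      (mfderiv (𝓡 3) (𝓡 3) f (ψ x)).comp (mfderiv 𝓘(ℝ, E) (𝓡 3) ψ x) := fun x hx =>
    mfderiv_comp x (f.contMDiff.contMDiffAt.mdifferentiableAt (by simp))
      ((hψ x hx).mdifferentiableAt (by simp))
  have hfψi : ∀ x ∈ U, (mfderiv 𝓘(ℝ, E) (𝓡 3) (f ∘ ψ) x).IsInvertible := by
    intro x hx
    rw [hcomp x hx]
    exact ContinuousLinearMap.IsInvertible.comp
      ⟨f.mfderivToContinuousLinearEquiv (by simp) (ψ x), rfl⟩ (hψi x hx)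
  have h3 : (3 : ℕ∞ω) ≤ ∞ := ENat.LEInfty.out
  have hV := isMilnorFrameOn_mpullback he0 he1 he2 (fun x hx => (hψ x hx).of_le h3) hψi
  have hW := isMilnorFrameOn_mpullback he0' he1' he2' (fun x hx => (hfψ x hx).of_le h3) hfψi
  set V : Fin 3 → E → E := fun i =>
    VectorField.mpullback 𝓘(ℝ, E) (𝓡 3) ψ (mulInvariantVectorField (e i)) with hVdef
  set W : Fin 3 → E → E := fun i =>
    VectorField.mpullback 𝓘(ℝ, E) (𝓡 3) (f ∘ ψ) (mulInvariantVectorField (e' i)) with hWdef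
  have hform : ∀ x ∈ U, ∀ u v, M.pullbackForm ψ x u v = c * M'.pullbackForm (f ∘ ψ) x u v := by
    intro x hx u v
    rw [M.pullbackForm_apply, M'.pullbackForm_apply, hf, hcomp x hx]
    rfl
  have hVo : ∀ x ∈ U, ∀ i j, M.pullbackForm ψ x (V i x) (V j x) = if i = j then 1 else 0 := by
    intro x hx i j
    have := M.pullbackForm_mpullback (hψi x hx) (e i) (e j)
    rw [hem, one_pow] at this
    exact this
  have hWo : ∀ x ∈ U, ∀ i j, M.pullbackForm ψ x (W i x) (W j x) = if i = j then 1 else 0 := by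
    intro x hx i j
    have := M'.pullbackForm_mpullback (hfψi x hx) (e' i) (e' j)
    rw [hem'] at this
    rw [hform x hx]
    refine (congrArg (c * ·) this).trans ?_
    simp only [mul_ite, hck, mul_zero]
  have hind : ∀ x ∈ U, LinearIndependent ℝ fun i => W i x := fun x hx =>
    linearIndependent_of_orthonormal (hWo x hx)
  -- The operator with columns `W i x`. Inversion of operators is smooth, so the transition
  -- coefficients `(T x).inverse (V i x)` inherit two derivatives from the fields.
  let T : E → ((Fin 3 → ℝ) →L[ℝ] E) := fun x =>
    ∑ i, (ContinuousLinearMap.proj (R := ℝ) (φ := fun _ : Fin 3 => ℝ) i).smulRight (W i x)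
  have hTapp : ∀ x g, T x g = ∑ i, g i • W i x := by
    intro x g; simp [T, _root_.sum_apply]
  have hTi : ∀ x ∈ U, (T x).IsInvertible := by
    intro x hx
    have hinj : Function.Injective (T x).toLinearMap := by
      rw [← LinearMap.ker_eq_bot, LinearMap.ker_eq_bot']
      intro g hg
      have := (Fintype.linearIndependent_iff.1 (hind x hx)) g ((hTapp x g).symm.trans hg)
      exact funext this
    refine ⟨(LinearEquiv.ofInjectiveOfFinrankEq _ hinj (by simp [E])).toContinuousLinearEquiv, ?_⟩
    ext1 g
    rfl
  have hTc : ∀ x ∈ U, ContDiffAt ℝ 2 T x := fun x hx => by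
    refine ContDiffAt.sum fun i _ => ?_
    exact contDiffAt_const.smulRight (hW.contDiffAt i x hx)
  refine milnorInvariant_eq_of_frames (A := fun x i j => (T x).inverse (V i x) j) hU
    ⟨_, mem_extChartAt_target (1 : M.G)⟩ ha hb hV hW ?_ hind ?_ ?_
  · intro i j x hx
    have h1 : ContDiffAt ℝ 2 (fun y => (T y).inverse) x :=
      (hTi x hx).contDiffAt_map_inverse.comp x (hTc x hx)
    have h2 := h1.clm_apply (hV.contDiffAt i x hx)
    exact contDiffAt_pi.1 h2 j
  · intro x hx i
    rw [← hTapp x]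
    exact (DFunLike.congr_fun (hTi x hx).self_comp_inverse (V i x)).symm
  · intro x hx
    refine transition_mul_transpose (hVo x hx) (hWo x hx) fun i => ?_
    rw [← hTapp x]
    exact (DFunLike.congr_fun (hTi x hx).self_comp_inverse (V i x)).symm

end MetricLieAlgebra

/-! ### The moduli space as a quotient of the space of structure constants -/

open MetricLieAlgebra

theorem UnimodularMLA.exists_frame (A : UnimodularMLA) :
    ∃ a L, A.1.IsMilnorFrame a L ∧ a ≠ 0 := by
  obtain ⟨a, L, hL⟩ := A.1.exists_isMilnorFrame A.2.1
  exact ⟨a, L, hL, hL.ne_zero A.2.2⟩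

/-- The structure constants of a chosen Milnor frame. -/
noncomputable def UnimodularMLA.constants (A : UnimodularMLA) : {a : Fin 3 → ℝ // a ≠ 0} :=
  ⟨A.exists_frame.choose, A.exists_frame.choose_spec.choose_spec.2⟩

theorem UnimodularMLA.isMilnorFrame_constants (A : UnimodularMLA) :
    ∃ L, A.1.IsMilnorFrame A.constants.1 L :=
  ⟨_, A.exists_frame.choose_spec.choose_spec.1⟩

theorem milnorMap_eq_mk {A : UnimodularMLA} {a : Fin 3 → ℝ} (ha : a ≠ 0)
    {L : (Fin 3 → ℝ) ≃ₗ[ℝ] (Fin 3 → ℝ)} (hL : A.1.IsMilnorFrame a L) :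
    milnorMap ⟨a, ha⟩ = Moduli.mk A :=
  (Quot.sound (r := fun A A' : UnimodularMLA =>
    A.1.IsomorphicUpToScaling A'.1 ∨ A.1.Homothetic A'.1) (Or.inl hL.isomorphic)).symm

namespace Moduli

/-- The complete invariant on the moduli space. -/
noncomputable def invariant : Moduli → ℝ × ℝ × ℝ :=
  Quot.lift (fun A => milnorInvariant A.constants.1) (by
    rintro A A' (h | h)
    · obtain ⟨L, hL⟩ := A.isMilnorFrame_constants
      obtain ⟨L', hL'⟩ := A'.isMilnorFrame_constants
      exact milnorInvariant_eq_of_isomorphic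
        (hL.isomorphic.symm.trans (h.trans hL'.isomorphic))
    · obtain ⟨L, hL⟩ := A.isMilnorFrame_constants
      obtain ⟨L', hL'⟩ := A'.isMilnorFrame_constants
      exact milnorInvariant_eq_of_homothetic hL hL' A.constants.2 A'.constants.2 h)

theorem invariant_milnorMap (a : {a : Fin 3 → ℝ // a ≠ 0}) :
    invariant (milnorMap a) = milnorInvariant a.1 := by
  obtain ⟨L, hL⟩ := UnimodularMLA.isMilnorFrame_constants
    ⟨milnorAlgebra a.1, milnorAlgebra_isUnimodular a.1, milnorAlgebra_isNonabelian a.2⟩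
  exact milnorInvariant_eq_of_isomorphic hL.isomorphic.symm

theorem milnorMap_eq_iff {a b : {a : Fin 3 → ℝ // a ≠ 0}} :
    milnorMap a = milnorMap b ↔ MilnorEquiv a.1 b.1 := by
  constructor
  · intro h
    rw [← milnorInvariant_eq_iff a.2 b.2, ← invariant_milnorMap, h, invariant_milnorMap]
  · intro h
    exact Quot.sound (Or.inl h.isomorphic)

theorem milnorMap_surjective : Function.Surjective milnorMap := by
  rintro ⟨A⟩
  obtain ⟨L, hL⟩ := A.isMilnorFrame_constants
  exact ⟨A.constants, milnorMap_eq_mk A.constants.2 hL⟩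

theorem isQuotientMap_milnorMap : Topology.IsQuotientMap milnorMap :=
  ⟨⟨rfl⟩, milnorMap_surjective⟩

theorem continuous_milnorMap : Continuous milnorMap := isQuotientMap_milnorMap.continuous

/-- The action of a nonzero scalar and a permutation on nonzero vectors. -/
def scalePerm (c : ℝ) (hc : c ≠ 0) (σ : Equiv.Perm (Fin 3)) (a : {a : Fin 3 → ℝ // a ≠ 0}) :
    {a : Fin 3 → ℝ // a ≠ 0} :=
  ⟨fun i => c * a.1 (σ i), fun h => a.2 (by
    ext i
    simpa [hc] using congrFun h (σ.symm i))⟩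

theorem continuous_coordinate (i : Fin 3) :
    Continuous fun a : {a : Fin 3 → ℝ // a ≠ 0} => a.1 i :=
  (continuous_apply i).comp continuous_subtype_val

theorem continuous_scalePerm (c : ℝ) (hc : c ≠ 0) (σ : Equiv.Perm (Fin 3)) :
    Continuous (scalePerm c hc σ) := by
  unfold scalePerm
  exact Continuous.subtype_mk
    (continuous_pi fun i => continuous_const.mul (continuous_coordinate _)) _

theorem milnorMap_scalePerm (c : ℝ) (hc : c ≠ 0) (σ : Equiv.Perm (Fin 3))
    (a : {a : Fin 3 → ℝ // a ≠ 0}) : milnorMap (scalePerm c hc σ a) = milnorMap a :=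
  (milnorMap_eq_iff.2 ⟨c, σ, hc, fun _ => rfl⟩).symm

/-- The fibres are orbits under homeomorphisms, so the saturation of an open set is a union of open
preimages. -/
theorem isOpenMap_milnorMap : IsOpenMap milnorMap := by
  intro S hS
  rw [← isQuotientMap_milnorMap.isOpen_preimage]
  have : milnorMap ⁻¹' (milnorMap '' S) =
      ⋃ (c : {c : ℝ // c ≠ 0}) (σ : Equiv.Perm (Fin 3)), scalePerm c.1 c.2 σ ⁻¹' S := by
    ext a
    simp only [Set.mem_preimage, Set.mem_image, Set.mem_iUnion]
    constructor
    · rintro ⟨b, hb, hab⟩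
      obtain ⟨c, σ, hc, h⟩ := milnorMap_eq_iff.1 hab.symm
      refine ⟨⟨c, hc⟩, σ, ?_⟩
      rwa [show scalePerm c hc σ a = b from Subtype.ext (funext fun i => (h i).symm)]
    · rintro ⟨c, σ, h⟩
      exact ⟨_, h, milnorMap_scalePerm _ _ _ _⟩
  rw [this]
  exact isOpen_iUnion fun c => isOpen_iUnion fun σ => hS.preimage (continuous_scalePerm _ _ _)

theorem isOpenQuotientMap_milnorMap : IsOpenQuotientMap milnorMap :=
  ⟨milnorMap_surjective, continuous_milnorMap, isOpenMap_milnorMap⟩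

theorem continuous_invariant : Continuous invariant := by
  rw [isQuotientMap_milnorMap.continuous_iff]
  have : invariant ∘ milnorMap = fun a => milnorInvariant a.1 := funext invariant_milnorMap
  rw [this]
  have hN : ∀ a : {a : Fin 3 → ℝ // a ≠ 0}, a.1 0 ^ 2 + a.1 1 ^ 2 + a.1 2 ^ 2 ≠ 0 :=
    fun a => (sum_sq_pos a.2).ne'
  have h0 := continuous_coordinate 0
  have h1 := continuous_coordinate 1
  have h2 := continuous_coordinate 2
  have hN' := ((h0.pow 2).add (h1.pow 2)).add (h2.pow 2)
  have hs := (h0.add h1).add h2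
  have hp := (h0.mul h1).mul h2
  exact .prodMk ((hs.pow 2).div hN' hN) (.prodMk
    ((hs.mul hp).div (hN'.pow 2) fun a => pow_ne_zero _ (hN a))
    ((hp.pow 2).div (hN'.pow 3) fun a => pow_ne_zero _ (hN a)))

theorem invariant_injective : Function.Injective invariant := by
  intro x y h
  obtain ⟨a, rfl⟩ := milnorMap_surjective x
  obtain ⟨b, rfl⟩ := milnorMap_surjective y
  rw [invariant_milnorMap, invariant_milnorMap] at h
  exact milnorMap_eq_iff.2 ((milnorInvariant_eq_iff a.2 b.2).1 h)

instance : T2Space Moduli := .of_injective_continuous invariant_injective continuous_invariant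

end Moduli

/-! ### Flows of Lipschitz vector fields -/

section LipschitzFlow

open Set NNReal

/-- Coordinatewise truncation to the ball of radius `R`. -/
noncomputable def truncate {ι : Type*} (R : ℝ) (x : ι → ℝ) : ι → ℝ :=
  fun i => max (-R) (min R (x i))

variable {ι : Type*} [Fintype ι]

theorem lipschitzWith_truncate (R : ℝ) : LipschitzWith 1 (truncate (ι := ι) R) := by
  refine LipschitzWith.of_dist_le_mul fun x y => ?_
  rw [NNReal.coe_one, one_mul, dist_pi_le_iff dist_nonneg]
  intro i
  refine le_trans ?_ (dist_le_pi_dist x y i)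
  simpa [truncate] using ((LipschitzWith.id.const_min R).const_max (-R)).dist_le_mul (x i) (y i)

theorem truncate_eq_self {R : ℝ} {x : ι → ℝ} (h : ‖x‖ ≤ R) : truncate R x = x := by
  ext i
  have := abs_le.1 ((norm_le_pi_norm x i).trans h)
  simp [truncate, this.1, this.2]

theorem norm_truncate_le {R : ℝ} (hR : 0 ≤ R) (x : ι → ℝ) : ‖truncate R x‖ ≤ R := by
  rw [pi_norm_le_iff_of_nonneg hR]
  intro i
  rw [Real.norm_eq_abs, abs_le]
  exact ⟨le_max_left _ _, max_le (by linarith) (min_le_left _ _)⟩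

theorem norm_truncate_le_norm {R : ℝ} (hR : 0 ≤ R) (x : ι → ℝ) : ‖truncate R x‖ ≤ ‖x‖ := by
  rcases le_total ‖x‖ R with h | h
  · rw [truncate_eq_self h]
  · exact (norm_truncate_le hR x).trans h

/-- Grönwall's inequality forwards; negative times follow by reversing time. -/
theorem norm_le_of_hasDerivAt_of_norm_le {E : Type*} [NormedAddCommGroup E] [NormedSpace ℝ E]
    {γ γ' : ℝ → E} {K T : ℝ} (hγ : ∀ t ∈ Ioo (-T) T, HasDerivAt γ (γ' t) t)
    (hb : ∀ t ∈ Ioo (-T) T, ‖γ' t‖ ≤ K * ‖γ t‖) :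
    ∀ t ∈ Ioo (-T) T, ‖γ t‖ ≤ ‖γ 0‖ * Real.exp (K * |t|) := by
  have main : ∀ (γ γ' : ℝ → E), (∀ t ∈ Ioo (-T) T, HasDerivAt γ (γ' t) t) →
      (∀ t ∈ Ioo (-T) T, ‖γ' t‖ ≤ K * ‖γ t‖) → ∀ t ∈ Ico 0 T,
      ‖γ t‖ ≤ ‖γ 0‖ * Real.exp (K * t) := by
    intro γ γ' hγ hb t ht
    have hsub : ∀ s ∈ Icc 0 t, s ∈ Ioo (-T) T := fun s hs =>
      ⟨by linarith [ht.1, ht.2, hs.1], hs.2.trans_lt ht.2⟩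
    have := norm_le_gronwallBound_of_norm_deriv_right_le (f := γ) (f' := γ') (δ := ‖γ 0‖)
      (K := K) (ε := 0) (a := 0) (b := t)
      (fun s hs => (hγ s (hsub s hs)).continuousAt.continuousWithinAt)
      (fun s hs => (hγ s (hsub s (Ico_subset_Icc_self hs))).hasDerivWithinAt) le_rfl
      (fun s hs => by simpa using hb s (hsub s (Ico_subset_Icc_self hs))) t ⟨ht.1, le_rfl⟩
    simpa [gronwallBound_ε0] using this
  intro t ht
  rcases le_total 0 t with h | h
  · rw [abs_of_nonneg h]
    exact main γ γ' hγ hb t ⟨h, ht.2⟩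
  · rw [abs_of_nonpos h]
    have := main (fun s => γ (-s)) (fun s => -γ' (-s))
      (fun s hs => by
        have h1 : HasDerivAt γ (γ' (-s)) (-s) :=
          hγ (-s) ⟨by linarith [hs.2], by linarith [hs.1]⟩
        simpa [Function.comp_def] using h1.scomp s (hasDerivAt_neg s))
      (fun s hs => by
        rw [norm_neg]
        exact hb (-s) ⟨by linarith [hs.2], by linarith [hs.1]⟩)
      (-t) ⟨by linarith, by linarith [ht.1]⟩
    simpa using this

variable {V : (ι → ℝ) → ι → ℝ} {K : ℝ≥0}

theorem norm_le_of_lipschitzWith (hV : LipschitzWith K V) (h0 : V 0 = 0) (x : ι → ℝ) :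
    ‖V x‖ ≤ K * ‖x‖ := by
  simpa [h0] using hV.dist_le_mul x 0

/-- The truncated field is bounded, so Picard–Lindelöf reaches time `T` in one step. The radius `R`
is the Grönwall bound at time `T`, so the solution stays where truncation does nothing. -/
theorem exists_solution_on_interval (hV : LipschitzWith K V) (h0 : V 0 = 0) (x : ι → ℝ)
    {T : ℝ} (hT : 0 < T) :
    ∃ γ : ℝ → ι → ℝ, γ 0 = x ∧ ∀ t ∈ Ioo (-T) T, HasDerivAt γ (V (γ t)) t := by
  let R : ℝ≥0 := ⟨‖x‖ * Real.exp (K * T), by positivity⟩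
  let T' : ℝ≥0 := ⟨T, hT.le⟩
  have hR : (0 : ℝ) ≤ R := R.2
  have hlip : LipschitzWith K (fun y => V (truncate R y)) := by
    simpa [Function.comp_def] using hV.comp (lipschitzWith_truncate (R : ℝ))
  have hPL : IsPicardLindelof (fun _ y => V (truncate R y)) (tmin := -T) (tmax := T)
      ⟨0, by simp [hT.le]⟩ x (K * R * T') 0 (K * R) K :=
    IsPicardLindelof.of_time_independent
      (fun y _ => by
        refine (norm_le_of_lipschitzWith hV h0 _).trans ?_
        push_cast
        exact mul_le_mul_of_nonneg_left (norm_truncate_le hR y) K.2)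
      hlip.lipschitzOnWith (by simp; exact le_rfl)
  obtain ⟨γ, hγ0, hγ⟩ := hPL.exists_eq_forall_mem_Icc_hasDerivWithinAt₀
  have hγ' : ∀ t ∈ Ioo (-T) T, HasDerivAt γ (V (truncate R (γ t))) t := fun t ht =>
    (hγ t (Ioo_subset_Icc_self ht)).hasDerivAt (Icc_mem_nhds ht.1 ht.2)
  have hbd := norm_le_of_hasDerivAt_of_norm_le (K := K) hγ' fun t _ =>
    (norm_le_of_lipschitzWith hV h0 _).trans
      (mul_le_mul_of_nonneg_left (norm_truncate_le_norm hR _) K.2)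
  refine ⟨γ, hγ0, fun t ht => ?_⟩
  have h1 : ‖γ t‖ ≤ R := by
    refine (hbd t ht).trans ?_
    have h0 : γ 0 = x := hγ0
    rw [h0]
    change _ ≤ ‖x‖ * Real.exp (K * T)
    gcongr
    exact (abs_lt.2 ht).le
  have := hγ' t ht
  rwa [truncate_eq_self h1] at this

theorem exists_global_solution (hV : LipschitzWith K V) (h0 : V 0 = 0) (x : ι → ℝ) :
    ∃ γ : ℝ → ι → ℝ, γ 0 = x ∧ ∀ t, HasDerivAt γ (V (γ t)) t := by
  have h := fun T : {T : ℝ // 0 < T} => exists_solution_on_interval hV h0 x T.2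
  choose γ hγ0 hγ using h
  have huniq : ∀ S T : {T : ℝ // 0 < T}, S.1 ≤ T.1 → EqOn (γ S) (γ T) (Ioo (-S.1) S.1) := by
    intro S T hST
    refine ODE_solution_unique_of_mem_Ioo (v := fun _ => V) (s := fun _ => univ) (K := K)
      (t₀ := 0) (fun _ _ => hV.lipschitzOnWith) ⟨by linarith [S.2], S.2⟩
      (fun t ht => ⟨hγ S t ht, mem_univ _⟩)
      (fun t ht => ⟨hγ T t ⟨by linarith [ht.1], ht.2.trans_le hST⟩, mem_univ _⟩) ?_
    rw [hγ0, hγ0]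
  -- Values are read from the solution on `(-(|t| + 1), |t| + 1)`. Near `t` all of these agree with
  -- the one for `|t| + 2`, which gives the derivative.
  let δ : ℝ → ι → ℝ := fun t => γ ⟨|t| + 1, by positivity⟩ t
  refine ⟨δ, hγ0 _, fun t => ?_⟩
  have hpos : 0 < |t| + 2 := by positivity
  have hev : δ =ᶠ[𝓝 t] γ ⟨|t| + 2, hpos⟩ := by
    filter_upwards [Ioo_mem_nhds (show t - 1 < t by linarith) (show t < t + 1 by linarith)]
      with s hs
    have hst : |s| ≤ |t| + 1 := by
      have h1 : |s - t| ≤ 1 := abs_le.2 ⟨by linarith [hs.1], by linarith [hs.2]⟩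
      linarith [abs_sub_abs_le_abs_sub s t]
    exact huniq ⟨|s| + 1, by positivity⟩ ⟨|t| + 2, hpos⟩ (by simp; linarith)
      (abs_lt.1 (by simp))
  have h1 := hγ ⟨|t| + 2, hpos⟩ t (abs_lt.1 (by simp))
  rw [← hev.eq_of_nhds] at h1
  exact h1.congr_of_eventuallyEq hev

theorem solution_unique (hV : LipschitzWith K V) {γ δ : ℝ → ι → ℝ}
    (hγ : ∀ t, HasDerivAt γ (V (γ t)) t) (hδ : ∀ t, HasDerivAt δ (V (δ t)) t)
    {t₀ : ℝ} (h : γ t₀ = δ t₀) : γ = δ :=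
  ODE_solution_unique_univ (v := fun _ => V) (s := fun _ => univ) (K := K) (t₀ := t₀)
    (fun _ => hV.lipschitzOnWith) (fun t => ⟨hγ t, mem_univ _⟩) (fun t => ⟨hδ t, mem_univ _⟩) h

theorem dist_solution_le (hV : LipschitzWith K V) {γ δ : ℝ → ι → ℝ}
    (hγ : ∀ t, HasDerivAt γ (V (γ t)) t) (hδ : ∀ t, HasDerivAt δ (V (δ t)) t) (t : ℝ) :
    dist (γ t) (δ t) ≤ dist (γ 0) (δ 0) * Real.exp (K * |t|) := by
  have := norm_le_of_hasDerivAt_of_norm_le (K := K) (T := |t| + 1) (γ := fun s => γ s - δ s)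
    (γ' := fun s => V (γ s) - V (δ s))
    (fun s _ => (hγ s).fun_sub (hδ s))
    (fun s _ => by simpa [dist_eq_norm] using hV.dist_le_mul (γ s) (δ s)) t
    (abs_lt.1 (by simp))
  simpa [dist_eq_norm] using this

/-- Joint continuity combines continuity in time with Lipschitz dependence on the initial value,
uniform on bounded times. The group law is uniqueness of solutions. -/
theorem exists_flow_of_lipschitzWith (hV : LipschitzWith K V) (h0 : V 0 = 0) :
    ∃ Φ : Flow ℝ (ι → ℝ), ∀ x t, HasDerivAt (fun s => Φ s x) (V (Φ t x)) t := by
  choose γ hγ0 hγ using exists_global_solution hV h0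
  refine ⟨⟨fun t x => γ x t, ?_, fun t₁ t₂ x => ?_, hγ0⟩, hγ⟩
  · rw [continuous_iff_continuousAt]
    rintro ⟨t, x⟩
    have hT : t ∈ Ioo (-(|t| + 1)) (|t| + 1) := abs_lt.1 (by simp)
    have := continuousOn_prod_of_continuousOn_lipschitzOnWith'
      (f := fun p : ℝ × (ι → ℝ) => γ p.2 p.1) (s := Ioo (-(|t| + 1)) (|t| + 1)) (t := univ)
      ⟨Real.exp (K * (|t| + 1)), (Real.exp_pos _).le⟩
      (fun s hs => LipschitzOnWith.of_dist_le_mul fun y _ z _ => by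
        refine (dist_solution_le hV (hγ y) (hγ z) s).trans ?_
        rw [hγ0, hγ0, mul_comm]
        refine mul_le_mul_of_nonneg_right ?_ dist_nonneg
        change _ ≤ Real.exp (K * (|t| + 1))
        gcongr
        exact (abs_lt.2 hs).le)
      (fun y _ s _ => (hγ y s).continuousAt.continuousWithinAt)
    exact this.continuousAt (prod_mem_nhds (Ioo_mem_nhds hT.1 hT.2) Filter.univ_mem)
  · have := solution_unique hV (γ := fun s => γ x (s + t₂)) (δ := γ (γ x t₂)) (t₀ := 0)
      (fun s => by simpa using (hγ x (s + t₂)).comp_add_const s t₂) (hγ _)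
      (by simp [hγ0])
    exact congrFun this t₁

end LipschitzFlow

/-! ### Lipschitz bounds for homogeneous functions -/

section Homogeneous

open NNReal

variable {E : Type*} [NormedAddCommGroup E]

/-- Lipschitz functions of linear growth are stable under `f, g ↦ f * g / ‖·‖`. -/
theorem LipschitzWith.mul_div_norm {f g : E → ℝ} {K L : ℝ≥0} (hf : LipschitzWith K f)
    (hg : LipschitzWith L g) (hf0 : f 0 = 0) (hg0 : g 0 = 0) :
    LipschitzWith (3 * (K * L)) fun x => f x * g x / ‖x‖ := by
  have hfb : ∀ x, |f x| ≤ K * ‖x‖ := fun x => by simpa [hf0] using hf.dist_le_mul x 0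
  have hgb : ∀ x, |g x| ≤ L * ‖x‖ := fun x => by simpa [hg0] using hg.dist_le_mul x 0
  have main : ∀ x y : E, ‖y‖ ≤ ‖x‖ →
      |f x * g x / ‖x‖ - f y * g y / ‖y‖| ≤ 3 * (K * L) * ‖x - y‖ := by
    intro x y hyx
    rcases (norm_nonneg y).eq_or_lt with hy | hy
    · have hy0 : y = 0 := norm_eq_zero.1 hy.symm
      subst hy0
      rcases (norm_nonneg x).eq_or_lt with hx | hx
      · simp [← hx]
      · simp only [hf0, hg0, norm_zero, mul_zero, div_zero, sub_zero, abs_div, abs_mul, abs_norm]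
        rw [div_le_iff₀ hx]
        have a1 := mul_le_mul (hfb x) (hgb x) (abs_nonneg _) (by positivity)
        have a2 : (0 : ℝ) ≤ K * L * ‖x‖ ^ 2 := by positivity
        nlinarith
    have hx : 0 < ‖x‖ := hy.trans_le hyx
    -- Differences of `f` and `g` are divided by the larger norm `‖x‖`. The change of the
    -- denominator is weighted by `f y * g y`, at most `K L ‖x‖ ‖y‖`. These parts contribute `2` and
    -- `1` to the constant `3`.
    have h1 : f x * g x / ‖x‖ - f y * g y / ‖y‖ =
        (f x * (g x - g y) + (f x - f y) * g y) / ‖x‖ -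
          f y * g y * (‖x‖ - ‖y‖) / (‖x‖ * ‖y‖) := by
      field_simp; ring
    have hd := norm_nonneg (x - y)
    have hfd : |f x - f y| ≤ K * ‖x - y‖ := by
      simpa [Real.dist_eq, dist_eq_norm] using hf.dist_le_mul x y
    have hgd : |g x - g y| ≤ L * ‖x - y‖ := by
      simpa [Real.dist_eq, dist_eq_norm] using hg.dist_le_mul x y
    have hn : |‖x‖ - ‖y‖| ≤ ‖x - y‖ := abs_norm_sub_norm_le x y
    have hKL : (0 : ℝ) ≤ K * L := mul_nonneg K.2 L.2
    rw [h1]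
    refine (abs_sub _ _).trans ?_
    have e1 : |(f x * (g x - g y) + (f x - f y) * g y) / ‖x‖| ≤ 2 * (K * L) * ‖x - y‖ := by
      rw [abs_div, abs_norm, div_le_iff₀ hx]
      refine (abs_add_le _ _).trans ?_
      rw [abs_mul, abs_mul]
      have a1 : |f x| * |g x - g y| ≤ (K * ‖x‖) * (L * ‖x - y‖) :=
        mul_le_mul (hfb x) hgd (abs_nonneg _) (by positivity)
      have a2 : |f x - f y| * |g y| ≤ (K * ‖x - y‖) * (L * ‖x‖) :=
        mul_le_mul hfd ((hgb y).trans (by gcongr)) (abs_nonneg _) (by positivity)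
      nlinarith
    have e2 : |f y * g y * (‖x‖ - ‖y‖) / (‖x‖ * ‖y‖)| ≤ K * L * ‖x - y‖ := by
      rw [abs_div, abs_mul, abs_mul, abs_mul, abs_norm, abs_norm, div_le_iff₀ (by positivity)]
      have a1 : |f y| * |g y| ≤ (K * ‖x‖) * (L * ‖y‖) :=
        mul_le_mul ((hfb y).trans (by gcongr)) (hgb y) (abs_nonneg _) (by positivity)
      have a2 := mul_le_mul a1 hn (abs_nonneg _) (by positivity)
      nlinarith
    linarith
  refine LipschitzWith.of_dist_le_mul fun x y => ?_
  push_cast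
  rw [Real.dist_eq, dist_eq_norm]
  rcases le_total ‖y‖ ‖x‖ with h | h
  · exact main x y h
  · rw [abs_sub_comm, norm_sub_rev]
    exact main y x h

end Homogeneous

/-! ### The normalized vector field on structure constants and its flow -/

/-- The vector field by which structure constants evolve under the Ricci flow. -/
noncomputable def constantsField (a : Fin 3 → ℝ) (i : Fin 3) : ℝ :=
  1 / 2 * a i * (4 * (∑ j, a j) * a i - 8 * a i ^ 2 + 2 * ∑ j, a j ^ 2 - (∑ j, a j) ^ 2)

/-- The vector field `constantsField`, normalized to be homogeneous of degree one. -/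
noncomputable def normalizedField (a : Fin 3 → ℝ) (i : Fin 3) : ℝ :=
  constantsField a i / ‖a‖ ^ 2

/-- Lipschitz functions that vanish at the origin. -/
def IsLipschitzAtZero (f : (Fin 3 → ℝ) → ℝ) : Prop := (∃ K, LipschitzWith K f) ∧ f 0 = 0

namespace IsLipschitzAtZero

variable {f g : (Fin 3 → ℝ) → ℝ}

theorem add (hf : IsLipschitzAtZero f) (hg : IsLipschitzAtZero g) :
    IsLipschitzAtZero fun a => f a + g a := by
  obtain ⟨⟨K, hK⟩, hf0⟩ := hf
  obtain ⟨⟨L, hL⟩, hg0⟩ := hg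
  exact ⟨⟨_, hK.add hL⟩, by simp [hf0, hg0]⟩

theorem const_mul (hf : IsLipschitzAtZero f) (c : ℝ) : IsLipschitzAtZero fun a => c * f a := by
  obtain ⟨⟨K, hK⟩, hf0⟩ := hf
  exact ⟨⟨_, (lipschitzWith_smul c).comp hK⟩, by simp [hf0]⟩

theorem mul_div_norm (hf : IsLipschitzAtZero f) (hg : IsLipschitzAtZero g) :
    IsLipschitzAtZero fun a => f a * g a / ‖a‖ := by
  obtain ⟨⟨K, hK⟩, hf0⟩ := hf
  obtain ⟨⟨L, hL⟩, hg0⟩ := hg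
  exact ⟨⟨_, hK.mul_div_norm hL hf0 hg0⟩, by simp [hf0]⟩

theorem coordinate (i : Fin 3) : IsLipschitzAtZero fun a => a i :=
  ⟨⟨1, LipschitzWith.eval i⟩, rfl⟩

end IsLipschitzAtZero

open IsLipschitzAtZero in
-- The cubic divided by `‖a‖ ^ 2` is built from coordinates by linear combinations and two rounds of
-- `f * g / ‖·‖`, all of which preserve the Lipschitz property.
theorem exists_lipschitzWith_normalizedField : ∃ K, LipschitzWith K normalizedField := by
  have hs : IsLipschitzAtZero fun a => a 0 + a 1 + a 2 :=
    ((coordinate 0).add (coordinate 1)).add (coordinate 2)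
  have hi : ∀ i, IsLipschitzAtZero fun a => normalizedField a i := by
    intro i
    have hsq := fun j => (coordinate j).mul_div_norm (coordinate j)
    have h1 := (((hs.mul_div_norm (coordinate i)).const_mul 4).add ((hsq i).const_mul (-8))).add
      (((((hsq 0).add (hsq 1)).add (hsq 2)).const_mul 2).add
      ((hs.mul_div_norm hs).const_mul (-1)))
    convert! ((coordinate i).mul_div_norm h1).const_mul (1 / 2) using 2 with a
    simp only [normalizedField, constantsField, Fin.sum_univ_three]
    rcases eq_or_ne ‖a‖ 0 with h | h
    · simp [h]
    · field_simp
      ring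
  choose K hK using fun i => (hi i).1
  refine ⟨∑ i, K i, LipschitzWith.of_dist_le_mul fun x y => ?_⟩
  rw [dist_pi_le_iff (by positivity)]
  intro i
  refine ((hK i).dist_le_mul x y).trans (mul_le_mul_of_nonneg_right ?_ dist_nonneg)
  exact_mod_cast Finset.single_le_sum (f := K) (fun _ _ => zero_le) (Finset.mem_univ i)

theorem normalizedField_zero : normalizedField 0 = 0 := by
  ext i; simp [normalizedField]

/-- The cubic field is odd and symmetric, so after normalization it commutes with permutations and
with factors of either sign. This lets its flow descend to `𝓜`. -/
theorem normalizedField_scale_perm (c : ℝ) (σ : Equiv.Perm (Fin 3)) (a : Fin 3 → ℝ) (i : Fin 3) :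
    normalizedField (fun j => c * a (σ j)) i = c * normalizedField a (σ i) := by
  have hn : ‖fun j => c * a (σ j)‖ = |c| * ‖a‖ := by
    have h1 : (fun j => c * a (σ j)) = c • (a ∘ σ) := rfl
    have hle : ∀ (τ : Equiv.Perm (Fin 3)) (b : Fin 3 → ℝ), ‖b ∘ τ‖ ≤ ‖b‖ := fun τ b =>
      (pi_norm_le_iff_of_nonneg (norm_nonneg _)).2 fun i => norm_le_pi_norm b (τ i)
    have h2 : ‖a ∘ σ‖ = ‖a‖ := le_antisymm (hle σ a) (by
      simpa [Function.comp_assoc] using hle σ.symm (a ∘ σ))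
    rw [h1, norm_smul, Real.norm_eq_abs, h2]
  have h1 : ∑ j, c * a (σ j) = c * ∑ j, a j := by
    rw [← Finset.mul_sum, Equiv.sum_comp σ a]
  have h2 : ∑ j, c ^ 2 * a (σ j) ^ 2 = c ^ 2 * ∑ j, a j ^ 2 := by
    rw [← Finset.mul_sum, Equiv.sum_comp σ fun j => a j ^ 2]
  simp only [normalizedField, constantsField, hn, h1, h2, mul_pow, sq_abs]
  rcases eq_or_ne c 0 with hc | hc
  · simp [hc]
  rcases eq_or_ne ‖a‖ 0 with h | h
  · simp [h]
  · field_simp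

/-- The flow of the normalized vector field on structure constants. -/
noncomputable def constantsFlow : Flow ℝ (Fin 3 → ℝ) :=
  (exists_flow_of_lipschitzWith exists_lipschitzWith_normalizedField.choose_spec
    normalizedField_zero).choose

theorem hasDerivAt_constantsFlow (a : Fin 3 → ℝ) (t : ℝ) :
    HasDerivAt (fun s => constantsFlow s a) (normalizedField (constantsFlow t a)) t :=
  (exists_flow_of_lipschitzWith exists_lipschitzWith_normalizedField.choose_spec
    normalizedField_zero).choose_spec a t

theorem eq_constantsFlow {γ : ℝ → Fin 3 → ℝ} (hγ : ∀ t, HasDerivAt γ (normalizedField (γ t)) t)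
    (t : ℝ) : γ t = constantsFlow t (γ 0) :=
  congrFun (solution_unique exists_lipschitzWith_normalizedField.choose_spec (t₀ := 0) hγ
    (hasDerivAt_constantsFlow (γ 0)) (constantsFlow.map_zero_apply _).symm) t

theorem hasDerivAt_constantsFlow_apply (a : Fin 3 → ℝ) (t : ℝ) (i : Fin 3) :
    HasDerivAt (fun s => constantsFlow s a i) (normalizedField (constantsFlow t a) i) t :=
  hasDerivAt_pi.1 (hasDerivAt_constantsFlow a t) i

theorem constantsFlow_scale_perm (c : ℝ) (σ : Equiv.Perm (Fin 3)) (a : Fin 3 → ℝ) (t : ℝ) :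
    constantsFlow t (fun j => c * a (σ j)) = fun j => c * constantsFlow t a (σ j) := by
  have := eq_constantsFlow (γ := fun t j => c * constantsFlow t a (σ j)) (fun s => by
    rw [hasDerivAt_pi]
    intro i
    rw [normalizedField_scale_perm]
    exact (hasDerivAt_constantsFlow_apply a s (σ i)).const_mul c) t
  rw [this]
  simp only [constantsFlow.map_zero_apply]

theorem constantsFlow_zero (t : ℝ) : constantsFlow t 0 = 0 := by
  have := eq_constantsFlow (γ := fun _ => 0)
    (fun s => by rw [normalizedField_zero]; exact hasDerivAt_const s 0) t
  exact this.symm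

theorem constantsFlow_neg_apply (t : ℝ) (a : Fin 3 → ℝ) :
    constantsFlow (-t) (constantsFlow t a) = a := by
  rw [← constantsFlow.map_add, neg_add_cancel, constantsFlow.map_zero_apply]

theorem constantsFlow_ne_zero {a : Fin 3 → ℝ} (ha : a ≠ 0) (t : ℝ) : constantsFlow t a ≠ 0 := by
  intro h
  apply ha
  rw [← constantsFlow_neg_apply t a, h, constantsFlow_zero]

theorem MilnorEquiv.constantsFlow {a b : Fin 3 → ℝ} (h : MilnorEquiv a b) (t : ℝ) :
    MilnorEquiv (_root_.constantsFlow t a) (_root_.constantsFlow t b) := by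
  obtain ⟨c, σ, hc, h⟩ := h
  refine ⟨c, σ, hc, fun i => ?_⟩
  rw [show b = fun j => c * a (σ j) from funext h, constantsFlow_scale_perm]

namespace Moduli

/-- The flow of the normalized vector field on the moduli space. -/
noncomputable def ricciFlow : Flow ℝ Moduli where
  toFun t x := milnorMap ⟨constantsFlow t (Function.surjInv milnorMap_surjective x).1,
    constantsFlow_ne_zero (Function.surjInv milnorMap_surjective x).2 t⟩
  cont' := by
    -- Openness makes the product with `ℝ` a quotient map again, so joint continuity can be tested
    -- on structure constants.
    have hq := (IsOpenQuotientMap.id (X := ℝ)).prodMap isOpenQuotientMap_milnorMap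
    rw [← hq.continuous_comp_iff]
    have : (Function.uncurry fun t x => milnorMap ⟨constantsFlow t
        (Function.surjInv milnorMap_surjective x).1,
        constantsFlow_ne_zero (Function.surjInv milnorMap_surjective x).2 t⟩) ∘
        Prod.map id milnorMap = fun p : ℝ × {a : Fin 3 → ℝ // a ≠ 0} =>
          milnorMap ⟨constantsFlow p.1 p.2.1, constantsFlow_ne_zero p.2.2 p.1⟩ := by
      funext p
      exact milnorMap_eq_iff.2
        ((milnorMap_eq_iff.1 (Function.surjInv_eq milnorMap_surjective _)).constantsFlow _)
    rw [this]
    refine continuous_milnorMap.comp (Continuous.subtype_mk ?_ _)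
    exact constantsFlow.continuous continuous_fst (continuous_subtype_val.comp continuous_snd)
  map_add' t₁ t₂ x := by
    rw [milnorMap_eq_iff]
    dsimp only
    rw [constantsFlow.map_add]
    refine MilnorEquiv.constantsFlow ?_ _
    exact (milnorMap_eq_iff.1 (Function.surjInv_eq milnorMap_surjective _)).symm
  map_zero' x := by
    refine Eq.trans ?_ (Function.surjInv_eq milnorMap_surjective x)
    congr 1
    exact Subtype.ext (constantsFlow.map_zero_apply _)

theorem ricciFlow_milnorMap (a : {a : Fin 3 → ℝ // a ≠ 0}) (t : ℝ) :
    ricciFlow t (milnorMap a) =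
      milnorMap ⟨constantsFlow t a.1, constantsFlow_ne_zero a.2 t⟩ :=
  milnorMap_eq_iff.2
    ((milnorMap_eq_iff.1 (Function.surjInv_eq milnorMap_surjective _)).constantsFlow _)

end Moduli

/-! ### The Ricci tensor in a Milnor frame -/

namespace MetricLieAlgebra

theorem metric_conn (A : MetricLieAlgebra) (x y z : Fin 3 → ℝ) :
    A.metric (A.conn x y) z = 1 / 2 * (A.metric (A.bracket x y) z - A.metric (A.bracket y z) x +
      A.metric (A.bracket z x) y) := by
  have h : A.metric (A.conn x y) = A.koszul x y :=
    LinearEquiv.apply_symm_apply (LinearMap.BilinForm.toDual A.metric A.metric_nondegenerate) _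
  rw [h]
  simp [koszul]
  ring

variable {A : MetricLieAlgebra} {a : Fin 3 → ℝ} {L : (Fin 3 → ℝ) ≃ₗ[ℝ] (Fin 3 → ℝ)}

/-- In a Milnor frame Koszul's formula makes `∇ₓ` the cross product with `μ * x`; this is the origin
of the numbers `μ i`. -/
theorem IsMilnorFrame.map_conn (hL : A.IsMilnorFrame a L) (x y : Fin 3 → ℝ) :
    L (A.conn x y) = crossProduct (milnorMu a * L x) (L y) := by
  refine (dotProduct_eq_iff).1 fun z => ?_
  obtain ⟨z, rfl⟩ := L.surjective z
  rw [← hL.metric_eq, metric_conn]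
  simp only [hL.metric_eq, hL.map_bracket]
  simp [cross_apply, dotProduct, Fin.sum_univ_three, milnorMu]
  ring

/-- The principal Ricci curvatures for given structure constants. -/
noncomputable def ricciCoeff (a : Fin 3 → ℝ) (i : Fin 3) : ℝ :=
  2 * milnorMu a (i + 1) * milnorMu a (i + 2)

/-- The trace does not depend on the basis, so it can be taken in the frame, where the connection is
a cross product. -/
theorem IsMilnorFrame.ricci_eq (hL : A.IsMilnorFrame a L) (x y : Fin 3 → ℝ) :
    A.ricci x y = ∑ i, ricciCoeff a i * (L x i * L y i) := by
  let c : (Fin 3 → ℝ) → (Fin 3 → ℝ) →ₗ[ℝ] (Fin 3 → ℝ) := fun w => crossProduct (milnorMu a * w)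
  let cl : (Fin 3 → ℝ) → (Fin 3 → ℝ) →ₗ[ℝ] (Fin 3 → ℝ) := fun w =>
    crossProduct.flip w ∘ₗ LinearMap.mulLeft ℝ (milnorMu a)
  let Z : (Fin 3 → ℝ) →ₗ[ℝ] (Fin 3 → ℝ) :=
    cl (c (L x) (L y)) - c (L x) ∘ₗ cl (L y) -
      cl (L y) ∘ₗ (LinearMap.mulLeft ℝ a ∘ₗ crossProduct.flip (L x))
  have hZ : ∀ z, A.curvature z x y = (L.symm.toLinearMap ∘ₗ Z ∘ₗ L.toLinearMap) z := by
    intro z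
    apply L.injective
    simp [curvature, hL.map_conn, hL.map_bracket, Z, c, cl]
  have htr : ∀ f : (Fin 3 → ℝ) →ₗ[ℝ] (Fin 3 → ℝ),
      ∑ i, f (Pi.single i 1) i = LinearMap.trace ℝ (Fin 3 → ℝ) f := by
    intro f
    rw [LinearMap.trace_eq_matrix_trace ℝ (Pi.basisFun ℝ (Fin 3))]
    simp [Matrix.trace]
  have h1 : LinearMap.trace ℝ _ (L.symm.toLinearMap ∘ₗ Z ∘ₗ L.toLinearMap) =
      LinearMap.trace ℝ _ Z := by
    rw [LinearMap.trace_comp_comm', LinearMap.comp_assoc]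
    simp
  rw [ricci]
  simp only [hZ]
  rw [htr, h1, ← htr]
  simp [Z, c, cl, Fin.sum_univ_three, cross_apply, ricciCoeff, milnorMu, Pi.single_apply]
  ring

/-- Traces and adjugates transform well under congruence, as is needed for metrics that are not
orthonormal in the given coordinates. -/
theorem ricciCoeff_diagonal (a : Fin 3 → ℝ) :
    diagonal (ricciCoeff a) = -((diagonal a).trace ^ 2 / 2) • (1 : Matrix (Fin 3) (Fin 3) ℝ) +
      (diagonal a).trace • diagonal a + (2 : ℝ) • adjugate (diagonal a) := by
  ext i j
  fin_cases i <;> fin_cases j <;>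
    simp [ricciCoeff, milnorMu, adjugate_fin_three, Matrix.trace, Fin.sum_univ_three,
      -adjugate_diagonal] <;> ring

/-- The Ricci tensor of the metric with Gram matrix `Q` on the Lie algebra with structure constants
`a`. -/
noncomputable def ricciMatrix (a : Fin 3 → ℝ) (Q : Matrix (Fin 3) (Fin 3) ℝ) :
    Matrix (Fin 3) (Fin 3) ℝ :=
  -((diagonal a * Q).trace ^ 2 / (2 * Q.det)) • Q +
    ((diagonal a * Q).trace / Q.det) • (Q * diagonal a * Q) + (2 : ℝ) • adjugate (diagonal a)

/-- The Ricci tensor becomes a function of the Gram matrix alone. Along a flow the Gram matrix is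
differentiable, while Milnor frames chosen at each time need not be. -/
theorem ricciMatrix_gram {a b : Fin 3 → ℝ} {P : Matrix (Fin 3) (Fin 3) ℝ} (hP : P.det ≠ 0)
    (h : P * diagonal a * Pᵀ = P.det • diagonal b) :
    Pᵀ * diagonal (ricciCoeff b) * P = ricciMatrix a (Pᵀ * P) := by
  have htr : (diagonal a * (Pᵀ * P)).trace = P.det * (diagonal b).trace := by
    rw [← Matrix.mul_assoc, Matrix.trace_mul_comm, ← Matrix.mul_assoc, h, Matrix.trace_smul,
      smul_eq_mul]
  have hdet : (Pᵀ * P).det = P.det ^ 2 := by rw [det_mul, det_transpose]; ring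
  have hQ : Pᵀ * P * diagonal a * (Pᵀ * P) = P.det • (Pᵀ * diagonal b * P) := by
    calc Pᵀ * P * diagonal a * (Pᵀ * P) = Pᵀ * (P * diagonal a * Pᵀ) * P := by
          simp only [Matrix.mul_assoc]
      _ = _ := by rw [h]; simp
  have hadj : Pᵀ * adjugate (diagonal b) * P = adjugate (diagonal a) := by
    have h1 := congrArg adjugate h
    rw [adjugate_mul_distrib, adjugate_mul_distrib, adjugate_smul] at h1
    have h2 : P.det ^ 2 • (Pᵀ * adjugate (diagonal b) * P) =
        P.det ^ 2 • adjugate (diagonal a) := by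
      calc P.det ^ 2 • (Pᵀ * adjugate (diagonal b) * P)
          = Pᵀ * (P.det ^ (Fintype.card (Fin 3) - 1) • adjugate (diagonal b)) * P := by simp
        _ = (Pᵀ * adjugate Pᵀ) * adjugate (diagonal a) * (adjugate P * P) := by
            rw [← h1]; simp only [Matrix.mul_assoc]
        _ = _ := by
            rw [mul_adjugate, adjugate_mul, det_transpose]
            simp [smul_smul, sq]
    exact smul_right_injective _ (pow_ne_zero 2 hP) h2
  rw [ricciMatrix, htr, hdet, hQ, ricciCoeff_diagonal]
  simp only [Matrix.mul_add, Matrix.add_mul, Matrix.mul_smul, Matrix.smul_mul, hadj,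
    Matrix.mul_one, smul_smul]
  congr 3
  · field_simp
  · field_simp

/-- The Gram matrix of the metric in the coordinates `L`. -/
noncomputable def gram (A : MetricLieAlgebra) (L : (Fin 3 → ℝ) ≃ₗ[ℝ] (Fin 3 → ℝ)) :
    Matrix (Fin 3) (Fin 3) ℝ :=
  Matrix.of fun i j => A.metric (L.symm (Pi.single i 1)) (L.symm (Pi.single j 1))

/-- The coordinates `L` normalize the bracket but need not be orthonormal. The matrix `P` compares
them with a Milnor frame, and compatibility with both brackets is the hypothesis of
`ricciMatrix_gram`. -/
theorem exists_gram_eq (hA : A.IsUnimodular)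
    (hL : ∀ x y, L (A.bracket x y) = a * crossProduct (L x) (L y)) :
    0 < (A.gram L).det ∧ ∀ i j, A.ricci (L.symm (Pi.single i 1)) (L.symm (Pi.single j 1)) =
      ricciMatrix a (A.gram L) i j := by
  obtain ⟨b, N, hN⟩ := A.exists_isMilnorFrame hA
  let e : (Fin 3 → ℝ) ≃ₗ[ℝ] (Fin 3 → ℝ) := L.symm.trans N
  set P := LinearMap.toMatrix' (e : (Fin 3 → ℝ) →ₗ[ℝ] (Fin 3 → ℝ)) with hPdef
  have heP : ∀ x, N (L.symm x) = P *ᵥ x := fun x => by simp [hPdef, e]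
  have hdet : P.det ≠ 0 := by
    have := LinearEquiv.isUnit_det' e
    rw [← LinearMap.det_toMatrix'] at this
    exact this.ne_zero
  have hgram : A.gram L = Pᵀ * P := by
    ext i j
    simp [gram, hN.metric_eq, heP, Matrix.mul_apply, dotProduct]
  have hM : P * diagonal a * Pᵀ = P.det • diagonal b := by
    have h1 : P * diagonal a = diagonal b * (adjugate P)ᵀ := by
      have hcross : ∀ x y, crossProduct (P *ᵥ x) (P *ᵥ y) =
          (adjugate P)ᵀ *ᵥ crossProduct x y := by
        intro x y
        have h2 := congrArg ((adjugate P)ᵀ *ᵥ ·) (transpose_mulVec_cross P x y)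
        simp only [mulVec_mulVec, ← transpose_mul, mul_adjugate, transpose_smul, transpose_one,
          smul_mulVec, one_mulVec, mulVec_smul] at h2
        exact smul_right_injective _ hdet h2
      refine Matrix.toLin'.injective (LinearMap.ext fun z => ?_)
      rw [toLin'_apply, toLin'_apply]
      refine exists_cross_eq z
        (fun z => (P * diagonal a) *ᵥ z = (diagonal b * (adjugate P)ᵀ) *ᵥ z) (fun x y => ?_) (fun x y hx hy => by
        rw [mulVec_add, mulVec_add, hx, hy])
      have hbr : A.bracket (L.symm x) (L.symm y) = L.symm (a * crossProduct x y) := by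
        apply L.injective
        simp [hL]
      have h2 := hN.map_bracket (L.symm x) (L.symm y)
      rw [hbr, heP, heP, heP, hcross] at h2
      have hd : ∀ (c z : Fin 3 → ℝ), diagonal c *ᵥ z = c * z := fun c z => by
        ext i; simp [mulVec_diagonal]
      rw [← mulVec_mulVec, ← mulVec_mulVec, hd, hd]
      exact h2
    rw [h1, Matrix.mul_assoc, ← transpose_mul, mul_adjugate]
    simp
  refine ⟨?_, fun i j => ?_⟩
  · rw [hgram, det_mul, det_transpose]
    exact mul_self_pos.2 hdet
  · rw [hgram, ← ricciMatrix_gram hdet hM, hN.ricci_eq]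
    simp [heP, Matrix.mul_apply, diagonal_apply, mul_comm, mul_left_comm]

end MetricLieAlgebra

/-- Grönwall with a variable coefficient, which is bounded on the compact interval between `0` and
`t`. -/
theorem eq_zero_of_norm_deriv_le {E : Type*} [NormedAddCommGroup E] [NormedSpace ℝ E]
    {f f' : ℝ → E} {C : ℝ → ℝ} {I : Set ℝ} (hI : I.OrdConnected) (h0 : 0 ∈ I)
    (hf : ∀ t ∈ I, HasDerivAt f (f' t) t) (hC : ContinuousOn C I)
    (hb : ∀ t ∈ I, ‖f' t‖ ≤ C t * ‖f t‖) (hz : f 0 = 0) : ∀ t ∈ I, f t = 0 := by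
  have main : ∀ (f f' : ℝ → E) (C : ℝ → ℝ) (T : ℝ), 0 ≤ T →
      (∀ t ∈ Set.Icc 0 T, HasDerivAt f (f' t) t) → ContinuousOn C (Set.Icc 0 T) →
      (∀ t ∈ Set.Icc 0 T, ‖f' t‖ ≤ C t * ‖f t‖) → f 0 = 0 → f T = 0 := by
    intro f f' C T hT hf hC hb hz
    obtain ⟨K, hK⟩ := isCompact_Icc.exists_bound_of_continuousOn hC
    exact eq_zero_of_abs_deriv_le_mul_abs_self_of_eq_zero_right (K := K) (f' := f')
      (fun t ht => (hf t ht).continuousAt.continuousWithinAt)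
      (fun t ht => (hf t (Set.Ico_subset_Icc_self ht)).hasDerivWithinAt) hz
      (fun t ht => (hb t (Set.Ico_subset_Icc_self ht)).trans (mul_le_mul_of_nonneg_right
        ((le_abs_self _).trans (hK t (Set.Ico_subset_Icc_self ht))) (norm_nonneg _)))
      T ⟨hT, le_rfl⟩
  intro t ht
  rcases le_total 0 t with h | h
  · have hs : Set.Icc 0 t ⊆ I := hI.out h0 ht
    exact main f f' C t h (fun s hs' => hf s (hs hs')) (hC.mono hs) (fun s hs' => hb s (hs hs')) hz
  · have hs : ∀ s ∈ Set.Icc 0 (-t), -s ∈ I := fun s hs' =>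
      hI.out ht h0 ⟨by linarith [hs'.2], by linarith [hs'.1]⟩
    have := main (fun s => f (-s)) (fun s => -f' (-s)) (fun s => C (-s)) (-t) (by linarith)
      (fun s hs' => by
        simpa [Function.comp_def] using (hf _ (hs s hs')).scomp s (hasDerivAt_neg s))
      (hC.comp continuous_neg.continuousOn hs)
      (fun s hs' => by rw [norm_neg]; exact hb _ (hs s hs')) (by simpa using hz)
    simpa using this

/-! ### Solutions of the Ricci flow in a Milnor frame -/

namespace MetricLieAlgebra

variable {A : MetricLieAlgebra} {a : Fin 3 → ℝ} {L : (Fin 3 → ℝ) ≃ₗ[ℝ] (Fin 3 → ℝ)}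

/-- The structure constants after rescaling the frame to be orthonormal for the diagonal metric
`q`. -/
noncomputable def rescaledConstants (a q : Fin 3 → ℝ) (i : Fin 3) : ℝ :=
  a i * q i / √(q 0 * q 1 * q 2)

/-- Normalizing the basis multiplies the `i`-th constant by `√qᵢ / (√qⱼ √qₖ)`, which is `qᵢ / √(q₀
q₁ q₂)`. -/
theorem isMilnorFrame_rescale {q : Fin 3 → ℝ} (hq : ∀ i, 0 < q i)
    (hbr : ∀ x y, L (A.bracket x y) = a * crossProduct (L x) (L y))
    (hm : ∀ x y, A.metric x y = ∑ i, q i * (L x i * L y i)) :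
    A.IsMilnorFrame (rescaledConstants a q) (L.trans (LinearEquiv.piCongrRight fun i =>
      LinearEquiv.smulOfNeZero ℝ ℝ (√(q i)) (Real.sqrt_pos.2 (hq i)).ne')) := by
  have hs : ∀ i, √(q i) * √(q i) = q i := fun i => Real.mul_self_sqrt (hq i).le
  have hs0 : ∀ i, √(q i) ≠ 0 := fun i => (Real.sqrt_pos.2 (hq i)).ne'
  have hp : √(q 0 * q 1 * q 2) = √(q 0) * √(q 1) * √(q 2) := by
    rw [Real.sqrt_mul (mul_pos (hq 0) (hq 1)).le, Real.sqrt_mul (hq 0).le]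
  constructor
  · intro x y
    have h0 := hs0 0
    have h1 := hs0 1
    have h2 := hs0 2
    ext i
    simp only [LinearEquiv.trans_apply, LinearEquiv.piCongrRight_apply, hbr, Pi.mul_apply,
      LinearEquiv.smulOfNeZero_apply, smul_eq_mul, rescaledConstants, hp]
    rw [← hs i]
    fin_cases i <;> simp [cross_apply] <;> field_simp
  · intro x y
    rw [hm]
    simp only [dotProduct, LinearEquiv.trans_apply, LinearEquiv.piCongrRight_apply,
      LinearEquiv.smulOfNeZero_apply, smul_eq_mul]
    refine Finset.sum_congr rfl fun i _ => ?_
    linear_combination -(L x i * L y i) * hs i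

theorem ricci_eq_of_diagonal {q : Fin 3 → ℝ} (hq : ∀ i, 0 < q i)
    (hbr : ∀ x y, L (A.bracket x y) = a * crossProduct (L x) (L y))
    (hm : ∀ x y, A.metric x y = ∑ i, q i * (L x i * L y i)) (x y : Fin 3 → ℝ) :
    A.ricci x y = ∑ i, ricciCoeff (rescaledConstants a q) i * q i * (L x i * L y i) := by
  rw [(isMilnorFrame_rescale hq hbr hm).ricci_eq]
  refine Finset.sum_congr rfl fun i _ => ?_
  simp only [LinearEquiv.trans_apply, LinearEquiv.piCongrRight_apply,
    LinearEquiv.smulOfNeZero_apply, smul_eq_mul]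
  linear_combination ricciCoeff (rescaledConstants a q) i * (L x i * L y i) *
    Real.mul_self_sqrt (hq i).le

theorem metric_eq_sum_gram (x y : Fin 3 → ℝ) :
    A.metric x y = ∑ i, ∑ j, A.gram L i j * (L x i * L y j) := by
  have h : ∀ x, x = ∑ i, L x i • L.symm (Pi.single i 1) := by
    intro x
    apply L.injective
    simp only [map_sum, map_smul, LinearEquiv.apply_symm_apply]
    exact pi_eq_sum_univ' (L x)
  conv_lhs => rw [h x, h y]
  simp only [map_sum, map_smul, LinearMap.sum_apply, LinearMap.smul_apply, smul_eq_mul,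
    Finset.mul_sum]
  rw [Finset.sum_comm]
  refine Finset.sum_congr rfl fun i _ => Finset.sum_congr rfl fun j _ => ?_
  simp only [MetricLieAlgebra.gram, Matrix.of_apply]
  ring

theorem constantsField_eq (a : Fin 3 → ℝ) (i : Fin 3) :
    constantsField a i = a i * (∑ j, ricciCoeff a j - 2 * ricciCoeff a i) := by
  fin_cases i <;> simp [constantsField, ricciCoeff, milnorMu, Fin.sum_univ_three] <;> ring

/-- Logarithmic differentiation: `q i` contributes `-2 r i`, and the root of the product in the
denominator contributes the sum of all `r j`. -/
theorem hasDerivAt_rescaledConstants {q r : ℝ → Fin 3 → ℝ} {t : ℝ} (hq : ∀ i, 0 < q t i)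
    (h : ∀ i, HasDerivAt (fun s => q s i) (-2 * (r t i * q t i)) t) (i : Fin 3) :
    HasDerivAt (fun s => rescaledConstants a (q s) i)
      (rescaledConstants a (q t) i * (∑ j, r t j - 2 * r t i)) t := by
  have hp : 0 < q t 0 * q t 1 * q t 2 := mul_pos (mul_pos (hq 0) (hq 1)) (hq 2)
  have hs := Real.sqrt_pos.2 hp
  have h1 := (((h 0).mul (h 1)).mul (h 2)).sqrt hp.ne'
  have h2 : HasDerivAt (fun s => rescaledConstants a (q s) i) _ t :=
    ((h i).const_mul (a i)).div h1 hs.ne'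
  refine h2.congr_deriv ?_
  simp only [rescaledConstants, Fin.sum_univ_three, Pi.mul_apply]
  have h3 := Real.sq_sqrt hp.le
  field_simp
  rw [h3]
  ring

end MetricLieAlgebra

open MetricLieAlgebra

/-- The off-diagonal part of the Gram matrix starts at zero and satisfies a linear differential
inequality: off the diagonal the adjugate term of `ricciMatrix` vanishes and every other term has an
off-diagonal entry of `Q` as a factor. Grönwall then suffices, without a uniqueness theorem for the
Ricci flow. -/
theorem IsRicciFlow.gram_offDiagonal {A : ℝ → UnimodularMLA} {I : Set ℝ} (h : IsRicciFlow A I)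
    {a : Fin 3 → ℝ} {L : (Fin 3 → ℝ) ≃ₗ[ℝ] (Fin 3 → ℝ)} (hL : (A 0).1.IsMilnorFrame a L)
    {t : ℝ} (ht : t ∈ I) {i j : Fin 3} (hij : i ≠ j) : (A t).1.gram L i j = 0 := by
  set Q : ℝ → Matrix (Fin 3) (Fin 3) ℝ := fun t => (A t).1.gram L with hQdef
  have hbr : ∀ t ∈ I, ∀ x y, L ((A t).1.bracket x y) = a * crossProduct (L x) (L y) := by
    intro t ht x y
    rw [h.bracket_eq t ht, hL.map_bracket]
  have hdet : ∀ t ∈ I, 0 < (Q t).det := fun t ht => (exists_gram_eq (A t).2.1 (hbr t ht)).1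
  have hder : ∀ t ∈ I, ∀ i j, HasDerivAt (fun s => Q s i j) (-2 * ricciMatrix a (Q t) i j) t := by
    intro t ht i j
    rw [← (exists_gram_eq (A t).2.1 (hbr t ht)).2]
    exact h.hasDerivAt t ht _ _
  have hQc : ContinuousOn Q I := fun t ht => (continuousAt_pi.2 fun i => continuousAt_pi.2 fun j =>
    (hder t ht i j).continuousAt).continuousWithinAt
  let T : ℝ → ℝ := fun t => (diagonal a * Q t).trace
  let S : ℝ → ℝ := fun t => ∑ k, ∑ l, |Q t k l|
  have hT : ContinuousOn T I :=
    (continuous_const.matrix_mul continuous_id).matrix_trace.comp_continuousOn hQc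
  have hD : ContinuousOn (fun t => (Q t).det) I :=
    continuous_id.matrix_det.comp_continuousOn hQc
  have hQe : ∀ i j, ContinuousOn (fun t => Q t i j) I := fun i j t ht =>
    (hder t ht i j).continuousAt.continuousWithinAt
  have hS : ContinuousOn S I := continuousOn_finsetSum _ fun k _ =>
    continuousOn_finsetSum _ fun l _ => (hQe k l).abs
  let f : ℝ → Fin 3 → Fin 3 → ℝ := fun t i j => if i = j then 0 else Q t i j
  let f' : ℝ → Fin 3 → Fin 3 → ℝ := fun t i j =>
    if i = j then 0 else -2 * ricciMatrix a (Q t) i j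
  let C : ℝ → ℝ := fun t => |T t ^ 2 / (Q t).det| +
    2 * |T t / (Q t).det| * ((∑ k, |a k|) * S t)
  have hC : ContinuousOn C I := by
    have hne : ∀ t ∈ I, (Q t).det ≠ 0 := fun t ht => (hdet t ht).ne'
    exact ((hT.pow 2).div hD hne).abs.add
      ((continuousOn_const.mul (hT.div hD hne).abs).mul (continuousOn_const.mul hS))
  have hz : f 0 = 0 := by
    funext i j
    by_cases hij : i = j
    · simp [f, hij]
    · simp [f, hij, Q, MetricLieAlgebra.gram, hL.metric_eq]
  have hb : ∀ t ∈ I, ‖f' t‖ ≤ C t * ‖f t‖ := by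
    intro t ht
    have hS0 : 0 ≤ S t := Finset.sum_nonneg fun k _ => Finset.sum_nonneg fun l _ => abs_nonneg _
    have hC0 : 0 ≤ C t := by
      have : 0 ≤ ∑ k, |a k| := Finset.sum_nonneg fun k _ => abs_nonneg _
      positivity
    have hoff : ∀ i j, i ≠ j → |Q t i j| ≤ ‖f t‖ := by
      intro i j hij
      have h1 := (norm_le_pi_norm (f t i) j).trans (norm_le_pi_norm (f t) i)
      simpa [f, hij] using h1
    have hall : ∀ i j, |Q t i j| ≤ S t := fun i j =>
      (Finset.single_le_sum (f := fun l => |Q t i l|) (fun _ _ => abs_nonneg _)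
        (Finset.mem_univ j)).trans (Finset.single_le_sum (f := fun k => ∑ l, |Q t k l|)
        (fun _ _ => Finset.sum_nonneg fun _ _ => abs_nonneg _) (Finset.mem_univ i))
    have hmul : ∀ i j, i ≠ j → |(Q t * diagonal a * Q t) i j| ≤
        (∑ k, |a k|) * S t * ‖f t‖ := by
      intro i j hij
      rw [Matrix.mul_apply, Finset.sum_mul, Finset.sum_mul]
      refine (Finset.abs_sum_le_sum_abs _ _).trans (Finset.sum_le_sum fun k _ => ?_)
      rw [mul_diagonal, abs_mul, abs_mul]
      -- As `i ≠ j`, at least one of the factors `Q i k` and `Q k j` is off-diagonal.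
      by_cases hk : i = k
      · have h1 := hoff k j (hk ▸ hij)
        have h2 := hall i k
        calc |Q t i k| * |a k| * |Q t k j| ≤ S t * |a k| * ‖f t‖ := by gcongr
          _ = _ := by ring
      · have h1 := hoff i k hk
        have h2 := hall k j
        calc |Q t i k| * |a k| * |Q t k j| ≤ ‖f t‖ * |a k| * S t := by gcongr
          _ = _ := by ring
    refine (pi_norm_le_iff_of_nonneg (by positivity)).2 fun i =>
      (pi_norm_le_iff_of_nonneg (by positivity)).2 fun j => ?_
    by_cases hij : i = j
    · simp only [f', hij, if_true, norm_zero]; positivity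
    · simp only [f', hij, if_false, Real.norm_eq_abs]
      have hadj : adjugate (diagonal a) i j = 0 := by simp [adjugate_diagonal, hij]
      have e : -2 * ricciMatrix a (Q t) i j = T t ^ 2 / (Q t).det * Q t i j +
          -(2 * (T t / (Q t).det) * (Q t * diagonal a * Q t) i j) := by
        have := (hdet t ht).ne'
        simp only [ricciMatrix, Matrix.add_apply, Matrix.smul_apply, smul_eq_mul, hadj, T]
        field_simp
        ring
      rw [e]
      refine (abs_add_le _ _).trans ?_
      rw [abs_neg, abs_mul, abs_mul, abs_mul, abs_two]
      have h1 := mul_le_mul_of_nonneg_left (hoff i j hij) (abs_nonneg (T t ^ 2 / (Q t).det))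
      have h2 := mul_le_mul_of_nonneg_left (hmul i j hij)
        (show 0 ≤ 2 * |T t / (Q t).det| by positivity)
      refine (add_le_add h1 h2).trans (le_of_eq ?_)
      simp only [C]; ring
  have := eq_zero_of_norm_deriv_le (f := f) (f' := f') h.ordConnected h.zero_mem
    (fun t ht => hasDerivAt_pi.2 fun i => hasDerivAt_pi.2 fun j => by
      by_cases hij : i = j
      · simpa [f, f', hij] using hasDerivAt_const t (0 : ℝ)
      · simpa [f, f', hij] using hder t ht i j) hC hb hz t ht
  simpa [f, hij] using congrFun (congrFun this i) j

/-- The initial frame stays orthogonal, so rescaling its vectors gives Milnor frames whose constants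
are differentiable in time. -/
theorem IsRicciFlow.exists_constants {A : ℝ → UnimodularMLA} {I : Set ℝ} (h : IsRicciFlow A I) :
    ∃ b : ℝ → Fin 3 → ℝ, (∀ t ∈ I, b t ≠ 0 ∧ ∃ L, (A t).1.IsMilnorFrame (b t) L) ∧
      ∀ t ∈ I, HasDerivAt b (constantsField (b t)) t := by
  obtain ⟨a, L, hL, ha⟩ := (A 0).exists_frame
  let q : ℝ → Fin 3 → ℝ := fun t i => (A t).1.gram L i i
  have hbr : ∀ t ∈ I, ∀ x y, L ((A t).1.bracket x y) = a * crossProduct (L x) (L y) := by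
    intro t ht x y
    rw [h.bracket_eq t ht, hL.map_bracket]
  have hm : ∀ t ∈ I, ∀ x y, (A t).1.metric x y = ∑ i, q t i * (L x i * L y i) := by
    intro t ht x y
    rw [metric_eq_sum_gram (L := L)]
    refine Finset.sum_congr rfl fun i _ => ?_
    rw [Finset.sum_eq_single i]
    · intro j _ hj
      rw [h.gram_offDiagonal hL ht hj.symm, zero_mul]
    · simp
  have hq : ∀ t i, 0 < q t i := fun t i => (A t).1.metric_pos _ (by simp)
  have hder : ∀ t ∈ I, ∀ i, HasDerivAt (fun s => q s i)
      (-2 * (ricciCoeff (rescaledConstants a (q t)) i * q t i)) t := by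
    intro t ht i
    have h1 := h.hasDerivAt t ht (L.symm (Pi.single i 1)) (L.symm (Pi.single i 1))
    rw [ricci_eq_of_diagonal (hq t) (hbr t ht) (hm t ht)] at h1
    refine h1.congr_deriv ?_
    simp [Pi.single_apply]
  refine ⟨fun t => rescaledConstants a (q t), fun t ht => ?_, fun t ht => ?_⟩
  · have hfr := isMilnorFrame_rescale (hq t) (hbr t ht) (hm t ht)
    exact ⟨hfr.ne_zero (A t).2.2, _, hfr⟩
  · refine hasDerivAt_pi.2 fun i => ?_
    rw [constantsField_eq]
    exact hasDerivAt_rescaledConstants (r := fun t => ricciCoeff (rescaledConstants a (q t)))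
      (hq t) (hder t ht) i

/-! ### The flow on the moduli space is a normalized Ricci flow -/

theorem exists_primitive {g : ℝ → ℝ} {I : Set ℝ} (hI : IsOpen I) (hI' : I.OrdConnected)
    (h0 : 0 ∈ I) (hg : ContinuousOn g I) :
    ∃ s : ℝ → ℝ, s 0 = 0 ∧ ∀ t ∈ I, HasDerivAt s (g t) t := by
  refine ⟨fun t => ∫ x in (0 : ℝ)..t, g x, by simp, fun t ht => ?_⟩
  exact intervalIntegral.integral_hasDerivAt_right
    ((hg.mono (hI'.uIcc_subset h0 ht)).intervalIntegrable)
    (hg.stronglyMeasurableAtFilter hI t ht) (hg.continuousAt (hI.mem_nhds ht))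

theorem norm_ne_zero_sq_smul_normalizedField {a : Fin 3 → ℝ} (ha : a ≠ 0) :
    ‖a‖ ^ 2 • normalizedField a = constantsField a := by
  ext i
  have : ‖a‖ ≠ 0 := norm_ne_zero_iff.2 ha
  simp only [Pi.smul_apply, smul_eq_mul, normalizedField]
  field_simp

/-- Curves of structure constants under the Ricci flow are orbits of the normalized flow, up to
time change. -/
theorem eq_constantsFlow_of_hasDerivAt {b : ℝ → Fin 3 → ℝ} {s : ℝ → ℝ} {I : Set ℝ}
    (hI : I.OrdConnected) (h0 : 0 ∈ I) (hb0 : ∀ t ∈ I, b t ≠ 0)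
    (hb : ∀ t ∈ I, HasDerivAt b (constantsField (b t)) t) (hs0 : s 0 = 0)
    (hs : ∀ t ∈ I, HasDerivAt s (‖b t‖ ^ 2) t) {t : ℝ} (ht : t ∈ I) :
    b t = constantsFlow (s t) (b 0) := by
  obtain ⟨K, hK⟩ := exists_lipschitzWith_normalizedField
  have hbc : ContinuousOn b I := fun t ht => (hb t ht).continuousAt.continuousWithinAt
  have := eq_zero_of_norm_deriv_le (f := fun t => b t - constantsFlow (s t) (b 0))
    (f' := fun t => constantsField (b t) - ‖b t‖ ^ 2 • normalizedField (constantsFlow (s t) (b 0)))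
    (C := fun t => ‖b t‖ ^ 2 * K) hI h0
    (fun t ht => (hb t ht).fun_sub ((hasDerivAt_constantsFlow (b 0) (s t)).scomp t (hs t ht)))
    ((hbc.norm.pow 2).mul continuousOn_const)
    (fun t ht => by
      rw [← norm_ne_zero_sq_smul_normalizedField (hb0 t ht), ← smul_sub, norm_smul, mul_assoc,
        norm_pow, norm_norm]
      gcongr
      simpa [dist_eq_norm] using hK.dist_le_mul (b t) (constantsFlow (s t) (b 0)))
    (by simp [hs0, constantsFlow.map_zero_apply]) t ht
  exact sub_eq_zero.1 this

theorem strictMonoOn_of_hasDerivAt_pos {s g : ℝ → ℝ} {I : Set ℝ} (hI : I.OrdConnected)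
    (hs : ∀ t ∈ I, HasDerivAt s (g t) t) (hg : ∀ t ∈ I, 0 < g t) : StrictMonoOn s I :=
  strictMonoOn_of_deriv_pos hI.convex
    (fun t ht => (hs t ht).continuousAt.continuousWithinAt)
    (fun t ht => by
      rw [(hs t (interior_subset ht)).deriv]
      exact hg t (interior_subset ht))

namespace Moduli

/-- The time change is a primitive of `‖b‖ ^ 2`, the positive factor removed by the normalization.
-/
theorem isNormalizedRicciFlow_ricciFlow : IsNormalizedRicciFlow ricciFlow := by
  intro A I h
  obtain ⟨b, hfr, hb⟩ := h.exists_constants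
  have hbc : ContinuousOn b I := fun t ht => (hb t ht).continuousAt.continuousWithinAt
  obtain ⟨s, hs0, hs⟩ := exists_primitive h.isOpen h.ordConnected h.zero_mem (hbc.norm.pow 2)
  refine ⟨s, hs0, fun t ht => (hs t ht).continuousAt.continuousWithinAt,
    strictMonoOn_of_hasDerivAt_pos h.ordConnected hs
      fun t ht => pow_pos (norm_pos_iff.2 (hfr t ht).1) 2, fun t ht => ?_⟩
  obtain ⟨hb0, L₀, hL₀⟩ := hfr 0 h.zero_mem
  obtain ⟨hbt, L, hL⟩ := hfr t ht
  rw [← milnorMap_eq_mk hb0 hL₀, ← milnorMap_eq_mk hbt hL, ricciFlow_milnorMap]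
  congr 2
  exact (eq_constantsFlow_of_hasDerivAt h.ordConnected h.zero_mem (fun t ht => (hfr t ht).1)
    hb hs0 hs ht).symm

end Moduli

/-! ### Existence of Ricci flows -/

/-- The Lie algebra with structure constants `a` and the inner product that is diagonal with
entries `q`. -/
noncomputable def diagonalAlgebra (a q : Fin 3 → ℝ) (hq : ∀ i, 0 < q i) : MetricLieAlgebra where
  bracket := milnorBracket a
  bracket_self := (milnorAlgebra a).bracket_self
  jacobi := (milnorAlgebra a).jacobi
  metric := LinearMap.mk₂ ℝ (fun x y => ∑ i, q i * (x i * y i))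
    (fun x x' y => by simp [add_mul, mul_add, Finset.sum_add_distrib])
    (fun c x y => by
      simp only [Pi.smul_apply, smul_eq_mul, Finset.mul_sum]
      exact Finset.sum_congr rfl fun i _ => by ring)
    (fun x y y' => by simp [mul_add, Finset.sum_add_distrib])
    (fun c x y => by
      simp only [Pi.smul_apply, smul_eq_mul, Finset.mul_sum]
      exact Finset.sum_congr rfl fun i _ => by ring)
  metric_symm x y := by simp [mul_comm (x _)]
  metric_pos x hx := by
    obtain ⟨i, hi⟩ := Function.ne_iff.1 hx
    exact Finset.sum_pos' (fun j _ => mul_nonneg (hq j).le (mul_self_nonneg _))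
      ⟨i, Finset.mem_univ i, mul_pos (hq i) (mul_self_pos.2 hi)⟩

/-- Strictly increasing functions with positive derivative have an inverse on an open interval. -/
theorem exists_inverse_of_hasDerivAt_pos {g g' : ℝ → ℝ} (hg : ∀ t, HasDerivAt g (g' t) t)
    (hpos : ∀ t, 0 < g' t) :
    IsOpen (Set.range g) ∧ (Set.range g).OrdConnected ∧
      ∃ k : ℝ → ℝ, (∀ t, k (g t) = t) ∧ ∀ t, HasDerivAt k (g' t)⁻¹ (g t) := by
  have hc : Continuous g := continuous_iff_continuousAt.2 fun t => (hg t).continuousAt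
  have hmono : StrictMono g := strictMonoOn_univ.1
    (strictMonoOn_of_hasDerivAt_pos Set.ordConnected_univ (fun t _ => hg t) fun t _ => hpos t)
  have hord : (Set.range g).OrdConnected := (isPreconnected_range hc).ordConnected
  have hopen : IsOpen (Set.range g) := by
    rw [isOpen_iff_mem_nhds]
    rintro _ ⟨t, rfl⟩
    exact Filter.mem_of_superset
      (Icc_mem_nhds (hmono (sub_one_lt t)) (hmono (lt_add_one t)))
      (hord.out ⟨_, rfl⟩ ⟨_, rfl⟩)
  have hemb : Topology.IsOpenEmbedding g :=
    ⟨hmono.isEmbedding_of_ordConnected hord, hopen⟩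
  let e := hemb.toOpenPartialHomeomorph g
  have hl : ∀ t, e.symm (g t) = t := fun t => e.left_inv (by simp [e])
  refine ⟨hopen, hord, e.symm, hl, fun t => ?_⟩
  have := e.hasDerivAt_symm (a := g t) (f' := g' t) (by simp [e]) (hpos t).ne'
    (by rw [hl]; exact hg t)
  exact this

open MetricLieAlgebra

theorem isMilnorFrame_diagonalAlgebra (a q : Fin 3 → ℝ) (hq : ∀ i, 0 < q i) :
    ∃ L, (diagonalAlgebra a q hq).IsMilnorFrame (rescaledConstants a q) L :=
  ⟨_, isMilnorFrame_rescale (A := diagonalAlgebra a q hq) (L := LinearEquiv.refl ℝ _) hq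
    (fun _ _ => rfl) fun _ _ => rfl⟩

theorem rescaledConstants_ne_zero {a q : Fin 3 → ℝ} (ha : a ≠ 0) (hq : ∀ i, 0 < q i) :
    rescaledConstants a q ≠ 0 := by
  obtain ⟨i, hi⟩ := Function.ne_iff.1 ha
  refine Function.ne_iff.2 ⟨i, ?_⟩
  have := Real.sqrt_pos.2 (mul_pos (mul_pos (hq 0) (hq 1)) (hq 2))
  exact div_ne_zero (mul_ne_zero hi (hq i).ne') this.ne'

/-- The metric Lie algebra `diagonalAlgebra` as a unimodular one. -/
noncomputable def diagonalMLA {a : Fin 3 → ℝ} (ha : a ≠ 0) (q : Fin 3 → ℝ) (hq : ∀ i, 0 < q i) :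
    UnimodularMLA :=
  ⟨diagonalAlgebra a q hq, milnorAlgebra_isUnimodular a, milnorAlgebra_isNonabelian ha⟩

theorem continuous_ricciCoeff (i : Fin 3) : Continuous fun a => ricciCoeff a i := by
  unfold ricciCoeff milnorMu
  fun_prop

/-- Along a normalized orbit `b` everything is found by quadrature: the logarithms of the metric
coefficients from the Ricci curvatures, and the Ricci time `g` from `dg/dτ = ‖b‖⁻²`. One solution
covers the orbit for all `τ`, whether or not its own time interval `range g` is bounded. -/
theorem Moduli.exists_isRicciFlow (x : Moduli) :
    ∃ (A : ℝ → UnimodularMLA) (I : Set ℝ) (g : ℝ → ℝ), IsRicciFlow A I ∧ StrictMono g ∧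
      Continuous g ∧ g 0 = 0 ∧ ∀ τ, g τ ∈ I ∧ Moduli.mk (A (g τ)) = ricciFlow τ x := by
  obtain ⟨⟨a, ha⟩, rfl⟩ := milnorMap_surjective x
  let b : ℝ → Fin 3 → ℝ := fun τ => constantsFlow τ a
  have hb0 : ∀ τ, b τ ≠ 0 := constantsFlow_ne_zero ha
  have hbn : ∀ τ, ‖b τ‖ ^ 2 ≠ 0 := fun τ => pow_ne_zero 2 (norm_ne_zero_iff.2 (hb0 τ))
  have hb : ∀ τ, HasDerivAt b (normalizedField (b τ)) τ := hasDerivAt_constantsFlow a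
  have hbc : Continuous b := continuous_iff_continuousAt.2 fun τ => (hb τ).continuousAt
  have hrc : ∀ i, Continuous fun τ => ricciCoeff (b τ) i / ‖b τ‖ ^ 2 := fun i =>
    ((continuous_ricciCoeff i).comp hbc).div (hbc.norm.pow 2) hbn
  have hprim : ∀ h : ℝ → ℝ, Continuous h → ∃ s : ℝ → ℝ, s 0 = 0 ∧ ∀ t, HasDerivAt s (h t) t :=
    fun h hh => by
      obtain ⟨s, hs0, hs⟩ := exists_primitive isOpen_univ Set.ordConnected_univ (Set.mem_univ 0)
        hh.continuousOn
      exact ⟨s, hs0, fun t => hs t (Set.mem_univ t)⟩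
  choose R hR0 hR using fun i => hprim _ (hrc i)
  obtain ⟨g, hg0, hg⟩ := hprim (fun τ => (‖b τ‖ ^ 2)⁻¹) ((hbc.norm.pow 2).inv₀ hbn)
  have hnpos : ∀ τ, 0 < (‖b τ‖ ^ 2)⁻¹ := fun τ =>
    inv_pos.2 (pow_pos (norm_pos_iff.2 (hb0 τ)) 2)
  let q : ℝ → Fin 3 → ℝ := fun τ i => Real.exp (-2 * R i τ)
  have hq : ∀ τ i, 0 < q τ i := fun τ i => Real.exp_pos _
  have hqd : ∀ τ i, HasDerivAt (fun s => q s i)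
      (-2 * (ricciCoeff (b τ) i / ‖b τ‖ ^ 2 * q τ i)) τ := fun τ i =>
    (((hR i τ).const_mul (-2)).exp).congr_deriv (by simp only [q]; ring)
  -- Each component of both curves solves the same scalar linear equation `f' = f * c` with the same
  -- initial value.
  have hresc : ∀ τ, rescaledConstants a (q τ) = b τ := by
    intro τ
    ext i
    let c : ℝ → ℝ := fun τ => ∑ j, ricciCoeff (b τ) j / ‖b τ‖ ^ 2 -
      2 * (ricciCoeff (b τ) i / ‖b τ‖ ^ 2)
    have hc : Continuous c :=
      (continuous_finsetSum _ fun j _ => hrc j).sub (continuous_const.mul (hrc i))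
    have hd1 : ∀ s, HasDerivAt (fun s => rescaledConstants a (q s) i)
        (rescaledConstants a (q s) i * c s) s := fun s =>
      hasDerivAt_rescaledConstants (r := fun τ j => ricciCoeff (b τ) j / ‖b τ‖ ^ 2)
        (hq s) (hqd s) i
    have hd2 : ∀ s, HasDerivAt (fun s => b s i) (b s i * c s) s := fun s =>
      (hasDerivAt_pi.1 (hb s) i).congr_deriv (by
        simp only [normalizedField, constantsField_eq, c, ← Finset.sum_div]
        ring)
    have := eq_zero_of_norm_deriv_le (f := fun s => rescaledConstants a (q s) i - b s i)
      (f' := fun s => rescaledConstants a (q s) i * c s - b s i * c s) (C := fun s => |c s|)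
      Set.ordConnected_univ (Set.mem_univ 0) (fun s _ => (hd1 s).fun_sub (hd2 s))
      hc.abs.continuousOn
      (fun s _ => by rw [← sub_mul, norm_mul, mul_comm, Real.norm_eq_abs (c s)])
      (by simp [rescaledConstants, q, hR0, b, constantsFlow.map_zero_apply]) τ (Set.mem_univ τ)
    exact sub_eq_zero.1 this
  obtain ⟨hopen, hord, k, hkg, hk⟩ := exists_inverse_of_hasDerivAt_pos hg hnpos
  have hmono : StrictMono g := strictMonoOn_univ.1
    (strictMonoOn_of_hasDerivAt_pos Set.ordConnected_univ (fun t _ => hg t) fun t _ => hnpos t)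
  refine ⟨fun t => diagonalMLA ha (q (k t)) (hq (k t)), Set.range g, g,
    ⟨hopen, hord, ⟨0, hg0⟩, fun _ _ => rfl, ?_⟩, hmono,
    continuous_iff_continuousAt.2 fun t => (hg t).continuousAt, hg0,
    fun τ => ⟨⟨τ, rfl⟩, ?_⟩⟩
  · rintro _ ⟨τ, rfl⟩ x y
    have h1 : HasDerivAt (fun s => ∑ i, q (k s) i * (x i * y i))
        (∑ i, -2 * (ricciCoeff (b τ) i / ‖b τ‖ ^ 2 * q τ i) * (‖b τ‖ ^ 2)⁻¹⁻¹ * (x i * y i))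
        (g τ) := by
      refine HasDerivAt.fun_sum fun i _ => HasDerivAt.mul_const ?_ _
      have h2 := hqd τ i
      rw [← hkg τ] at h2
      have h3 := HasDerivAt.comp (g τ) h2 (hk τ)
      rwa [hkg] at h3
    refine h1.congr_deriv ?_
    have h2 := ricci_eq_of_diagonal (A := diagonalAlgebra a (q (k (g τ))) (hq _))
      (L := LinearEquiv.refl ℝ _) (hq (k (g τ))) (fun _ _ => rfl) (fun _ _ => rfl) x y
    refine Eq.trans ?_ (congrArg (-2 * ·) h2.symm)
    have h4 : ‖b τ‖ ≠ 0 := norm_ne_zero_iff.2 (hb0 τ)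
    simp only [hkg, hresc, Finset.mul_sum, inv_inv, LinearEquiv.refl_apply]
    refine Finset.sum_congr rfl fun i _ => ?_
    field_simp
  · obtain ⟨L, hL⟩ := isMilnorFrame_diagonalAlgebra a (q (k (g τ))) (hq _)
    rw [ricciFlow_milnorMap]
    refine (milnorMap_eq_mk (A := diagonalMLA ha (q (k (g τ))) (hq (k (g τ))))
      (rescaledConstants_ne_zero ha (hq _)) hL).symm.trans ?_
    congr 2
    rw [hkg, hresc]

/-! ### Comparison of normalized Ricci flows -/

theorem IsNormalizedRicciFlow.exists_reparametrization {φ : Flow ℝ Moduli}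
    (hφ : IsNormalizedRicciFlow φ) (x : Moduli) :
    ∃ S : ℝ → ℝ, S 0 = 0 ∧ Continuous S ∧ StrictMono S ∧
      ∀ τ, φ (S τ) x = Moduli.ricciFlow τ x := by
  obtain ⟨A, I, g, hA, hg, hgc, hg0, hgA⟩ := x.exists_isRicciFlow
  obtain ⟨s, hs0, hsc, hsm, hs⟩ := hφ A I hA
  have hx : Moduli.mk (A 0) = x := by
    rw [← hg0, (hgA 0).2, Moduli.ricciFlow.map_zero_apply]
  refine ⟨s ∘ g, by simp [hg0, hs0], hsc.comp_continuous hgc fun τ => (hgA τ).1,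
    fun t t' h => hsm (hgA t).1 (hgA t').1 (hg h), fun τ => ?_⟩
  rw [← (hgA τ).2, ← hs _ (hgA τ).1, hx]
  rfl

/-! ### Flows that differ by a reparametrization of the orbits -/

section Comparison

open Filter

variable {X : Type*} [TopologicalSpace X] {φ ψ : Flow ℝ X}

/-- If an orbit of `ψ` is a reparametrization of one of `φ`, a rest point of `ψ` is a rest point
of `φ`. -/
theorem Flow.fixed_of_reparametrization {p : X} {S : ℝ → ℝ} (hS0 : S 0 = 0) (hSc : Continuous S)
    (hS : StrictMono S) (h : ∀ τ, φ (S τ) p = ψ τ p) (hp : ∀ τ, ψ τ p = p) (t : ℝ) :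
    φ t p = p := by
  have hfix : ∀ r ∈ Set.Icc (S (-1)) (S 1), φ r p = p := by
    intro r hr
    obtain ⟨τ, -, rfl⟩ := intermediate_value_Icc (show (-1 : ℝ) ≤ 1 by norm_num)
      hSc.continuousOn hr
    rw [h, hp]
  have hneg : S (-1) < 0 := hS0 ▸ hS (by norm_num)
  have hpos : 0 < S 1 := hS0 ▸ hS (by norm_num)
  -- For this `n` the time `t / n` lies in the interval already known to fix `p`, and `n` such steps
  -- reach `t`.
  obtain ⟨n, hn⟩ := exists_nat_gt (max (t / S (-1)) (t / S 1))
  have hn0 : (0 : ℝ) < n := by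
    refine lt_of_le_of_lt ?_ hn
    rcases le_total 0 t with h | h
    · exact le_max_of_le_right (by positivity)
    · exact le_max_of_le_left (div_nonneg_of_nonpos h hneg.le)
  have h1 : t / n ∈ Set.Icc (S (-1)) (S 1) := by
    have a1 := (le_max_left _ _).trans_lt hn
    have a2 := (le_max_right _ _).trans_lt hn
    rw [div_lt_iff_of_neg hneg] at a1
    rw [div_lt_iff₀ hpos] at a2
    constructor
    · rw [le_div_iff₀ hn0]; linarith
    · rw [div_le_iff₀ hn0]; linarith
  have hiter : ∀ m : ℕ, φ (m * (t / n)) p = p := by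
    intro m
    induction m with
    | zero => simp [φ.map_zero_apply]
    | succ m ih =>
      rw [Nat.cast_succ, add_mul, one_mul, φ.map_add, hfix _ h1, ih]
  have := hiter n
  rwa [mul_div_cancel₀ _ hn0.ne'] at this

/-- If `S` converged to a finite time `b`, the `φ`-orbit of `x` would reach the rest point `q` at
time `b`, and then `x = q`. -/
theorem tendsto_of_strictMono_reparametrization {S : ℝ → ℝ} {x q : X} [T2Space X]
    (hS : StrictMono S) (h : ∀ τ, φ (S τ) x = ψ τ x) (hq : ∀ t, φ t q = q) (hxq : x ≠ q) :
    (Tendsto (fun τ => ψ τ x) atTop (𝓝 q) → Tendsto S atTop atTop) ∧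
      (Tendsto (fun τ => ψ τ x) atBot (𝓝 q) → Tendsto S atBot atBot) := by
  have key : ∀ (l : Filter ℝ) [l.NeBot] (b : ℝ), Tendsto (fun τ => ψ τ x) l (𝓝 q) →
      ¬ Tendsto S l (𝓝 b) := by
    intro l _ b hl hb
    have h1 : Tendsto (fun τ => φ (S τ) x) l (𝓝 (φ b x)) :=
      ((φ.continuous continuous_id continuous_const).tendsto b).comp hb
    simp only [h] at h1
    have h2 := tendsto_nhds_unique h1 hl
    apply hxq
    rw [← φ.map_zero_apply x, ← neg_add_cancel b, φ.map_add, h2, hq]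
  constructor
  · intro hl
    rcases tendsto_atTop_of_monotone hS.monotone with h1 | ⟨b, hb⟩
    · exact h1
    · exact absurd hb (key _ b hl)
  · intro hl
    rcases tendsto_atBot_of_monotone hS.monotone with h1 | ⟨b, hb⟩
    · exact h1
    · exact absurd hb (key _ b hl)

/-- The flow `φ` has the same oriented orbits as `ψ`, locally in time. -/
def Flow.IsReparametrization (φ ψ : Flow ℝ X) : Prop :=
  ∀ x, ∃ S : ℝ → ℝ, S 0 = 0 ∧ Continuous S ∧ StrictMono S ∧ ∀ τ, φ (S τ) x = ψ τ x

theorem Flow.IsReparametrization.fixed (h : φ.IsReparametrization ψ) {p : X}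
    (hp : ∀ t, ψ t p = p) (t : ℝ) : φ t p = p := by
  obtain ⟨S, hS0, hSc, hS, hSx⟩ := h p
  exact Flow.fixed_of_reparametrization hS0 hSc hS hSx hp t

/-- An orbit that is heteroclinic for `ψ` is the same orbit, with the same limits, for `φ`. -/
theorem Flow.IsReparametrization.heteroclinic [T2Space X] (h : φ.IsReparametrization ψ)
    {x p q : X} (hp : ∀ t, ψ t p = p) (hq : ∀ t, ψ t q = q) (hxp : x ≠ p) (hxq : x ≠ q)
    (hlp : Tendsto (fun t => ψ t x) atBot (𝓝 p)) (hlq : Tendsto (fun t => ψ t x) atTop (𝓝 q)) :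
    φ.orbit x = ψ.orbit x ∧ Tendsto (fun t => φ t x) atBot (𝓝 p) ∧
      Tendsto (fun t => φ t x) atTop (𝓝 q) := by
  obtain ⟨S, hS0, hSc, hS, hSx⟩ := h x
  have htop := (tendsto_of_strictMono_reparametrization hS hSx (h.fixed hq) hxq).1 hlq
  have hbot := (tendsto_of_strictMono_reparametrization hS hSx (h.fixed hp) hxp).2 hlp
  have hsurj : Function.Surjective S := hSc.surjective htop hbot
  let e := hS.orderIsoOfSurjective S hsurj
  have he : ∀ t, φ t x = ψ (e.symm t) x := by
    intro t
    rw [← hSx]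
    congr 1
    exact (e.apply_symm_apply t).symm
  refine ⟨?_, ?_, ?_⟩
  · ext y
    simp only [Flow.mem_orbit_iff]
    constructor
    · rintro ⟨t, rfl⟩
      exact ⟨e.symm t, (he t).symm⟩
    · rintro ⟨t, rfl⟩
      exact ⟨S t, hSx t⟩
  · simp only [he]
    exact hlp.comp e.symm.tendsto_atBot
  · simp only [he]
    exact hlq.comp e.symm.tendsto_atTop

/-- The orbit map of a heteroclinic orbit is an embedding. -/
theorem Flow.isEmbedding_of_heteroclinic [T2Space X] {x p q : X} (hpq : p ≠ q)
    (hp : ∀ t, φ t p = p) (hq : ∀ t, φ t q = q)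
    (hlp : Tendsto (fun t => φ t x) atBot (𝓝 p)) (hlq : Tendsto (fun t => φ t x) atTop (𝓝 q)) :
    Topology.IsEmbedding fun t : ℝ => φ t x := by
  have hc : Continuous fun t : ℝ => φ t x := φ.continuous continuous_id continuous_const
  have hne : ∀ r, (∀ t, φ t r = r) → (p = r → q = r → False) → ∀ t, φ t x ≠ r := by
    intro r hr hpqr t h
    have hconst : ∀ s, φ s x = r := by
      intro s
      rw [← sub_add_cancel s t, φ.map_add, h, hr]
    simp only [hconst] at hlp hlq
    exact hpqr (tendsto_nhds_unique hlp tendsto_const_nhds)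
      (tendsto_nhds_unique hlq tendsto_const_nhds)
  have hnp := hne p hp fun _ h => hpq h.symm
  have hnq := hne q hq fun h _ => hpq h
  have hinj : Function.Injective fun t : ℝ => φ t x := by
    have main : ∀ t₁ t₂, t₁ < t₂ → φ t₁ x ≠ φ t₂ x := by
      intro t₁ t₂ hlt heq
      -- A period would make a point of the orbit its own limit along an arithmetic progression of
      -- times, hence equal to `q`.
      have hper : ∀ n : ℕ, φ (t₁ + n * (t₂ - t₁)) x = φ t₁ x := by
        intro n
        induction n with
        | zero => simp
        | succ n ih =>
          have e1 : t₁ + (n + 1 : ℕ) * (t₂ - t₁) = (n * (t₂ - t₁)) + t₂ := by push_cast; ring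
          rw [e1, φ.map_add, ← heq, ← φ.map_add, add_comm, ih]
      have h1 : Tendsto (fun n : ℕ => t₁ + n * (t₂ - t₁)) atTop atTop :=
        tendsto_atTop_add_const_left _ _
          (tendsto_natCast_atTop_atTop.atTop_mul_const (sub_pos.2 hlt))
      have h2 := hlq.comp h1
      simp only [Function.comp_def, hper] at h2
      exact hnq t₁ (tendsto_nhds_unique tendsto_const_nhds h2)
    intro t₁ t₂ h
    rcases lt_trichotomy t₁ t₂ with h1 | h1 | h1
    · exact absurd h (main _ _ h1)
    · exact h1
    · exact absurd h.symm (main _ _ h1)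
  refine ⟨Topology.isInducing_iff_nhds.2 fun t => le_antisymm ?_ ?_, hinj⟩
  · exact (hc.tendsto t).le_comap
  · intro U hU
    obtain ⟨V, hVU, hV, htV⟩ := mem_nhds_iff.1 hU
    obtain ⟨P, P', hP, hP', htP, hpP, hPP⟩ := t2_separation (hnp t)
    obtain ⟨R, R', hR, hR', htR, hqR, hRR⟩ := t2_separation (hnq t)
    obtain ⟨m, hm⟩ := eventually_atBot.1 (hlp.eventually (hP'.mem_nhds hpP))
    obtain ⟨n, hn⟩ := eventually_atTop.1 (hlq.eventually (hR'.mem_nhds hqR))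
    -- Neighbourhoods of the limits contain the two tails. The rest of the orbit outside the image
    -- of `V` is compact, hence closed, and misses the point.
    have hK : IsCompact ((fun t : ℝ => φ t x) '' (Set.Icc m n \ V)) :=
      (isCompact_Icc.diff hV).image hc
    refine mem_comap.2 ⟨(P ∩ R) ∩ ((fun t : ℝ => φ t x) '' (Set.Icc m n \ V))ᶜ,
      inter_mem (inter_mem (hP.mem_nhds htP) (hR.mem_nhds htR))
        (hK.isClosed.isOpen_compl.mem_nhds ?_), ?_⟩
    · rintro ⟨s, hs, hst⟩
      exact hs.2 (hinj hst ▸ htV)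
    · rintro s ⟨⟨hsP, hsR⟩, hs⟩
      by_contra hsU
      refine hs ⟨s, ⟨⟨?_, ?_⟩, fun h => hsU (hVU h)⟩, rfl⟩
      · by_contra hlt
        exact Set.disjoint_left.1 hPP hsP (hm s (not_le.1 hlt).le)
      · by_contra hlt
        exact Set.disjoint_left.1 hRR hsR (hn s (not_le.1 hlt).le)

end Comparison

/-! ### A chart of the moduli space -/

namespace Moduli

theorem chart_ne_zero (p : ℝ × ℝ) : ![1, p.1, p.2] ≠ (0 : Fin 3 → ℝ) := fun h => by
  simpa using congrFun h 0

/-- The class of the structure constants `(1, u, v)`. -/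
noncomputable def chart (p : ℝ × ℝ) : Moduli := milnorMap ⟨![1, p.1, p.2], chart_ne_zero p⟩

theorem continuous_chart : Continuous chart := by
  refine continuous_milnorMap.comp (Continuous.subtype_mk (continuous_pi fun i => ?_) _)
  fin_cases i
  · exact continuous_const
  · exact continuous_fst
  · exact continuous_snd

theorem chart_eq_milnorMap {p : ℝ × ℝ} {a : Fin 3 → ℝ} (ha : a ≠ 0) {c : ℝ} (hc : c ≠ 0)
    (σ : Equiv.Perm (Fin 3)) (h0 : c * a (σ 0) = 1) (h1 : c * a (σ 1) = p.1)
    (h2 : c * a (σ 2) = p.2) : chart p = milnorMap ⟨a, ha⟩ := by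
  refine (milnorMap_eq_iff.2 ⟨c, σ, hc, fun i => ?_⟩).symm
  fin_cases i
  · exact h0.symm
  · exact h1.symm
  · exact h2.symm

/-- The image of `S` is also the image of the open cone of constants with `a 0 ≠ 0` and ratios in
`S`. -/
theorem isOpenMap_chart : IsOpenMap chart := by
  intro S hS
  have h0 : IsOpen {a : {a : Fin 3 → ℝ // a ≠ 0} | a.1 0 ≠ 0} :=
    isOpen_ne_fun (continuous_coordinate 0) continuous_const
  have h1 : ContinuousOn (fun a : {a : Fin 3 → ℝ // a ≠ 0} => (a.1 1 / a.1 0, a.1 2 / a.1 0))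
      {a | a.1 0 ≠ 0} :=
    ((continuous_coordinate 1).continuousOn.div (continuous_coordinate 0).continuousOn
      fun a h => h).prodMk
    ((continuous_coordinate 2).continuousOn.div (continuous_coordinate 0).continuousOn
      fun a h => h)
  convert isOpenMap_milnorMap _ (h1.isOpen_inter_preimage h0 hS) using 1
  ext x
  constructor
  · rintro ⟨p, hp, rfl⟩
    exact ⟨_, ⟨by simp, by simpa using hp⟩, rfl⟩
  · rintro ⟨a, ⟨ha0, ha⟩, rfl⟩
    have ha0 : a.1 0 ≠ 0 := ha0
    refine ⟨_, ha, chart_eq_milnorMap a.2 (inv_ne_zero ha0) 1 ?_ ?_ ?_⟩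
    · simp [ha0]
    · simp [div_eq_inv_mul]
    · simp [div_eq_inv_mul]

/-- A domain of normal forms for structure constants. -/
def normalForms : Set (ℝ × ℝ) :=
  {p | 0 ≤ p.1 ∧ p.1 ≤ 1 ∧ p.2 ≤ p.1 ∧ (p.1 = 0 → -1 ≤ p.2)}

/-- After sorting, division by an extreme entry with the sign of the middle one puts the middle
ratio into `[0, 1]`. If the middle entry is zero, both extremes may qualify; the one of larger
modulus is used, hence the clause for `p.1 = 0`. -/
theorem exists_chart_eq (x : Moduli) : ∃ p ∈ normalForms, chart p = x := by
  obtain ⟨⟨a, ha⟩, rfl⟩ := milnorMap_surjective x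
  set σ := Tuple.sort a
  have hm : Monotone (a ∘ σ) := Tuple.monotone_sort a
  have h01 : a (σ 0) ≤ a (σ 1) := hm (by decide)
  have h12 : a (σ 1) ≤ a (σ 2) := hm (by decide)
  have hne : a (σ 0) = 0 → a (σ 1) = 0 → a (σ 2) = 0 → False := by
    intro h0 h1 h2
    apply ha
    ext i
    obtain ⟨j, rfl⟩ := σ.surjective i
    fin_cases j
    · exact h0
    · exact h1
    · exact h2
  have neg : a (σ 0) < 0 → a (σ 1) ≤ 0 → (a (σ 1) = 0 → a (σ 2) ≤ - a (σ 0)) →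
      ∃ p ∈ normalForms, chart p = milnorMap ⟨a, ha⟩ := by
    intro h0 h1 h2
    refine ⟨(a (σ 1) / a (σ 0), a (σ 2) / a (σ 0)), ⟨?_, ?_, ?_, ?_⟩,
      chart_eq_milnorMap ha (inv_ne_zero h0.ne) σ ?_ ?_ ?_⟩
    · exact div_nonneg_of_nonpos h1 h0.le
    · exact (div_le_one_of_neg h0).2 h01
    · exact div_le_div_of_nonpos_of_le h0.le h12
    · intro h
      have := h2 ((div_eq_zero_iff.1 h).resolve_right h0.ne)
      change -1 ≤ a (σ 2) / a (σ 0)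
      rw [le_div_iff_of_neg h0]
      linarith
    · exact inv_mul_cancel₀ h0.ne
    · exact (div_eq_inv_mul _ _).symm
    · exact (div_eq_inv_mul _ _).symm
  have pos : 0 < a (σ 2) → 0 ≤ a (σ 1) → (a (σ 1) = 0 → - a (σ 2) ≤ a (σ 0)) →
      ∃ p ∈ normalForms, chart p = milnorMap ⟨a, ha⟩ := by
    intro h0 h1 h2
    refine ⟨(a (σ 1) / a (σ 2), a (σ 0) / a (σ 2)), ⟨?_, ?_, ?_, ?_⟩,
      chart_eq_milnorMap ha (inv_ne_zero h0.ne') (Fin.revPerm.trans σ) ?_ ?_ ?_⟩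
    · exact div_nonneg h1 h0.le
    · exact (div_le_one₀ h0).2 h12
    · exact div_le_div_of_nonneg_right h01 h0.le
    · intro h
      have := h2 ((div_eq_zero_iff.1 h).resolve_right h0.ne')
      change -1 ≤ a (σ 0) / a (σ 2)
      rw [le_div_iff₀ h0]
      linarith
    · exact inv_mul_cancel₀ h0.ne'
    · exact (div_eq_inv_mul _ _).symm
    · exact (div_eq_inv_mul _ _).symm
  rcases lt_trichotomy (a (σ 1)) 0 with h1 | h1 | h1
  · exact neg (h01.trans_lt h1) h1.le fun h => absurd h h1.ne
  · by_cases h : -a (σ 0) ≤ a (σ 2)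
    · refine pos ?_ h1.ge fun _ => by linarith
      by_contra h2
      exact hne (by linarith) h1 (by linarith)
    · exact neg (by linarith) h1.le fun _ => by linarith
  · exact pos (h1.trans_le h12) h1.le fun h => absurd h h1.ne'

/-- A positive factor must be `1`, because the largest entries agree. A negative factor exchanges
largest and smallest entries, which forces `u = u' = 0` and `v * v' = 1`, so `v = v' = -1`. -/
theorem injOn_chart : Set.InjOn chart normalForms := by
  rintro ⟨u, v⟩ ⟨hu0, hu1, hvu, hv⟩ ⟨u', v'⟩ ⟨hu0', hu1', hvu', hv'⟩ h
  dsimp only at *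
  obtain ⟨c, σ, hc, hcσ⟩ := milnorMap_eq_iff.1 h
  dsimp only at hcσ
  have hmax : ∀ i, ![1, u, v] i ≤ 1 := by intro i; fin_cases i <;> simp <;> linarith
  have hmin : ∀ i, v ≤ ![1, u, v] i := by intro i; fin_cases i <;> simp <;> linarith
  have hmax' : ∀ i, ![1, u', v'] i ≤ 1 := by intro i; fin_cases i <;> simp <;> linarith
  have hmin' : ∀ i, v' ≤ ![1, u', v'] i := by intro i; fin_cases i <;> simp <;> linarith
  have hsum : 1 + u' + v' = c * (1 + u + v) := by
    have h1 : ∑ i, ![1, u', v'] i = ∑ i, c * ![1, u, v] (σ i) :=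
      Finset.sum_congr rfl fun i _ => hcσ i
    rw [← Finset.mul_sum, Equiv.sum_comp σ ![1, u, v]] at h1
    simpa [Fin.sum_univ_three] using h1
  have e0 : 1 = c * ![1, u, v] (σ 0) := by simpa using hcσ 0
  have e2 : v' = c * ![1, u, v] (σ 2) := by simpa using hcσ 2
  have f0 : ![1, u', v'] (σ.symm 0) = c := by simpa using hcσ (σ.symm 0)
  have f2 : ![1, u', v'] (σ.symm 2) = c * v := by simpa using hcσ (σ.symm 2)
  have g0 := hmax' (σ.symm 0)
  have g0' := hmin' (σ.symm 0)
  have g2 := hmax' (σ.symm 2)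
  have g2' := hmin' (σ.symm 2)
  rw [f0] at g0 g0'
  rw [f2] at g2 g2'
  rcases hc.lt_or_gt with hneg | hpos
  · have k0 := mul_le_mul_of_nonpos_left (hmin (σ 0)) hneg.le
    have k2 := mul_le_mul_of_nonpos_left (hmax (σ 2)) hneg.le
    have hcv : c * v = 1 := le_antisymm g2 (e0.trans_le k0)
    have hvc : v' = c := le_antisymm g0' (by linarith)
    have huu : u' = c * u := by linarith
    have hu : u = 0 := by nlinarith
    have hu' : u' = 0 := by rw [huu, hu, mul_zero]
    have hv := hv hu
    have hv' := hv' hu'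
    subst hvc
    have : v' = -1 := by nlinarith
    subst this
    simp only [hu, hu', Prod.mk.injEq, true_and]
    linarith
  · have k0 := mul_le_mul_of_nonneg_left (hmax (σ 0)) hpos.le
    have k2 := mul_le_mul_of_nonneg_left (hmin (σ 2)) hpos.le
    have hc1 : c = 1 := le_antisymm g0 (by linarith)
    subst hc1
    have : v = v' := by linarith
    simp only [Prod.mk.injEq]
    exact ⟨by linarith, this⟩

theorem exists_isOpenEmbedding {B : Set Moduli} (hB : IsOpen B) {Ω : Set (ℝ × ℝ)}
    (hΩ : IsOpen Ω) (hΩD : Ω ⊆ normalForms) (hBΩ : B ⊆ chart '' Ω) :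
    ∃ e : B → ℝ × ℝ, Topology.IsOpenEmbedding e := by
  have hemb : Topology.IsOpenEmbedding (Ω.domRestrict chart) :=
    .of_continuous_injective_isOpenMap (continuous_chart.comp continuous_subtype_val)
      (Set.injOn_iff_injective.1 (injOn_chart.mono hΩD)) (isOpenMap_chart.domRestrict hΩ)
  have hrange : Set.range (Ω.domRestrict chart) = chart '' Ω := Set.range_domRestrict _ _
  let e := hemb.isEmbedding.toHomeomorph
  refine ⟨Subtype.val ∘ e.symm ∘ Set.inclusion (hBΩ.trans hrange.ge), ?_⟩
  refine hΩ.isOpenEmbedding_subtypeVal.comp (e.symm.isOpenEmbedding.comp ?_)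
  exact .of_continuous_injective_isOpenMap (continuous_inclusion _) (Set.inclusion_injective _)
    (hB.isOpenMap_inclusion _)

end Moduli

/-! ### Limits of solutions of scalar differential equations -/

section Scalar

open Filter Set

theorem exists_integrating_factor {f h c : ℝ → ℝ} (hc : Continuous c)
    (hf : ∀ t, HasDerivAt f (f t * c t + h t) t) :
    ∃ E : ℝ → ℝ, (∀ t, 0 < E t) ∧ ∀ t, HasDerivAt (fun t => E t * f t) (E t * h t) t := by
  obtain ⟨s, -, hs⟩ := exists_primitive isOpen_univ ordConnected_univ (mem_univ 0) hc.continuousOn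
  refine ⟨fun t => Real.exp (-s t), fun t => Real.exp_pos _, fun t => ?_⟩
  refine (((hs t (mem_univ t)).neg.exp).mul (hf t)).congr_deriv ?_
  simp only [Pi.neg_apply]
  ring

theorem nonneg_of_linear_deriv {f h c : ℝ → ℝ} (hc : Continuous c)
    (hf : ∀ t, HasDerivAt f (f t * c t + h t) t) (hh : ∀ t, 0 ≤ h t) {t₀ t : ℝ} (ht : t₀ ≤ t)
    (h0 : 0 ≤ f t₀) : 0 ≤ f t := by
  obtain ⟨E, hE, hd⟩ := exists_integrating_factor hc hf
  have hm : Monotone fun t => E t * f t := monotone_of_deriv_nonneg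
    (fun t => (hd t).differentiableAt) fun t => by
      rw [(hd t).deriv]; exact mul_nonneg (hE t).le (hh t)
  exact nonneg_of_mul_nonneg_right ((mul_nonneg (hE t₀).le h0).trans (hm ht)) (hE t)

theorem eq_zero_of_linear_deriv {f c : ℝ → ℝ} (hc : Continuous c)
    (hf : ∀ t, HasDerivAt f (f t * c t) t) {t₀ : ℝ} (h0 : f t₀ = 0) (t : ℝ) : f t = 0 := by
  obtain ⟨E, hE, hd⟩ := exists_integrating_factor (h := 0) hc (by simpa using hf)
  have := is_const_of_deriv_eq_zero (fun t => (hd t).differentiableAt)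
    (fun t => by rw [(hd t).deriv]; simp) t t₀
  rw [h0, mul_zero] at this
  exact (mul_eq_zero.1 this).resolve_left (hE t).ne'

theorem pos_of_linear_deriv_eq {f c : ℝ → ℝ} (hc : Continuous c)
    (hf : ∀ t, HasDerivAt f (f t * c t) t) {t₀ : ℝ} (h0 : 0 < f t₀) (t : ℝ) : 0 < f t := by
  obtain ⟨E, hE, hd⟩ := exists_integrating_factor (h := 0) hc (by simpa using hf)
  have := is_const_of_deriv_eq_zero (fun t => (hd t).differentiableAt)
    (fun t => by rw [(hd t).deriv]; simp) t t₀
  exact pos_of_mul_pos_right (this ▸ mul_pos (hE t₀) h0) (hE t).le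

/-- On `[t, t + 1]` the mean value theorem finds a time at which the derivative equals an increment
that tends to zero. This identifies limits of solutions as rest points. -/
theorem eq_zero_of_tendsto_deriv_atTop {f g : ℝ → ℝ} {ℓ m : ℝ} (hf : ∀ t, HasDerivAt f (g t) t)
    (hl : Tendsto f atTop (𝓝 ℓ)) (hm : Tendsto g atTop (𝓝 m)) : m = 0 := by
  have h := fun t : ℝ => exists_hasDerivAt_eq_slope f g (lt_add_one t)
    (fun s _ => (hf s).continuousAt.continuousWithinAt) fun s _ => hf s
  choose ξ hξ hξ' using h
  have h1 : Tendsto ξ atTop atTop := tendsto_atTop_mono (fun t => (hξ t).1.le) tendsto_id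
  have h2 : Tendsto (fun t => f (t + 1) - f t) atTop (𝓝 (ℓ - ℓ)) :=
    (hl.comp (tendsto_atTop_add_const_right _ 1 tendsto_id)).sub hl
  have h3 := hm.comp h1
  refine tendsto_nhds_unique h3 ?_
  rw [sub_self] at h2
  refine h2.congr fun t => ?_
  simp [hξ']

theorem eq_zero_of_tendsto_deriv_atBot {f g : ℝ → ℝ} {ℓ m : ℝ} (hf : ∀ t, HasDerivAt f (g t) t)
    (hl : Tendsto f atBot (𝓝 ℓ)) (hm : Tendsto g atBot (𝓝 m)) : m = 0 := by
  have := eq_zero_of_tendsto_deriv_atTop (f := fun t => f (-t)) (g := fun t => -g (-t))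
    (m := -m) (fun t => by
      simpa [Function.comp_def] using (hf (-t)).scomp t (hasDerivAt_neg t))
    (hl.comp tendsto_neg_atTop_atBot) ((hm.comp tendsto_neg_atTop_atBot).neg)
  linarith

theorem exists_tendsto_atTop_of_monotoneOn {f : ℝ → ℝ} {t₀ B : ℝ}
    (hf : MonotoneOn f (Ici t₀)) (hB : ∀ t ∈ Ici t₀, f t ≤ B) :
    ∃ ℓ, Tendsto f atTop (𝓝 ℓ) ∧ (∀ t ∈ Ici t₀, f t ≤ ℓ) ∧ ℓ ≤ B := by
  have hm : Monotone fun t => f (max t₀ t) := fun s t h =>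
    hf (mem_Ici.2 (le_max_left _ _)) (mem_Ici.2 (le_max_left _ _)) (max_le_max le_rfl h)
  have hb : BddAbove (range fun t => f (max t₀ t)) :=
    ⟨B, by rintro _ ⟨t, rfl⟩; exact hB _ (mem_Ici.2 (le_max_left _ _))⟩
  refine ⟨_, (tendsto_atTop_ciSup hm hb).congr' ?_, fun t ht => ?_,
    ciSup_le fun t => hB _ (mem_Ici.2 (le_max_left _ _))⟩
  · filter_upwards [eventually_ge_atTop t₀] with t ht
    rw [max_eq_right ht]
  · have := le_ciSup hb t
    rwa [max_eq_right ht] at this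

theorem exists_tendsto_atTop_of_antitoneOn {f : ℝ → ℝ} {t₀ B : ℝ}
    (hf : AntitoneOn f (Ici t₀)) (hB : ∀ t ∈ Ici t₀, B ≤ f t) :
    ∃ ℓ, Tendsto f atTop (𝓝 ℓ) ∧ (∀ t ∈ Ici t₀, ℓ ≤ f t) ∧ B ≤ ℓ := by
  obtain ⟨ℓ, h1, h2, h3⟩ := exists_tendsto_atTop_of_monotoneOn (f := fun t => -f t) (B := -B)
    hf.neg fun t ht => neg_le_neg (hB t ht)
  exact ⟨-ℓ, by simpa using h1.neg, fun t ht => by linarith [h2 t ht], by linarith⟩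

theorem exists_tendsto_atBot_of_monotoneOn {f : ℝ → ℝ} {t₀ B : ℝ}
    (hf : MonotoneOn f (Iic t₀)) (hB : ∀ t ∈ Iic t₀, B ≤ f t) :
    ∃ ℓ, Tendsto f atBot (𝓝 ℓ) ∧ (∀ t ∈ Iic t₀, ℓ ≤ f t) ∧ B ≤ ℓ := by
  obtain ⟨ℓ, h1, h2, h3⟩ := exists_tendsto_atTop_of_antitoneOn (f := fun t => f (-t)) (t₀ := -t₀)
    (B := B) (fun s hs t ht h =>
      hf (mem_Iic.2 (neg_le.1 (mem_Ici.1 ht))) (mem_Iic.2 (neg_le.1 (mem_Ici.1 hs))) (neg_le_neg h))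
    fun t ht => hB _ (mem_Iic.2 (neg_le.1 (mem_Ici.1 ht)))
  refine ⟨ℓ, ?_, fun t ht => ?_, h3⟩
  · simpa [Function.comp_def] using h1.comp tendsto_neg_atBot_atTop
  · simpa using h2 (-t) (mem_Ici.2 (neg_le_neg (mem_Iic.1 ht)))

theorem tendsto_atBot_atBot_of_monotoneOn {f : ℝ → ℝ} {t₀ : ℝ} (hf : MonotoneOn f (Iic t₀))
    (hne : ∀ ℓ ≤ f t₀, ¬ Tendsto f atBot (𝓝 ℓ)) : Tendsto f atBot atBot := by
  have hm : Monotone fun t => f (min t₀ t) := fun s t h =>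
    hf (mem_Iic.2 (min_le_left _ _)) (mem_Iic.2 (min_le_left _ _)) (min_le_min le_rfl h)
  have hev : (fun t => f (min t₀ t)) =ᶠ[atBot] f := by
    filter_upwards [eventually_le_atBot t₀] with t ht
    rw [min_eq_right ht]
  rcases tendsto_atBot_of_monotone hm with h | ⟨ℓ, h⟩
  · exact h.congr' hev
  · refine absurd (h.congr' hev) (hne ℓ ?_)
    have := hm.le_of_tendsto h t₀
    rwa [min_self] at this

theorem exists_tendsto_atBot_of_antitoneOn {f : ℝ → ℝ} {t₀ B : ℝ}
    (hf : AntitoneOn f (Iic t₀)) (hB : ∀ t ∈ Iic t₀, f t ≤ B) :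
    ∃ ℓ, Tendsto f atBot (𝓝 ℓ) ∧ (∀ t ∈ Iic t₀, f t ≤ ℓ) ∧ ℓ ≤ B := by
  obtain ⟨ℓ, h1, h2, h3⟩ := exists_tendsto_atBot_of_monotoneOn (f := fun t => -f t) (B := -B)
    hf.neg fun t ht => neg_le_neg (hB t ht)
  exact ⟨-ℓ, by simpa using h1.neg, fun t ht => by linarith [h2 t ht], by linarith⟩

end Scalar

/-! ### The flow in the chart -/

/-- The factor by which the flow in the chart is slowed down. -/
noncomputable def slowdown (u v : ℝ) : ℝ := 2 / ‖![1, u, v]‖ ^ 2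

theorem norm_vec_pos (u v : ℝ) : 0 < ‖![1, u, v]‖ :=
  norm_pos_iff.2 (Moduli.chart_ne_zero (u, v))

theorem slowdown_pos (u v : ℝ) : 0 < slowdown u v := by
  have := norm_vec_pos u v
  unfold slowdown
  positivity

theorem continuous_slowdown : Continuous fun p : ℝ × ℝ => slowdown p.1 p.2 := by
  have h1 : Continuous fun p : ℝ × ℝ => ![1, p.1, p.2] := by
    refine continuous_pi fun i => ?_
    fin_cases i
    · exact continuous_const
    · exact continuous_fst
    · exact continuous_snd
  exact continuous_const.div (h1.norm.pow 2) fun p => pow_ne_zero 2 (norm_vec_pos p.1 p.2).ne'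

/-- Solutions of the normalized Ricci flow in the chart of the moduli space. -/
structure IsChartSolution (u v : ℝ → ℝ) : Prop where
  deriv_fst : ∀ t, HasDerivAt u (slowdown (u t) (v t) * (u t * (1 - u t) * (1 + u t - v t))) t
  deriv_snd : ∀ t, HasDerivAt v (slowdown (u t) (v t) * (v t * (1 - v t) * (1 + v t - u t))) t

/-- The constant `b 0` solves a scalar linear equation and stays positive, so the ratios `b 1 / b 0`
and `b 2 / b 0` exist for all time. -/
theorem exists_isChartSolution (u₀ v₀ : ℝ) : ∃ u v : ℝ → ℝ, u 0 = u₀ ∧ v 0 = v₀ ∧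
    IsChartSolution u v ∧
    ∀ t, Moduli.ricciFlow t (Moduli.chart (u₀, v₀)) = Moduli.chart (u t, v t) := by
  let b : ℝ → Fin 3 → ℝ := fun t => constantsFlow t ![1, u₀, v₀]
  have hbi : ∀ t i, HasDerivAt (fun s => b s i) (normalizedField (b t) i) t :=
    hasDerivAt_constantsFlow_apply _
  have hbc : Continuous b := continuous_iff_continuousAt.2 fun t =>
    (hasDerivAt_constantsFlow _ t).continuousAt
  have hne : ∀ t, b t ≠ 0 := constantsFlow_ne_zero (Moduli.chart_ne_zero (u₀, v₀))
  have hn : ∀ t, ‖b t‖ ^ 2 ≠ 0 := fun t => pow_ne_zero 2 (norm_ne_zero_iff.2 (hne t))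
  have hb0 : b 0 = ![1, u₀, v₀] := constantsFlow.map_zero_apply _
  have hpos : ∀ t, 0 < b t 0 := by
    refine pos_of_linear_deriv_eq (t₀ := 0) (c := fun t => 1 / 2 * (4 * (∑ j, b t j) * b t 0 -
      8 * b t 0 ^ 2 + 2 * ∑ j, b t j ^ 2 - (∑ j, b t j) ^ 2) / ‖b t‖ ^ 2) ?_ (fun t => ?_) ?_
    · have hbi : ∀ i, Continuous fun t => b t i := fun i => (continuous_apply i).comp hbc
      refine Continuous.div ?_ (hbc.norm.pow 2) hn
      simp only [Fin.sum_univ_three]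
      have h0 := hbi 0
      have h1 := hbi 1
      have h2 := hbi 2
      exact continuous_const.mul (((((continuous_const.mul ((h0.add h1).add h2)).mul h0).sub
        (continuous_const.mul (h0.pow 2))).add (continuous_const.mul
        (((h0.pow 2).add (h1.pow 2)).add (h2.pow 2)))).sub (((h0.add h1).add h2).pow 2))
    · refine (hbi t 0).congr_deriv ?_
      simp only [normalizedField, constantsField]
      ring
    · simp [hb0]
  have hvec : ∀ t, ‖b t‖ = b t 0 * ‖![1, b t 1 / b t 0, b t 2 / b t 0]‖ := by
    intro t
    have h0 := hpos t
    rw [← abs_of_pos h0, ← Real.norm_eq_abs, ← norm_smul, Real.norm_eq_abs, abs_of_pos h0]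
    congr 1
    ext i
    fin_cases i <;> simp <;> field_simp
  refine ⟨fun t => b t 1 / b t 0, fun t => b t 2 / b t 0, by simp [hb0], by simp [hb0],
    ⟨fun t => ?_, fun t => ?_⟩, fun t => ?_⟩
  · have h0 := (hpos t).ne'
    have h1 := norm_vec_pos (b t 1 / b t 0) (b t 2 / b t 0)
    refine ((hbi t 1).div (hbi t 0) h0).congr_deriv ?_
    simp only [normalizedField, constantsField, slowdown, hvec t, Fin.sum_univ_three]
    generalize ‖![1, b t 1 / b t 0, b t 2 / b t 0]‖ = N at h1
    field_simp
    ring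
  · have h0 := (hpos t).ne'
    have h1 := norm_vec_pos (b t 1 / b t 0) (b t 2 / b t 0)
    refine ((hbi t 2).div (hbi t 0) h0).congr_deriv ?_
    simp only [normalizedField, constantsField, slowdown, hvec t, Fin.sum_univ_three]
    generalize ‖![1, b t 1 / b t 0, b t 2 / b t 0]‖ = N at h1
    field_simp
    ring
  · have h0 := (hpos t).ne'
    refine (Moduli.ricciFlow_milnorMap _ t).trans
      (Moduli.chart_eq_milnorMap _ (inv_ne_zero h0) 1 ?_ ?_ ?_).symm
    · exact inv_mul_cancel₀ h0
    · exact (div_eq_inv_mul _ _).symm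
    · exact (div_eq_inv_mul _ _).symm

/-! ### Limits of the normalized Ricci flow in the chart -/

section ChartSolutions

open Filter Set

namespace IsChartSolution

variable {u v : ℝ → ℝ}

theorem continuous_fst (h : IsChartSolution u v) : Continuous u :=
  continuous_iff_continuousAt.2 fun t => (h.deriv_fst t).continuousAt

theorem continuous_snd (h : IsChartSolution u v) : Continuous v :=
  continuous_iff_continuousAt.2 fun t => (h.deriv_snd t).continuousAt

theorem continuous_slowdown (h : IsChartSolution u v) :
    Continuous fun t => slowdown (u t) (v t) := by
  have h1 : Continuous fun t => (u t, v t) := h.continuous_fst.prodMk h.continuous_snd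
  have h2 := _root_.continuous_slowdown.comp h1
  simpa only [Function.comp_def] using h2

theorem tendsto_deriv {l : Filter ℝ} {U V : ℝ} (hu : Tendsto u l (𝓝 U)) (hv : Tendsto v l (𝓝 V)) :
    Tendsto (fun t => slowdown (u t) (v t) * (u t * (1 - u t) * (1 + u t - v t))) l
      (𝓝 (slowdown U V * (U * (1 - U) * (1 + U - V)))) ∧
    Tendsto (fun t => slowdown (u t) (v t) * (v t * (1 - v t) * (1 + v t - u t))) l
      (𝓝 (slowdown U V * (V * (1 - V) * (1 + V - U)))) := by
  have h1 : Tendsto (fun t => (u t, v t)) l (𝓝 (U, V)) := hu.prodMk_nhds hv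
  have h2 := (_root_.continuous_slowdown.tendsto (U, V)).comp h1
  simp only [Function.comp_def] at h2
  exact ⟨h2.mul ((hu.mul (hu.const_sub 1)).mul ((hu.const_add 1).sub hv)),
    h2.mul ((hv.mul (hv.const_sub 1)).mul ((hv.const_add 1).sub hu))⟩

theorem limit_atTop (h : IsChartSolution u v) {U V : ℝ} (hu : Tendsto u atTop (𝓝 U))
    (hv : Tendsto v atTop (𝓝 V)) :
    U * (1 - U) * (1 + U - V) = 0 ∧ V * (1 - V) * (1 + V - U) = 0 := by
  have h1 := tendsto_deriv hu hv
  have h2 := eq_zero_of_tendsto_deriv_atTop h.deriv_fst hu h1.1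
  have h3 := eq_zero_of_tendsto_deriv_atTop h.deriv_snd hv h1.2
  have h4 := (slowdown_pos U V).ne'
  exact ⟨(mul_eq_zero.1 h2).resolve_left h4, (mul_eq_zero.1 h3).resolve_left h4⟩

theorem limit_atBot (h : IsChartSolution u v) {U V : ℝ} (hu : Tendsto u atBot (𝓝 U))
    (hv : Tendsto v atBot (𝓝 V)) :
    U * (1 - U) * (1 + U - V) = 0 ∧ V * (1 - V) * (1 + V - U) = 0 := by
  have h1 := tendsto_deriv hu hv
  have h2 := eq_zero_of_tendsto_deriv_atBot h.deriv_fst hu h1.1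
  have h3 := eq_zero_of_tendsto_deriv_atBot h.deriv_snd hv h1.2
  have h4 := (slowdown_pos U V).ne'
  exact ⟨(mul_eq_zero.1 h2).resolve_left h4, (mul_eq_zero.1 h3).resolve_left h4⟩

/-- The sign of a function with `f' = f c` does not change. -/
theorem sign_of_linear {f c : ℝ → ℝ} (hc : Continuous c)
    (hf : ∀ t, HasDerivAt f (f t * c t) t) (t₀ t : ℝ) :
    (0 < f t₀ → 0 < f t) ∧ (f t₀ < 0 → f t < 0) ∧ (f t₀ = 0 → f t = 0) := by
  refine ⟨fun h => pos_of_linear_deriv_eq hc hf h t, fun h => ?_,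
    fun h => eq_zero_of_linear_deriv hc hf h t⟩
  have := pos_of_linear_deriv_eq (f := fun t => -f t) hc
    (fun t => (hf t).neg.congr_deriv (by ring)) (neg_pos.2 h) t
  exact neg_pos.1 this

theorem sign_fst (h : IsChartSolution u v) (t₀ t : ℝ) :
    (0 < u t₀ → 0 < u t) ∧ (u t₀ < 0 → u t < 0) ∧ (u t₀ = 0 → u t = 0) :=
  sign_of_linear (c := fun t => slowdown (u t) (v t) * ((1 - u t) * (1 + u t - v t)))
    (h.continuous_slowdown.mul ((continuous_const.sub h.continuous_fst).mul
      ((continuous_const.add h.continuous_fst).sub h.continuous_snd)))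
    (fun t => (h.deriv_fst t).congr_deriv (by ring)) t₀ t

theorem sign_one_sub_fst (h : IsChartSolution u v) (t₀ t : ℝ) :
    (0 < 1 - u t₀ → 0 < 1 - u t) ∧ (1 - u t₀ < 0 → 1 - u t < 0) ∧
      (1 - u t₀ = 0 → 1 - u t = 0) :=
  sign_of_linear (f := fun t => 1 - u t)
    (c := fun t => -(slowdown (u t) (v t) * (u t * (1 + u t - v t))))
    (h.continuous_slowdown.mul (h.continuous_fst.mul
      ((continuous_const.add h.continuous_fst).sub h.continuous_snd))).neg
    (fun t => ((h.deriv_fst t).const_sub 1).congr_deriv (by ring)) t₀ t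

theorem sign_snd (h : IsChartSolution u v) (t₀ t : ℝ) :
    (0 < v t₀ → 0 < v t) ∧ (v t₀ < 0 → v t < 0) ∧ (v t₀ = 0 → v t = 0) :=
  sign_of_linear (c := fun t => slowdown (u t) (v t) * ((1 - v t) * (1 + v t - u t)))
    (h.continuous_slowdown.mul ((continuous_const.sub h.continuous_snd).mul
      ((continuous_const.add h.continuous_snd).sub h.continuous_fst)))
    (fun t => (h.deriv_snd t).congr_deriv (by ring)) t₀ t

/-- The system is symmetric in `u` and `v`, so the diagonal is invariant; the difference of the two
equations has the factor `u - v`. -/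
theorem sign_fst_sub_snd (h : IsChartSolution u v) (t₀ t : ℝ) :
    (0 < u t₀ - v t₀ → 0 < u t - v t) ∧ (u t₀ - v t₀ < 0 → u t - v t < 0) ∧
      (u t₀ - v t₀ = 0 → u t - v t = 0) :=
  sign_of_linear (f := fun t => u t - v t)
    (c := fun t => slowdown (u t) (v t) * (1 - u t ^ 2 - v t ^ 2))
    (h.continuous_slowdown.mul ((continuous_const.sub (h.continuous_fst.pow 2)).sub
      (h.continuous_snd.pow 2)))
    (fun t => ((h.deriv_fst t).fun_sub (h.deriv_snd t)).congr_deriv (by ring)) t₀ t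

theorem fst_mem_Icc (h : IsChartSolution u v) {t₀ : ℝ} (h0 : u t₀ ∈ Icc 0 1) (t : ℝ) :
    u t ∈ Icc 0 1 := by
  have h1 := h.sign_fst t t₀
  have h2 := h.sign_one_sub_fst t t₀
  constructor
  · by_contra hlt
    exact absurd h0.1 (not_le.2 (h1.2.1 (not_le.1 hlt)))
  · by_contra hlt
    have := h2.2.1 (by linarith)
    linarith [h0.2]

theorem fst_mem_Ioo (h : IsChartSolution u v) {t₀ : ℝ} (h0 : u t₀ ∈ Ioo 0 1) (t : ℝ) :
    u t ∈ Ioo 0 1 :=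
  ⟨(h.sign_fst t₀ t).1 h0.1, sub_pos.1 ((h.sign_one_sub_fst t₀ t).1 (sub_pos.2 h0.2))⟩

theorem monotone_fst (h : IsChartSolution u v) (h0 : u 0 ∈ Icc 0 1) (hvu : v 0 ≤ u 0) :
    Monotone u := by
  refine monotone_of_deriv_nonneg (fun t => (h.deriv_fst t).differentiableAt) fun t => ?_
  rw [(h.deriv_fst t).deriv]
  have h1 := h.fst_mem_Icc h0 t
  have h2 : v t ≤ u t := by
    by_contra hlt
    have := (h.sign_fst_sub_snd t 0).2.1 (by linarith)
    linarith
  refine mul_nonneg (slowdown_pos _ _).le (mul_nonneg (mul_nonneg h1.1 ?_) ?_)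
  · linarith [h1.2]
  · linarith

theorem exists_limits_fst (h : IsChartSolution u v) (h0 : u 0 ∈ Icc 0 1) (hvu : v 0 ≤ u 0) :
    (∃ U, Tendsto u atBot (𝓝 U) ∧ (∀ t, U ≤ u t) ∧ 0 ≤ U) ∧
      ∃ U, Tendsto u atTop (𝓝 U) ∧ (∀ t, u t ≤ U) ∧ U ≤ 1 := by
  have hm := h.monotone_fst h0 hvu
  obtain ⟨U, h1, -, h3⟩ := exists_tendsto_atBot_of_monotoneOn (f := u) (t₀ := 0) (B := 0)
    (hm.monotoneOn _) fun t _ => (h.fst_mem_Icc h0 t).1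
  obtain ⟨U', h1', -, h3'⟩ := exists_tendsto_atTop_of_monotoneOn (f := u) (t₀ := 0) (B := 1)
    (hm.monotoneOn _) fun t _ => (h.fst_mem_Icc h0 t).2
  exact ⟨⟨U, h1, fun t => hm.le_of_tendsto h1 t, h3⟩, ⟨U', h1', fun t => hm.ge_of_tendsto h1' t,
    h3'⟩⟩

/-- Limits of solutions in the closed triangle `0 ≤ v ≤ u ≤ 1`. -/
theorem triangle (h : IsChartSolution u v) (hv : 0 ≤ v 0) (hvu : v 0 ≤ u 0) (hu : u 0 ≤ 1) :
    (∃ U V, Tendsto u atBot (𝓝 U) ∧ Tendsto v atBot (𝓝 V) ∧ (∀ t, U ≤ u t) ∧ (∀ t, V ≤ v t) ∧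
      (U = 0 ∧ V = 0 ∨ U = 1 ∧ V = 0 ∨ U = 1 ∧ V = 1)) ∧
    ∃ U V, Tendsto u atTop (𝓝 U) ∧ Tendsto v atTop (𝓝 V) ∧ (∀ t, u t ≤ U) ∧ (∀ t, v t ≤ V) ∧
      (U = 0 ∧ V = 0 ∨ U = 1 ∧ V = 0 ∨ U = 1 ∧ V = 1) := by
  have h0 : u 0 ∈ Icc 0 1 := ⟨hv.trans hvu, hu⟩
  have hv0 : ∀ t, 0 ≤ v t := fun t => by
    by_contra hlt
    exact absurd ((h.sign_snd t 0).2.1 (not_le.1 hlt)) (not_lt.2 hv)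
  have hvu' : ∀ t, v t ≤ u t := fun t => by
    by_contra hlt
    have := (h.sign_fst_sub_snd t 0).2.1 (by linarith)
    linarith
  have hmv : Monotone v := by
    refine monotone_of_deriv_nonneg (fun t => (h.deriv_snd t).differentiableAt) fun t => ?_
    rw [(h.deriv_snd t).deriv]
    have h1 := h.fst_mem_Icc h0 t
    have h2 := hvu' t
    refine mul_nonneg (slowdown_pos _ _).le (mul_nonneg (mul_nonneg (hv0 t) ?_) ?_)
    · linarith [h1.2]
    · linarith [h1.2, hv0 t]
  have key : ∀ U V : ℝ, U * (1 - U) * (1 + U - V) = 0 ∧ V * (1 - V) * (1 + V - U) = 0 →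
      0 ≤ V → V ≤ U → U ≤ 1 → (U = 0 ∧ V = 0 ∨ U = 1 ∧ V = 0 ∨ U = 1 ∧ V = 1) := by
    rintro U V ⟨e1, e2⟩ hV hVU hU
    rcases mul_eq_zero.1 e1 with e1 | e1
    · rcases mul_eq_zero.1 e1 with e1 | e1
      · exact Or.inl ⟨e1, by linarith⟩
      · have hU1 : U = 1 := by linarith
        subst hU1
        rcases mul_eq_zero.1 e2 with e2 | e2
        · rcases mul_eq_zero.1 e2 with e2 | e2
          · exact Or.inr (Or.inl ⟨rfl, e2⟩)
          · exact Or.inr (Or.inr ⟨rfl, by linarith⟩)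
        · exact Or.inr (Or.inl ⟨rfl, by linarith⟩)
    · linarith
  obtain ⟨⟨U, hU, hUu, hU0⟩, ⟨U', hU', hUu', hU1'⟩⟩ := h.exists_limits_fst h0 hvu
  obtain ⟨V, hV, -, hV0⟩ := exists_tendsto_atBot_of_monotoneOn (f := v) (t₀ := 0) (B := 0)
    (hmv.monotoneOn _) fun t _ => hv0 t
  obtain ⟨V', hV', -, -⟩ := exists_tendsto_atTop_of_monotoneOn (f := v) (t₀ := 0) (B := 1)
    (hmv.monotoneOn _) fun t _ => (hvu' t).trans (h.fst_mem_Icc h0 t).2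
  refine ⟨⟨U, V, hU, hV, hUu, fun t => hmv.le_of_tendsto hV t, key U V (h.limit_atBot hU hV) hV0
    (le_of_tendsto_of_tendsto' hV hU hvu') ((hUu 0).trans hu)⟩, ⟨U', V', hU', hV', hUu',
    fun t => hmv.ge_of_tendsto hV' t, key U' V' (h.limit_atTop hU' hV')
    (hv.trans (hmv.ge_of_tendsto hV' 0)) (le_of_tendsto_of_tendsto' hV' hU' hvu') hU1'⟩⟩

/-! #### The region `v < 0` -/

/-- The line `u - v = 1` is a nullcline of `v`. There only `u` moves, and it does not decrease, so
orbits cross in one direction only. -/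
theorem nonneg_forward (h : IsChartSolution u v) (h0 : u 0 ∈ Icc 0 1) (hv : v 0 < 0)
    {t₀ t : ℝ} (ht : t₀ ≤ t) (hs : 0 ≤ u t₀ - v t₀ - 1) : 0 ≤ u t - v t - 1 := by
  refine nonneg_of_linear_deriv (f := fun t => u t - v t - 1)
    (h := fun t => slowdown (u t) (v t) * (u t * (1 - u t) * (1 + u t - v t)))
    (c := fun t => slowdown (u t) (v t) * (v t * (1 - v t)))
    (h.continuous_slowdown.mul (h.continuous_snd.mul (continuous_const.sub h.continuous_snd)))
    (fun t => (((h.deriv_fst t).fun_sub (h.deriv_snd t)).sub_const 1).congr_deriv (by ring))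
    (fun t => ?_) ht hs
  have h1 := h.fst_mem_Icc h0 t
  have h2 := (h.sign_snd 0 t).2.1 hv
  refine mul_nonneg (slowdown_pos _ _).le (mul_nonneg (mul_nonneg h1.1 ?_) ?_)
  · linarith [h1.2]
  · linarith [h1.1]

/-- At `v = -1` one has `v' ≥ 0`, so an orbit cannot enter `v < -1` as time increases. -/
theorem lt_neg_one_backward (h : IsChartSolution u v) (h0 : u 0 ∈ Icc 0 1) (hv : v 0 < 0)
    {t₀ t : ℝ} (ht : t ≤ t₀) (hs : v t₀ < -1) : v t < -1 := by
  by_contra hlt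
  have := nonneg_of_linear_deriv (f := fun t => 1 + v t)
    (h := fun t => slowdown (u t) (v t) * (-v t * (1 - v t) * u t))
    (c := fun t => slowdown (u t) (v t) * (v t * (1 - v t)))
    (h.continuous_slowdown.mul (h.continuous_snd.mul (continuous_const.sub h.continuous_snd)))
    (fun t => ((h.deriv_snd t).const_add 1).congr_deriv (by ring))
    (fun t => by
      have h1 := h.fst_mem_Icc h0 t
      have h2 := (h.sign_snd 0 t).2.1 hv
      refine mul_nonneg (slowdown_pos _ _).le (mul_nonneg (mul_nonneg ?_ ?_) h1.1) <;>
      linarith) ht (by linarith)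
  linarith

theorem monotoneOn_snd (h : IsChartSolution u v) (hv : v 0 < 0) {D : Set ℝ} (hD : Convex ℝ D)
    (hs : ∀ t ∈ D, 0 ≤ u t - v t - 1) : MonotoneOn v D := by
  refine monotoneOn_of_deriv_nonneg hD h.continuous_snd.continuousOn
    (fun t _ => (h.deriv_snd t).differentiableAt.differentiableWithinAt) fun t ht => ?_
  rw [(h.deriv_snd t).deriv]
  have h1 := hs t (interior_subset ht)
  have h2 := (h.sign_snd 0 t).2.1 hv
  have h3 : 0 ≤ -v t * (1 - v t) * (u t - v t - 1) :=
    mul_nonneg (mul_nonneg (by linarith) (by linarith)) h1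
  have := mul_nonneg (slowdown_pos (u t) (v t)).le h3
  linarith

theorem antitoneOn_snd (h : IsChartSolution u v) (hv : v 0 < 0) {D : Set ℝ} (hD : Convex ℝ D)
    (hs : ∀ t ∈ D, u t - v t - 1 ≤ 0) : AntitoneOn v D := by
  refine antitoneOn_of_deriv_nonpos hD h.continuous_snd.continuousOn
    (fun t _ => (h.deriv_snd t).differentiableAt.differentiableWithinAt) fun t ht => ?_
  rw [(h.deriv_snd t).deriv]
  have h1 := hs t (interior_subset ht)
  have h2 := (h.sign_snd 0 t).2.1 hv
  have h3 : 0 ≤ -v t * (1 - v t) * -(u t - v t - 1) :=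
    mul_nonneg (mul_nonneg (by linarith) (by linarith)) (by linarith)
  have := mul_nonneg (slowdown_pos (u t) (v t)).le h3
  linarith

/-- Either `u - v` reaches `1` and `v` does not decrease afterwards, or `v` is nonincreasing with
bound `-1`. In both cases there is a limit, and `(1, 0)` is the only rest point with `U > 0` and `V
≤ 0`. -/
theorem forward_of_neg (h : IsChartSolution u v) (hu : 0 < u 0) (hu1 : u 0 ≤ 1) (hv : v 0 < 0) :
    Tendsto u atTop (𝓝 1) ∧ Tendsto v atTop (𝓝 0) := by
  have h0 : u 0 ∈ Icc 0 1 := ⟨hu.le, hu1⟩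
  have hvneg : ∀ t, v t < 0 := fun t => (h.sign_snd 0 t).2.1 hv
  obtain ⟨-, U, hU, hUu, hU1⟩ := h.exists_limits_fst h0 (by linarith)
  have hVex : ∃ V, Tendsto v atTop (𝓝 V) := by
    by_cases hs : ∃ t₀, 0 ≤ u t₀ - v t₀ - 1
    · obtain ⟨t₀, ht₀⟩ := hs
      obtain ⟨V, hV, -, -⟩ := exists_tendsto_atTop_of_monotoneOn (B := 0)
        (h.monotoneOn_snd hv (convex_Ici t₀) fun t ht => h.nonneg_forward h0 hv ht ht₀)
        fun t _ => (hvneg t).le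
      exact ⟨V, hV⟩
    · push Not at hs
      obtain ⟨V, hV, -, -⟩ := exists_tendsto_atTop_of_antitoneOn (B := -1)
        (h.antitoneOn_snd hv (convex_Ici 0) fun t _ => (hs t).le)
        fun t _ => by linarith [hs t, (h.fst_mem_Icc h0 t).1]
      exact ⟨V, hV⟩
  obtain ⟨V, hV⟩ := hVex
  have hV0 : V ≤ 0 := le_of_tendsto' hV fun t => (hvneg t).le
  obtain ⟨e1, e2⟩ := h.limit_atTop hU hV
  have hU0 : 0 < U := hu.trans_le (hUu 0)
  have hU1 : U = 1 := by
    rcases mul_eq_zero.1 e1 with e | e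
    · linarith [(mul_eq_zero.1 e).resolve_left hU0.ne']
    · linarith
  subst hU1
  have hV1 : V = 0 := by
    rcases mul_eq_zero.1 e2 with e | e
    · rcases mul_eq_zero.1 e with e | e
      · exact e
      · linarith
    · linarith
  subst hV1
  exact ⟨hU, hV⟩

theorem eq_zero_of_backward (h : IsChartSolution u v) (hu : u 0 ∈ Ioo 0 1) (hv : v 0 < 0)
    {U V : ℝ} (hU : Tendsto u atBot (𝓝 U)) (hV : Tendsto v atBot (𝓝 V)) :
    U = 0 ∧ (V = 0 ∨ V = -1) := by
  have h0 : u 0 ∈ Icc 0 1 := Ioo_subset_Icc_self hu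
  obtain ⟨⟨U', hU', hUu', hU0'⟩, -⟩ := h.exists_limits_fst h0 (by linarith [hu.1])
  have hUU := tendsto_nhds_unique hU hU'
  subst hUU
  obtain ⟨e1, e2⟩ := h.limit_atBot hU hV
  have hV0 : V ≤ 0 := le_of_tendsto' hV fun t => ((h.sign_snd 0 t).2.1 hv).le
  have hU1 : U = 0 := by
    rcases mul_eq_zero.1 e1 with e | e
    · rcases mul_eq_zero.1 e with e | e
      · exact e
      · linarith [hUu' 0, hu.2]
    · linarith
  subst hU1
  refine ⟨rfl, ?_⟩
  rcases mul_eq_zero.1 e2 with e | e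
  · rcases mul_eq_zero.1 e with e | e
    · exact Or.inl e
    · linarith
  · exact Or.inr (by linarith)

/-- Before `t₀` the orbit lies in `u - v ≤ 1`, where `v` does not increase with time. Its backward
limit is at least `v t₀ > -1`, which excludes `(0, -1)`. -/
theorem backward_of_lt (h : IsChartSolution u v) (hu : u 0 ∈ Ioo 0 1) (hv : v 0 < 0) {t₀ : ℝ}
    (ht₀ : u t₀ - v t₀ - 1 < 0) : Tendsto u atBot (𝓝 0) ∧ Tendsto v atBot (𝓝 0) := by
  have h0 : u 0 ∈ Icc 0 1 := Ioo_subset_Icc_self hu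
  have hs : ∀ t ∈ Iic t₀, u t - v t - 1 ≤ 0 := fun t ht => by
    by_contra hlt
    exact absurd (h.nonneg_forward h0 hv ht (not_le.1 hlt).le) (not_le.2 ht₀)
  obtain ⟨⟨U, hU, -, -⟩, -⟩ := h.exists_limits_fst h0 (by linarith [hu.1])
  obtain ⟨V, hV, hV', -⟩ := exists_tendsto_atBot_of_antitoneOn (B := 0)
    (h.antitoneOn_snd hv (convex_Iic t₀) hs) fun t _ => ((h.sign_snd 0 t).2.1 hv).le
  obtain ⟨rfl, rfl | rfl⟩ := h.eq_zero_of_backward hu hv hU hV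
  · exact ⟨hU, hV⟩
  · have := hV' t₀ self_mem_Iic
    linarith [(h.fst_mem_Ioo hu t₀).1]

/-- Backwards `v` does not increase from a value below `-1`, while a finite limit would have to be
`0` or `-1`. -/
theorem backward_of_lt_neg_one (h : IsChartSolution u v) (hu : u 0 ∈ Ioo 0 1) (hv : v 0 < 0)
    {t₀ : ℝ} (ht₀ : v t₀ < -1) : Tendsto v atBot atBot := by
  have h0 : u 0 ∈ Icc 0 1 := Ioo_subset_Icc_self hu
  obtain ⟨⟨U, hU, -, -⟩, -⟩ := h.exists_limits_fst h0 (by linarith [hu.1])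
  refine tendsto_atBot_atBot_of_monotoneOn (h.monotoneOn_snd hv (convex_Iic t₀) fun t ht => ?_)
    fun V hV hlim => ?_
  · have := h.lt_neg_one_backward h0 hv ht ht₀
    linarith [(h.fst_mem_Ioo hu t).1]
  · rcases (h.eq_zero_of_backward hu hv hU hlim).2 with e | e <;> linarith

theorem backward_of_between (h : IsChartSolution u v) (hu : u 0 ∈ Ioo 0 1) (hv : v 0 < 0)
    (hs : ∀ t, 0 ≤ u t - v t - 1) (hv1 : ∀ t, -1 ≤ v t) :
    Tendsto u atBot (𝓝 0) ∧ Tendsto v atBot (𝓝 (-1)) := by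
  have h0 : u 0 ∈ Icc 0 1 := Ioo_subset_Icc_self hu
  obtain ⟨⟨U, hU, -, -⟩, -⟩ := h.exists_limits_fst h0 (by linarith [hu.1])
  obtain ⟨V, hV, hV', -⟩ := exists_tendsto_atBot_of_monotoneOn (t₀ := 0) (B := -1)
    (h.monotoneOn_snd hv (convex_Iic 0) fun t _ => hs t) fun t _ => hv1 t
  obtain ⟨rfl, rfl | rfl⟩ := h.eq_zero_of_backward hu hv hU hV
  · linarith [hV' 0 self_mem_Iic]
  · exact ⟨hU, hV⟩

theorem backward_of_fst_eq_one (h : IsChartSolution u v) (hu : u 0 = 1) (hv : v 0 < 0) :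
    Tendsto v atBot atBot := by
  have hu' : ∀ t, u t = 1 := fun t => by
    linarith [(h.sign_one_sub_fst 0 t).2.2 (by linarith)]
  refine tendsto_atBot_atBot_of_monotoneOn (t₀ := 0)
    (h.monotoneOn_snd hv (convex_Iic 0) fun t ht => ?_) fun V hV hlim => ?_
  · linarith [hu' t, (h.sign_snd 0 t).2.1 hv]
  · obtain ⟨-, e⟩ := h.limit_atBot (tendsto_const_nhds.congr fun t => (hu' t).symm) hlim
    have h1 : V * (1 - V) * V ≠ 0 :=
      mul_ne_zero (mul_ne_zero (by linarith) (by linarith)) (by linarith)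
    exact h1 (by linarith)

theorem limits_of_fst_eq_zero (h : IsChartSolution u v) (hu : u 0 = 0) (hv : v 0 ∈ Ioo (-1) 0) :
    (∀ t, u t = 0) ∧ (∀ t, v t ∈ Ioo (-1) 0) ∧ Tendsto v atBot (𝓝 0) ∧
      Tendsto v atTop (𝓝 (-1)) := by
  have hu' : ∀ t, u t = 0 := fun t => (h.sign_fst 0 t).2.2 hu
  have hv0 : ∀ t, v t < 0 := fun t => (h.sign_snd 0 t).2.1 hv.2
  have hv1 : ∀ t, -1 < v t := fun t => by
    have := (sign_of_linear (f := fun t => 1 + v t)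
      (c := fun t => slowdown (u t) (v t) * (v t * (1 - v t)))
      (h.continuous_slowdown.mul (h.continuous_snd.mul (continuous_const.sub h.continuous_snd)))
      (fun t => ((h.deriv_snd t).const_add 1).congr_deriv (by rw [hu' t]; ring)) 0 t).1
      (by linarith [hv.1])
    linarith
  have hul : ∀ l, Tendsto u l (𝓝 0) := fun l => tendsto_const_nhds.congr fun t => (hu' t).symm
  have hanti : Antitone v := antitoneOn_univ.1 (h.antitoneOn_snd hv.2 convex_univ fun t _ => by
    linarith [hu' t, hv1 t])
  have key : ∀ V : ℝ, V * (1 - V) * (1 + V - 0) = 0 → V ≤ 0 → V = 0 ∨ V = -1 := by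
    intro V e hV
    rcases mul_eq_zero.1 e with e | e
    · rcases mul_eq_zero.1 e with e | e
      · exact Or.inl e
      · linarith
    · exact Or.inr (by linarith)
  obtain ⟨V, hV, hV', hV0⟩ := exists_tendsto_atBot_of_antitoneOn (t₀ := 0) (B := 0)
    (hanti.antitoneOn _) fun t _ => (hv0 t).le
  obtain ⟨W, hW, hW', hW0⟩ := exists_tendsto_atTop_of_antitoneOn (t₀ := 0) (B := -1)
    (hanti.antitoneOn _) fun t _ => (hv1 t).le
  have h1 := hV' 0 self_mem_Iic
  have h2 := hW' 0 self_mem_Ici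
  refine ⟨hu', fun t => ⟨hv1 t, hv0 t⟩, ?_, ?_⟩
  · rcases key V (h.limit_atBot (hul _) hV).2 hV0 with rfl | rfl
    · exact hV
    · linarith [hv.1]
  · rcases key W (h.limit_atTop (hul _) hW).2 (by linarith [hv.2]) with rfl | rfl
    · linarith [hv.2]
    · exact hW

end IsChartSolution

end ChartSolutions

section

open Filter Set

/-! #### The separatrix -/

namespace IsChartSolution

variable {u v u' v' : ℝ → ℝ}

/-- The logarithmic slope of orbits as graphs over the first coordinate is decreasing. -/
theorem slope_antitone {r w w' : ℝ} (hr : 0 < r) (hr1 : r < 1) (hw : 0 < w) (h : w ≤ w') :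
    (1 + w') * (1 - w' - r) / (r * (1 - r) * (1 + r + w')) ≤
      (1 + w) * (1 - w - r) / (r * (1 - r) * (1 + r + w)) := by
  have h1 : 0 < r * (1 - r) := mul_pos hr (by linarith)
  rw [div_le_div_iff₀ (mul_pos h1 (by linarith)) (mul_pos h1 (by linarith))]
  -- After clearing denominators, the difference of the slopes is `r * (1 - r)` times `w' - w` times
  -- the difference of these two sides.
  have h2 : 2 * r ≤ (1 + r + w) * (1 + r + w') := by
    nlinarith [mul_nonneg hw.le (hw.le.trans h), mul_nonneg hr.le hw.le,
      mul_nonneg hr.le (hw.le.trans h)]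
  nlinarith [mul_nonneg h1.le (mul_nonneg (sub_nonneg.2 h) (sub_nonneg.2 h2))]

theorem strictMono_fst (h : IsChartSolution u v) (hu : u 0 ∈ Ioo 0 1) (hv : v 0 < 0) :
    (∀ t, 0 < slowdown (u t) (v t) * (u t * (1 - u t) * (1 + u t - v t))) ∧ StrictMono u := by
  have hpos : ∀ t, 0 < slowdown (u t) (v t) * (u t * (1 - u t) * (1 + u t - v t)) := fun t => by
    have h1 := h.fst_mem_Ioo hu t
    have h2 := (h.sign_snd 0 t).2.1 hv
    exact mul_pos (slowdown_pos _ _) (mul_pos (mul_pos h1.1 (by linarith [h1.2]))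
      (by linarith [h1.1]))
  exact ⟨hpos, strictMonoOn_univ.1
    (strictMonoOn_of_hasDerivAt_pos ordConnected_univ (fun t _ => h.deriv_fst t)
      fun t _ => hpos t)⟩

/-- An orbit in the strip that crosses it is a graph over the first coordinate. -/
theorem exists_graph (h : IsChartSolution u v) (hu : u 0 ∈ Ioo 0 1) (hv : v 0 < 0)
    (hbot : Tendsto u atBot (𝓝 0)) (htop : Tendsto u atTop (𝓝 1)) :
    ∃ k : ℝ → ℝ, (∀ t, k (u t) = t) ∧ (∀ r ∈ Ioo 0 1, u (k r) = r) ∧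
      ∀ r ∈ Ioo 0 1, HasDerivAt (fun r => Real.log (-v (k r)))
        ((1 + -v (k r)) * (1 - -v (k r) - r) / (r * (1 - r) * (1 + r + -v (k r)))) r := by
  obtain ⟨hpos, hmono⟩ := h.strictMono_fst hu hv
  obtain ⟨-, -, k, hk, hkd⟩ := exists_inverse_of_hasDerivAt_pos h.deriv_fst hpos
  have hrange : ∀ r ∈ Ioo (0 : ℝ) 1, ∃ t, u t = r := by
    intro r hr
    obtain ⟨t₁, ht₁⟩ := (hbot.eventually (gt_mem_nhds hr.1)).exists
    obtain ⟨t₂, ht₂⟩ := (htop.eventually (lt_mem_nhds hr.2)).exists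
    exact mem_range_of_exists_le_of_exists_ge h.continuous_fst ⟨t₁, ht₁.le⟩ ⟨t₂, ht₂.le⟩
  refine ⟨k, hk, fun r hr => ?_, fun r hr => ?_⟩
  · obtain ⟨t, rfl⟩ := hrange r hr
    rw [hk]
  · obtain ⟨t, rfl⟩ := hrange r hr
    have h2 := (h.sign_snd 0 t).2.1 hv
    have h3 : HasDerivAt (fun r => Real.log (-v (k r))) _ (u t) :=
      ((HasDerivAt.comp (u t) (by rw [hk]; exact h.deriv_snd t) (hkd t)).neg).log
        (by simp [hk, h2.ne])
    refine h3.congr_deriv ?_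
    have h4 := (slowdown_pos (u t) (v t)).ne'
    have h5 : 1 + u t - v t ≠ 0 := by linarith [hr.1]
    have h6 : u t ≠ 0 := hr.1.ne'
    have h7 : 1 - u t ≠ 0 := by linarith [hr.2]
    have h8 : v t ≠ 0 := h2.ne
    have h9 : 1 + u t + -v t ≠ 0 := by linarith [hr.1]
    simp only [hk, Function.comp_apply, Pi.neg_apply]
    field_simp
    ring

/-- By `slope_antitone` the squared difference of `log (-v)` along two orbits does not increase with
`u`. It tends to zero at `u = 0`, where both have `v → -1`, so it vanishes and the orbits coincide.
-/
theorem exists_eq_of_separatrix (h : IsChartSolution u v) (h' : IsChartSolution u' v')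
    (hu : u 0 ∈ Ioo 0 1) (hv : v 0 < 0) (hu' : u' 0 ∈ Ioo 0 1) (hv' : v' 0 < 0)
    (hub : Tendsto u atBot (𝓝 0)) (hvb : Tendsto v atBot (𝓝 (-1)))
    (hub' : Tendsto u' atBot (𝓝 0)) (hvb' : Tendsto v' atBot (𝓝 (-1))) :
    ∃ t, u t = u' 0 ∧ v t = v' 0 := by
  obtain ⟨k, hk, hk1, hkd⟩ := h.exists_graph hu hv hub (h.forward_of_neg hu.1 hu.2.le hv).1
  obtain ⟨k', hk', hk1', hkd'⟩ :=
    h'.exists_graph hu' hv' hub' (h'.forward_of_neg hu'.1 hu'.2.le hv').1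
  have hw : ∀ t, 0 < -v t := fun t => neg_pos.2 ((h.sign_snd 0 t).2.1 hv)
  have hw' : ∀ t, 0 < -v' t := fun t => neg_pos.2 ((h'.sign_snd 0 t).2.1 hv')
  let D : ℝ → ℝ := fun r => (Real.log (-v (k r)) - Real.log (-v' (k' r))) ^ 2
  have hD : AntitoneOn D (Ioo 0 1) := by
    have hd := fun r (hr : r ∈ Ioo (0 : ℝ) 1) => ((hkd r hr).fun_sub (hkd' r hr)).fun_pow 2
    refine antitoneOn_of_deriv_nonpos (convex_Ioo 0 1)
      (fun r hr => (hd r hr).continuousAt.continuousWithinAt)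
      (fun r hr => (hd r (interior_subset hr)).differentiableAt.differentiableWithinAt)
      fun r hr => ?_
    have hr' : r ∈ Ioo (0 : ℝ) 1 := interior_subset hr
    rw [(hd r hr').deriv, Nat.cast_ofNat, pow_one]
    rcases le_total (-v (k r)) (-v' (k' r)) with hle | hle
    · have h1 := slope_antitone hr'.1 hr'.2 (hw _) hle
      have h2 := Real.log_le_log (hw _) hle
      exact mul_nonpos_of_nonpos_of_nonneg (by linarith) (by linarith)
    · have h1 := slope_antitone hr'.1 hr'.2 (hw' _) hle
      have h2 := Real.log_le_log (hw' _) hle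
      exact mul_nonpos_of_nonneg_of_nonpos (by linarith) (by linarith)
  have hlog : ∀ {f : ℝ → ℝ} {l : Filter ℝ}, Tendsto f l (𝓝 (-1)) →
      Tendsto (fun t => Real.log (-f t)) l (𝓝 0) := by
    intro f l hf
    have := (hf.neg).log (by norm_num)
    simpa using this
  -- The times at which the second orbit has the first coordinate of the first one also run to `-∞`.
  have hkb : Tendsto (fun t => k' (u t)) atBot atBot := by
    refine tendsto_atBot.2 fun N => ?_
    filter_upwards [hub.eventually (gt_mem_nhds (h'.fst_mem_Ioo hu' N).1)] with t ht
    by_contra hlt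
    have := (h'.strictMono_fst hu' hv').2 (not_le.1 hlt)
    rw [hk1' _ (h.fst_mem_Ioo hu t)] at this
    exact absurd ht (not_lt.2 this.le)
  have hD0 : Tendsto (fun t => D (u t)) atBot (𝓝 0) := by
    have := ((hlog hvb).sub ((hlog hvb').comp hkb)).pow 2
    simpa [D, hk, Function.comp_def] using this
  have hzero : ∀ r ∈ Ioo (0 : ℝ) 1, v (k r) = v' (k' r) := by
    intro r hr
    have h1 : D r ≤ 0 := ge_of_tendsto hD0 (by
      filter_upwards [hub.eventually (gt_mem_nhds hr.1)] with t ht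
      exact hD (h.fst_mem_Ioo hu t) hr ht.le)
    have h2 : Real.log (-v (k r)) = Real.log (-v' (k' r)) :=
      sub_eq_zero.1 (pow_eq_zero_iff two_ne_zero |>.1 (le_antisymm h1 (sq_nonneg _)))
    exact neg_injective (Real.log_injOn_pos (hw _) (hw' _) h2)
  refine ⟨k (u' 0), hk1 _ hu', ?_⟩
  rw [hzero _ hu', hk']

end IsChartSolution

namespace Moduli

/-! ### Orbits of the normalized Ricci flow on the moduli space -/

theorem tendsto_chart {x : Moduli} {u v : ℝ → ℝ} {l : Filter ℝ} {U V : ℝ}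
    (hx : ∀ t, ricciFlow t x = chart (u t, v t)) (hu : Tendsto u l (𝓝 U))
    (hv : Tendsto v l (𝓝 V)) : Tendsto (fun t => ricciFlow t x) l (𝓝 (chart (U, V))) := by
  simp only [hx]
  exact (continuous_chart.tendsto (U, V)).comp (hu.prodMk_nhds hv)

/-- Dividing by the third constant brings `v → -∞` back into the chart, as an approach to `(0, 0)`.
-/
theorem chart_eq_chart_inv {u v : ℝ} (hv : v ≠ 0) : chart (u, v) = chart (u * v⁻¹, v⁻¹) := by
  refine (chart_eq_milnorMap (chart_ne_zero (u, v)) (inv_ne_zero hv) (Equiv.swap 0 2)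
    ?_ ?_ ?_).symm
  · simp [hv]
  · rw [Equiv.swap_apply_of_ne_of_ne (by decide) (by decide)]
    simp [mul_comm]
  · simp

theorem tendsto_chart_of_atBot {x : Moduli} {u v : ℝ → ℝ} {l : Filter ℝ}
    (hx : ∀ t, ricciFlow t x = chart (u t, v t)) (hu : ∀ t, u t ∈ Icc 0 1)
    (hv : Tendsto v l atBot) : Tendsto (fun t => ricciFlow t x) l (𝓝 (chart (0, 0))) := by
  have h1 : Tendsto (fun t => (v t)⁻¹) l (𝓝 0) := tendsto_inv_atBot_zero.comp hv
  have h2 : Tendsto (fun t => u t * (v t)⁻¹) l (𝓝 0) := by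
    refine bdd_le_mul_tendsto_zero' 1 (Eventually.of_forall fun t => ?_) h1
    rw [abs_le]
    exact ⟨by linarith [(hu t).1], (hu t).2⟩
  refine ((continuous_chart.tendsto (0, 0)).comp (h2.prodMk_nhds h1)).congr' ?_
  filter_upwards [hv.eventually (eventually_lt_atBot 0)] with t ht
  rw [hx, Function.comp_apply, chart_eq_chart_inv ht.ne]

theorem orbit_eq_image {x : Moduli} {c : ℝ → Moduli} {f : ℝ → ℝ} {J : Set ℝ}
    (hf : Continuous f) (hfJ : ∀ t, f t ∈ J) (hx : ∀ t, ricciFlow t x = c (f t))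
    (hJ : ∀ y ∈ J, (∃ t, f t ≤ y) ∧ ∃ t, y ≤ f t) : ricciFlow.orbit x = c '' J := by
  ext y
  rw [Flow.mem_orbit_iff]
  constructor
  · rintro ⟨t, rfl⟩
    exact ⟨f t, hfJ t, (hx t).symm⟩
  · rintro ⟨r, hr, rfl⟩
    obtain ⟨t, rfl⟩ := mem_range_of_exists_le_of_exists_ge hf (hJ r hr).1 (hJ r hr).2
    exact ⟨t, hx t⟩

theorem exists_le_of_tendsto {f : ℝ → ℝ} {l : Filter ℝ} [l.NeBot] {α y : ℝ}
    (h : Tendsto f l (𝓝 α)) (hy : α < y) : ∃ t, f t ≤ y :=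
  let ⟨t, ht⟩ := (h.eventually (gt_mem_nhds hy)).exists
  ⟨t, ht.le⟩

theorem exists_ge_of_tendsto {f : ℝ → ℝ} {l : Filter ℝ} [l.NeBot] {α y : ℝ}
    (h : Tendsto f l (𝓝 α)) (hy : y < α) : ∃ t, y ≤ f t :=
  let ⟨t, ht⟩ := (h.eventually (lt_mem_nhds hy)).exists
  ⟨t, ht.le⟩

/-- `T` is a single orbit of `ricciFlow`, which runs from `p` to `q`. -/
structure IsOrbitFromTo (T : Set Moduli) (p q : Moduli) : Prop where
  nonempty : T.Nonempty
  orbit_eq : ∀ x ∈ T, ricciFlow.orbit x = T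
  runsFromTo : RunsFromTo ricciFlow T p q

theorem fixed_zero_zero (t : ℝ) : ricciFlow t (chart (0, 0)) = chart (0, 0) := by
  obtain ⟨u, v, hu, hv, h, hx⟩ := exists_isChartSolution 0 0
  rw [hx, (h.sign_fst 0 t).2.2 hu, (h.sign_snd 0 t).2.2 hv]

theorem fixed_one_zero (t : ℝ) : ricciFlow t (chart (1, 0)) = chart (1, 0) := by
  obtain ⟨u, v, hu, hv, h, hx⟩ := exists_isChartSolution 1 0
  have := (h.sign_one_sub_fst 0 t).2.2 (by rw [hu, sub_self])
  rw [hx, (h.sign_snd 0 t).2.2 hv, show u t = 1 by linarith]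

theorem fixed_one_one (t : ℝ) : ricciFlow t (chart (1, 1)) = chart (1, 1) := by
  obtain ⟨u, v, hu, hv, h, hx⟩ := exists_isChartSolution 1 1
  have h1 := (h.sign_one_sub_fst 0 t).2.2 (by rw [hu, sub_self])
  have h2 := (h.sign_fst_sub_snd 0 t).2.2 (by rw [hu, hv, sub_self])
  rw [hx, show u t = 1 by linarith, show v t = 1 by linarith]

theorem fixed_zero_neg_one (t : ℝ) : ricciFlow t (chart (0, -1)) = chart (0, -1) := by
  obtain ⟨u, v, hu, hv, h, hx⟩ := exists_isChartSolution 0 (-1)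
  have hu' : ∀ t, u t = 0 := fun t => (h.sign_fst 0 t).2.2 hu
  have := eq_zero_of_linear_deriv (f := fun t => 1 + v t) (t₀ := 0)
    (c := fun t => slowdown (u t) (v t) * (v t * (1 - v t)))
    (h.continuous_slowdown.mul (h.continuous_snd.mul (continuous_const.sub h.continuous_snd)))
    (fun t => ((h.deriv_snd t).const_add 1).congr_deriv (by rw [hu' t]; ring))
    (by rw [hv]; norm_num) t
  rw [hx, hu' t, show v t = -1 by linarith]

/-- Signs `+, 0, -`: metrics on Sol, the motion group of the Minkowski plane. -/
theorem isOrbit_edge12 :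
    IsOrbitFromTo ((fun s => chart (0, s)) '' Ioo (-1) 0) (chart (0, 0)) (chart (0, -1)) := by
  have key : ∀ s ∈ Ioo (-1 : ℝ) 0, ricciFlow.orbit (chart (0, s)) =
      (fun s => chart (0, s)) '' Ioo (-1) 0 ∧
      Tendsto (fun t => ricciFlow t (chart (0, s))) atBot (𝓝 (chart (0, 0))) ∧
      Tendsto (fun t => ricciFlow t (chart (0, s))) atTop (𝓝 (chart (0, -1))) := by
    intro s hs
    obtain ⟨u, v, hu, rfl, h, hx⟩ := exists_isChartSolution 0 s
    obtain ⟨hu', hv', h1, h2⟩ := h.limits_of_fst_eq_zero hu hs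
    have hul : ∀ l, Tendsto u l (𝓝 0) := fun l => tendsto_const_nhds.congr fun t => (hu' t).symm
    exact ⟨orbit_eq_image h.continuous_snd hv' (fun t => by rw [hx, hu']) fun y hy =>
      ⟨exists_le_of_tendsto h2 hy.1, exists_ge_of_tendsto h1 hy.2⟩,
      tendsto_chart hx (hul _) h1, tendsto_chart hx (hul _) h2⟩
  exact ⟨⟨_, -1 / 2, by norm_num, rfl⟩, by rintro _ ⟨s, hs, rfl⟩; exact (key s hs).1,
    by rintro _ ⟨s, hs, rfl⟩; exact (key s hs).2⟩

/-- Signs `+, +, 0`: non-flat metrics on the universal cover of the Euclidean motion group, which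
tend to the flat one. -/
theorem isOrbit_edge13 :
    IsOrbitFromTo ((fun s => chart (s, 0)) '' Ioo 0 1) (chart (0, 0)) (chart (1, 0)) := by
  have key : ∀ s ∈ Ioo (0 : ℝ) 1, ricciFlow.orbit (chart (s, 0)) =
      (fun s => chart (s, 0)) '' Ioo 0 1 ∧
      Tendsto (fun t => ricciFlow t (chart (s, 0))) atBot (𝓝 (chart (0, 0))) ∧
      Tendsto (fun t => ricciFlow t (chart (s, 0))) atTop (𝓝 (chart (1, 0))) := by
    intro s hs
    obtain ⟨u, v, rfl, hv, h, hx⟩ := exists_isChartSolution s 0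
    have hv' : ∀ t, v t = 0 := fun t => (h.sign_snd 0 t).2.2 hv
    have hvl : ∀ l, Tendsto v l (𝓝 0) := fun l => tendsto_const_nhds.congr fun t => (hv' t).symm
    obtain ⟨⟨U, V, hU, -, hUu, -, hUV⟩, ⟨U', V', hU', -, hUu', -, hUV'⟩⟩ :=
      h.triangle hv.ge (by rw [hv]; exact hs.1.le) hs.2.le
    have e1 : U = 0 := by
      have := hUu 0
      rcases hUV with ⟨e, -⟩ | ⟨e, -⟩ | ⟨e, -⟩ <;> linarith [hs.2]
    have e2 : U' = 1 := by
      have := hUu' 0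
      rcases hUV' with ⟨e, -⟩ | ⟨e, -⟩ | ⟨e, -⟩ <;> linarith [hs.1]
    subst e1 e2
    exact ⟨orbit_eq_image h.continuous_fst (h.fst_mem_Ioo hs) (fun t => by rw [hx, hv'])
      fun y hy => ⟨exists_le_of_tendsto hU hy.1, exists_ge_of_tendsto hU' hy.2⟩,
      tendsto_chart hx hU (hvl _), tendsto_chart hx hU' (hvl _)⟩
  exact ⟨⟨_, 1 / 2, by norm_num, rfl⟩, by rintro _ ⟨s, hs, rfl⟩; exact (key s hs).1,
    by rintro _ ⟨s, hs, rfl⟩; exact (key s hs).2⟩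

/-- Two equal smaller positive constants: Berger spheres on one side of the round one. -/
theorem isOrbit_edge14 :
    IsOrbitFromTo ((fun s => chart (s, s)) '' Ioo 0 1) (chart (0, 0)) (chart (1, 1)) := by
  have key : ∀ s ∈ Ioo (0 : ℝ) 1, ricciFlow.orbit (chart (s, s)) =
      (fun s => chart (s, s)) '' Ioo 0 1 ∧
      Tendsto (fun t => ricciFlow t (chart (s, s))) atBot (𝓝 (chart (0, 0))) ∧
      Tendsto (fun t => ricciFlow t (chart (s, s))) atTop (𝓝 (chart (1, 1))) := by
    intro s hs
    obtain ⟨u, v, hu, hv, h, hx⟩ := exists_isChartSolution s s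
    have hu' : u 0 ∈ Ioo 0 1 := hu ▸ hs
    have hv' : ∀ t, v t = u t := fun t => by
      linarith [(h.sign_fst_sub_snd 0 t).2.2 (by rw [hu, hv, sub_self])]
    obtain ⟨⟨U, V, hU, hV, hUu, hVv, hUV⟩, ⟨U', V', hU', hV', hUu', hVv', hUV'⟩⟩ :=
      h.triangle (by rw [hv]; exact hs.1.le) (hv' 0).le hu'.2.le
    have e1 : U = 0 ∧ V = 0 := by
      have := hUu 0
      rcases hUV with e | ⟨e, -⟩ | ⟨e, -⟩
      · exact e
      · linarith [hu'.2]
      · linarith [hu'.2]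
    have e2 : U' = 1 ∧ V' = 1 := by
      have := hVv' 0
      have := hv' 0
      rcases hUV' with ⟨-, e⟩ | ⟨-, e⟩ | e
      · linarith [hu'.1]
      · linarith [hu'.1]
      · exact e
    rw [e1.1] at hU; rw [e1.2] at hV; rw [e2.1] at hU'; rw [e2.2] at hV'
    exact ⟨orbit_eq_image h.continuous_fst (h.fst_mem_Ioo hu') (fun t => by rw [hx, hv'])
      fun y hy => ⟨exists_le_of_tendsto hU hy.1, exists_ge_of_tendsto hU' hy.2⟩,
      tendsto_chart hx hU hV, tendsto_chart hx hU' hV'⟩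
  exact ⟨⟨_, 1 / 2, by norm_num, rfl⟩, by rintro _ ⟨s, hs, rfl⟩; exact (key s hs).1,
    by rintro _ ⟨s, hs, rfl⟩; exact (key s hs).2⟩

/-- Two equal larger positive constants: Berger spheres on the other side of the round one. -/
theorem isOrbit_edge34 :
    IsOrbitFromTo ((fun s => chart (1, s)) '' Ioo 0 1) (chart (1, 0)) (chart (1, 1)) := by
  have key : ∀ s ∈ Ioo (0 : ℝ) 1, ricciFlow.orbit (chart (1, s)) =
      (fun s => chart (1, s)) '' Ioo 0 1 ∧
      Tendsto (fun t => ricciFlow t (chart (1, s))) atBot (𝓝 (chart (1, 0))) ∧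
      Tendsto (fun t => ricciFlow t (chart (1, s))) atTop (𝓝 (chart (1, 1))) := by
    intro s hs
    obtain ⟨u, v, hu, rfl, h, hx⟩ := exists_isChartSolution 1 s
    have hu' : ∀ t, u t = 1 := fun t => by
      linarith [(h.sign_one_sub_fst 0 t).2.2 (by rw [hu, sub_self])]
    have hul : ∀ l, Tendsto u l (𝓝 1) := fun l => tendsto_const_nhds.congr fun t => (hu' t).symm
    have hv' : ∀ t, v t ∈ Ioo 0 1 := fun t =>
      ⟨(h.sign_snd 0 t).1 hs.1, by
        have := (h.sign_fst_sub_snd 0 t).1 (by rw [hu]; linarith [hs.2])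
        linarith [hu' t]⟩
    obtain ⟨⟨U, V, hU, hV, -, hVv, hUV⟩, ⟨U', V', hU', hV', -, hVv', hUV'⟩⟩ :=
      h.triangle hs.1.le (by rw [hu]; exact hs.2.le) hu.le
    have f1 := tendsto_nhds_unique hU (hul _)
    have f2 := tendsto_nhds_unique hU' (hul _)
    have e1 : V = 0 := by
      have := hVv 0
      rcases hUV with ⟨e, e'⟩ | ⟨-, e⟩ | ⟨-, e⟩ <;> linarith [hs.2]
    have e2 : V' = 1 := by
      have := hVv' 0
      rcases hUV' with ⟨-, e⟩ | ⟨-, e⟩ | ⟨-, e⟩ <;> linarith [hs.1]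
    subst e1 e2
    exact ⟨orbit_eq_image h.continuous_snd hv' (fun t => by rw [hx, hu'])
      fun y hy => ⟨exists_le_of_tendsto hV hy.1, exists_ge_of_tendsto hV' hy.2⟩,
      tendsto_chart hx (hul _) hV, tendsto_chart hx (hul _) hV'⟩
  exact ⟨⟨_, 1 / 2, by norm_num, rfl⟩, by rintro _ ⟨s, hs, rfl⟩; exact (key s hs).1,
    by rintro _ ⟨s, hs, rfl⟩; exact (key s hs).2⟩

/-- Signs `+, +, -` with the positive constants equal: the more symmetric metrics on the universal
cover of `SL(2, ℝ)`. -/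
theorem isOrbit_edge13' :
    IsOrbitFromTo ((fun s => chart (1, s)) '' Iio 0) (chart (0, 0)) (chart (1, 0)) := by
  have key : ∀ s ∈ Iio (0 : ℝ), ricciFlow.orbit (chart (1, s)) =
      (fun s => chart (1, s)) '' Iio 0 ∧
      Tendsto (fun t => ricciFlow t (chart (1, s))) atBot (𝓝 (chart (0, 0))) ∧
      Tendsto (fun t => ricciFlow t (chart (1, s))) atTop (𝓝 (chart (1, 0))) := by
    intro s hs
    obtain ⟨u, v, hu, rfl, h, hx⟩ := exists_isChartSolution 1 s
    have hu' : ∀ t, u t = 1 := fun t => by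
      linarith [(h.sign_one_sub_fst 0 t).2.2 (by rw [hu, sub_self])]
    have hbot := h.backward_of_fst_eq_one hu hs
    have htop := h.forward_of_neg (by rw [hu]; exact one_pos) hu.le hs
    exact ⟨orbit_eq_image h.continuous_snd (fun t => (h.sign_snd 0 t).2.1 hs)
      (fun t => by rw [hx, hu'])
      fun y hy => ⟨(hbot.eventually (eventually_le_atBot y)).exists,
        exists_ge_of_tendsto htop.2 hy⟩,
      tendsto_chart_of_atBot hx (fun t => by rw [hu']; simp) hbot,
      tendsto_chart hx htop.1 htop.2⟩
  exact ⟨⟨_, -1, by norm_num, rfl⟩, by rintro _ ⟨s, hs, rfl⟩; exact (key s hs).1,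
    by rintro _ ⟨s, hs, rfl⟩; exact (key s hs).2⟩

end Moduli

end

/-! ### The two-dimensional parts of the phase portrait -/

section Basins

open Filter Set

namespace Moduli

/-- The normal forms with one negative structure constant, away from the boundary. -/
def strip : Set (ℝ × ℝ) := Ioo 0 1 ×ˢ Iio 0

/-- The normal forms with distinct positive structure constants. -/
def triangle : Set (ℝ × ℝ) := {p | 0 < p.2 ∧ p.2 < p.1 ∧ p.1 < 1}

/-- The part of the strip from which orbits run backwards to the point `(0, 0)` of the chart. -/
def nearRegion : Set (ℝ × ℝ) := {p | 0 < p.1 ∧ p.2 < 0 ∧ p.1 - p.2 < 1}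

/-- The part of the strip from which orbits escape backwards to infinity in the chart. -/
def farRegion : Set (ℝ × ℝ) := Ioo 0 1 ×ˢ Iio (-1)

theorem strip_subset : strip ⊆ normalForms := fun _ ⟨h1, h2⟩ =>
  ⟨h1.1.le, h1.2.le, (mem_Iio.1 h2).le.trans h1.1.le, fun h => absurd h h1.1.ne'⟩

theorem triangle_subset : triangle ⊆ normalForms := fun _ ⟨h1, h2, h3⟩ =>
  ⟨(h1.trans h2).le, h3.le, h2.le, fun h => absurd h (h1.trans h2).ne'⟩

theorem nearRegion_subset : nearRegion ⊆ strip := fun _ ⟨h1, h2, h3⟩ =>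
  ⟨⟨h1, by linarith⟩, h2⟩

theorem farRegion_subset : farRegion ⊆ strip := fun _ ⟨h1, h2⟩ =>
  ⟨h1, lt_trans (mem_Iio.1 h2) (by norm_num)⟩

theorem isOpen_strip : IsOpen strip := isOpen_Ioo.prod isOpen_Iio

theorem isOpen_triangle : IsOpen triangle :=
  (isOpen_lt continuous_const continuous_snd).inter
    ((isOpen_lt continuous_snd continuous_fst).inter (isOpen_lt continuous_fst continuous_const))

theorem isOpen_nearRegion : IsOpen nearRegion :=
  (isOpen_lt continuous_const continuous_fst).inter
    ((isOpen_lt continuous_snd continuous_const).inter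
      (isOpen_lt (continuous_fst.sub continuous_snd) continuous_const))

theorem isOpen_farRegion : IsOpen farRegion := isOpen_Ioo.prod isOpen_Iio

theorem isConnected_triangle : IsConnected triangle := by
  refine ⟨⟨(1 / 2, 1 / 4), by norm_num [triangle]⟩, Convex.isPreconnected ?_⟩
  rintro ⟨u, v⟩ ⟨h1, h2, h3⟩ ⟨u', v'⟩ ⟨h1', h2', h3'⟩
  rw [← segment_subset_iff]
  rintro _ ⟨a, b, ha, hb, hab, rfl⟩
  dsimp only at *
  obtain rfl : b = 1 - a := by linarith
  refine ⟨?_, ?_, ?_⟩ <;> simp only [Prod.smul_mk, Prod.mk_add_mk, smul_eq_mul] <;>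
    rcases ha.eq_or_lt with rfl | ha
  · linarith
  · nlinarith
  · linarith
  · nlinarith
  · linarith
  · nlinarith

theorem isConnected_nearRegion : IsConnected nearRegion := by
  refine ⟨⟨(1 / 4, -1 / 4), by norm_num [nearRegion]⟩, Convex.isPreconnected ?_⟩
  rintro ⟨u, v⟩ ⟨h1, h2, h3⟩ ⟨u', v'⟩ ⟨h1', h2', h3'⟩
  rw [← segment_subset_iff]
  rintro _ ⟨a, b, ha, hb, hab, rfl⟩
  dsimp only at *
  obtain rfl : b = 1 - a := by linarith
  refine ⟨?_, ?_, ?_⟩ <;> simp only [Prod.smul_mk, Prod.mk_add_mk, smul_eq_mul] <;>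
    rcases ha.eq_or_lt with rfl | ha
  · linarith
  · nlinarith
  · linarith
  · nlinarith
  · linarith
  · nlinarith

theorem isConnected_farRegion : IsConnected farRegion :=
  (isConnected_Ioo one_pos).prod isConnected_Iio

theorem isPreconnected_strip : IsPreconnected strip :=
  isPreconnected_Ioo.prod isPreconnected_Iio

/-- The points of `𝓜` whose orbit meets the part `S` of the chart. -/
def sweep (S : Set (ℝ × ℝ)) : Set Moduli := {x | ∃ t, ricciFlow t x ∈ chart '' S}

variable {S : Set (ℝ × ℝ)}

theorem isInvariant_sweep : IsInvariant ricciFlow (sweep S) := by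
  rintro t x ⟨s, hs⟩
  refine ⟨s - t, ?_⟩
  rwa [← ricciFlow.map_add, sub_add_cancel]

theorem isOpen_sweep (hS : IsOpen S) : IsOpen (sweep S) := by
  rw [show sweep S = ⋃ t, (fun x => ricciFlow t x) ⁻¹' (chart '' S) by ext; simp [sweep]]
  exact isOpen_iUnion fun t => (isOpenMap_chart S hS).preimage (ricciFlow.continuous_toFun t)

theorem isConnected_sweep (hS : IsConnected S) : IsConnected (sweep S) := by
  have h : sweep S = (fun q : ℝ × (ℝ × ℝ) => ricciFlow q.1 (chart q.2)) '' (univ ×ˢ S) := by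
    ext x
    constructor
    · rintro ⟨t, q, hq, hx⟩
      refine ⟨(-t, q), ⟨mem_univ _, hq⟩, ?_⟩
      dsimp only
      rw [hx, ← ricciFlow.map_add, neg_add_cancel, ricciFlow.map_zero_apply]
    · rintro ⟨⟨t, q⟩, ⟨-, hq⟩, rfl⟩
      refine ⟨-t, q, hq, ?_⟩
      dsimp only
      rw [← ricciFlow.map_add, neg_add_cancel, ricciFlow.map_zero_apply]
  rw [h]
  exact (isConnected_univ.prod hS).image _
    (ricciFlow.continuous continuous_fst (continuous_chart.comp continuous_snd)).continuousOn

theorem exists_strip_solution {x : Moduli} (hx : x ∈ chart '' strip) :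
    ∃ u v, IsChartSolution u v ∧ u 0 ∈ Ioo 0 1 ∧ v 0 < 0 ∧ (∀ t, (u t, v t) ∈ strip) ∧
      ∀ t, ricciFlow t x = chart (u t, v t) := by
  obtain ⟨⟨a, b⟩, ⟨h1, h2⟩, rfl⟩ := hx
  obtain ⟨u, v, rfl, rfl, h, hx⟩ := exists_isChartSolution a b
  exact ⟨u, v, h, h1, h2, fun t => ⟨h.fst_mem_Ioo h1 t, (h.sign_snd 0 t).2.1 h2⟩, hx⟩

theorem isInvariant_image_strip : IsInvariant ricciFlow (chart '' strip) := by
  intro t x hx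
  obtain ⟨u, v, -, -, -, hs, hx⟩ := exists_strip_solution hx
  exact ⟨_, hs t, (hx t).symm⟩

theorem sweep_subset (hS : S ⊆ strip) : sweep S ⊆ chart '' strip := by
  rintro x ⟨t, ht⟩
  have := isInvariant_image_strip (-t) (image_mono hS ht)
  rwa [← ricciFlow.map_add, neg_add_cancel, ricciFlow.map_zero_apply] at this

theorem mem_sweep_iff (hS : S ⊆ strip) {x : Moduli} {u v : ℝ → ℝ}
    (hs : ∀ t, (u t, v t) ∈ strip) (hx : ∀ t, ricciFlow t x = chart (u t, v t)) :
    x ∈ sweep S ↔ ∃ t, (u t, v t) ∈ S := by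
  constructor
  · rintro ⟨t, q, hq, e⟩
    rw [hx] at e
    exact ⟨t, injOn_chart (strip_subset (hS hq)) (strip_subset (hs t)) e ▸ hq⟩
  · rintro ⟨t, ht⟩
    exact ⟨t, _, ht, (hx t).symm⟩

/-- If an orbit met both regions, then at the earlier of the two times it would have `v < -1`, hence
`u - v > 1`, a condition that persists and excludes the near region later. -/
theorem disjoint_sweep : Disjoint (sweep nearRegion) (sweep farRegion) := by
  rw [Set.disjoint_left]
  intro x hxn hxf
  obtain ⟨u, v, h, hu, hv, hs, hx⟩ := exists_strip_solution (sweep_subset nearRegion_subset hxn)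
  obtain ⟨t, -, -, ht⟩ := (mem_sweep_iff nearRegion_subset hs hx).1 hxn
  obtain ⟨s, -, hs'⟩ := (mem_sweep_iff farRegion_subset hs hx).1 hxf
  have h1 := h.lt_neg_one_backward (Ioo_subset_Icc_self hu) hv (min_le_right t s) hs'
  have h2 := h.nonneg_forward (Ioo_subset_Icc_self hu) hv (min_le_left t s)
    (by linarith [(h.fst_mem_Ioo hu (min t s)).1])
  dsimp only at ht
  linarith

theorem runsFromTo_sweep_nearRegion :
    RunsFromTo ricciFlow (sweep nearRegion) (chart (0, 0)) (chart (1, 0)) := by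
  intro x hxn
  obtain ⟨u, v, h, hu, hv, hs, hx⟩ := exists_strip_solution (sweep_subset nearRegion_subset hxn)
  obtain ⟨t, -, -, ht⟩ := (mem_sweep_iff nearRegion_subset hs hx).1 hxn
  have h1 := h.backward_of_lt hu hv (t₀ := t) (by dsimp only at ht; linarith)
  have h2 := h.forward_of_neg hu.1 hu.2.le hv
  exact ⟨tendsto_chart hx h1.1 h1.2, tendsto_chart hx h2.1 h2.2⟩

theorem runsFromTo_sweep_farRegion :
    RunsFromTo ricciFlow (sweep farRegion) (chart (0, 0)) (chart (1, 0)) := by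
  intro x hxf
  obtain ⟨u, v, h, hu, hv, hs, hx⟩ := exists_strip_solution (sweep_subset farRegion_subset hxf)
  obtain ⟨t, -, ht⟩ := (mem_sweep_iff farRegion_subset hs hx).1 hxf
  have h2 := h.forward_of_neg hu.1 hu.2.le hv
  exact ⟨tendsto_chart_of_atBot hx (fun t => Ioo_subset_Icc_self (h.fst_mem_Ioo hu t))
    (h.backward_of_lt_neg_one hu hv ht), tendsto_chart hx h2.1 h2.2⟩

theorem isConnectedPlanarOpen_sweep (hS : IsOpen S) (hc : IsConnected S) (hss : S ⊆ strip) :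
    IsConnectedPlanarOpen (sweep S) :=
  ⟨isOpen_sweep hS, isConnected_sweep hc,
    exists_isOpenEmbedding (isOpen_sweep hS) isOpen_strip strip_subset (sweep_subset hss)⟩

/-- The points of the strip that lie in neither two-dimensional basin. -/
def separatrix : Set Moduli := chart '' strip \ (sweep nearRegion ∪ sweep farRegion)

/-- The strip is connected, so the disjoint open preimages of the two sweeps cannot cover it. An
orbit in the remainder keeps `v ≥ -1` and `u - v ≥ 1`, hence comes from `(0, -1)`, and any two such
orbits agree. -/
theorem isOrbit_separatrix : IsOrbitFromTo separatrix (chart (0, -1)) (chart (1, 0)) := by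
  have key : ∀ x ∈ separatrix, ∃ u v, IsChartSolution u v ∧ u 0 ∈ Ioo 0 1 ∧ v 0 < 0 ∧
      (∀ t, (u t, v t) ∈ strip) ∧ (∀ t, ricciFlow t x = chart (u t, v t)) ∧
      Tendsto u atBot (𝓝 0) ∧ Tendsto v atBot (𝓝 (-1)) := by
    rintro x ⟨hx, hx'⟩
    rw [mem_union, not_or] at hx'
    obtain ⟨u, v, h, hu, hv, hs, hx⟩ := exists_strip_solution hx
    rw [mem_sweep_iff nearRegion_subset hs hx, mem_sweep_iff farRegion_subset hs hx] at hx'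
    push Not at hx'
    refine ⟨u, v, h, hu, hv, hs, hx, h.backward_of_between hu hv (fun t => ?_) fun t => ?_⟩
    · by_contra hlt
      exact hx'.1 t ⟨(hs t).1.1, (hs t).2, by dsimp only; linarith⟩
    · by_contra hlt
      exact hx'.2 t ⟨(hs t).1, not_le.1 hlt⟩
  have hinv : IsInvariant ricciFlow separatrix := by
    rintro t x ⟨hx, hx'⟩
    refine ⟨isInvariant_image_strip t hx, fun hmem => hx' ?_⟩
    have back : ∀ {S}, ricciFlow t x ∈ sweep S → x ∈ sweep S := fun h => by
      have := isInvariant_sweep (-t) h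
      rwa [← ricciFlow.map_add, neg_add_cancel, ricciFlow.map_zero_apply] at this
    exact hmem.imp back back
  refine ⟨?_, fun x hx => ?_, fun x hx => ?_⟩
  · by_contra hne
    rw [separatrix, not_nonempty_iff_eq_empty, sdiff_eq_empty] at hne
    have meets : ∀ {S}, IsConnected S → S ⊆ strip → (strip ∩ chart ⁻¹' sweep S).Nonempty := by
      rintro S ⟨⟨p, hp⟩, -⟩ hS
      exact ⟨p, hS hp, 0, p, hp, by rw [ricciFlow.map_zero_apply]⟩
    obtain ⟨p, hp, h1, h2⟩ := isPreconnected_strip (chart ⁻¹' sweep nearRegion)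
      (chart ⁻¹' sweep farRegion) ((isOpen_sweep isOpen_nearRegion).preimage continuous_chart)
      ((isOpen_sweep isOpen_farRegion).preimage continuous_chart)
      (fun p hp => hne (mem_image_of_mem _ hp))
      (meets isConnected_nearRegion nearRegion_subset)
      (meets isConnected_farRegion farRegion_subset)
    exact Set.disjoint_left.1 disjoint_sweep h1 h2
  · refine Subset.antisymm ?_ fun y hy => ?_
    · rintro _ ⟨t, rfl⟩
      exact hinv t hx
    · obtain ⟨u, v, h, hu, hv, hs, hx, hub, hvb⟩ := key x hx
      obtain ⟨u', v', h', hu', hv', hs', hy, hub', hvb'⟩ := key y hy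
      obtain ⟨t, e1, e2⟩ := h.exists_eq_of_separatrix h' hu hv hu' hv' hub hvb hub' hvb'
      refine Flow.mem_orbit_iff _ |>.2 ⟨t, ?_⟩
      rw [hx, e1, e2, ← hy, ricciFlow.map_zero_apply]
  · obtain ⟨u, v, h, hu, hv, hs, hx, hub, hvb⟩ := key x hx
    have h2 := h.forward_of_neg hu.1 hu.2.le hv
    exact ⟨tendsto_chart hx hub hvb, tendsto_chart hx h2.1 h2.2⟩

theorem image_strip_eq : chart '' strip = separatrix ∪ (sweep nearRegion ∪ sweep farRegion) := by
  rw [separatrix, sdiff_union_self, union_eq_left.2]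
  exact union_subset (sweep_subset nearRegion_subset) (sweep_subset farRegion_subset)

theorem exists_triangle_solution {x : Moduli} (hx : x ∈ chart '' triangle) :
    ∃ u v, IsChartSolution u v ∧ (∀ t, (u t, v t) ∈ triangle) ∧
      ∀ t, ricciFlow t x = chart (u t, v t) := by
  obtain ⟨⟨a, b⟩, ⟨h1, h2, h3⟩, rfl⟩ := hx
  obtain ⟨u, v, rfl, rfl, h, hx⟩ := exists_isChartSolution a b
  exact ⟨u, v, h, fun t => ⟨(h.sign_snd 0 t).1 h1,
    sub_pos.1 ((h.sign_fst_sub_snd 0 t).1 (sub_pos.2 h2)),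
    sub_pos.1 ((h.sign_one_sub_fst 0 t).1 (sub_pos.2 h3))⟩, hx⟩

theorem isInvariant_image_triangle : IsInvariant ricciFlow (chart '' triangle) := by
  intro t x hx
  obtain ⟨u, v, -, hs, hx⟩ := exists_triangle_solution hx
  exact ⟨_, hs t, (hx t).symm⟩

theorem runsFromTo_image_triangle :
    RunsFromTo ricciFlow (chart '' triangle) (chart (0, 0)) (chart (1, 1)) := by
  intro x hx
  obtain ⟨u, v, h, hs, hx⟩ := exists_triangle_solution hx
  obtain ⟨h1, h2, h3⟩ := hs 0
  dsimp only at h1 h2 h3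
  obtain ⟨⟨U, V, hU, hV, hUu, -, hUV⟩, ⟨U', V', hU', hV', -, hVv', hUV'⟩⟩ :=
    h.triangle h1.le h2.le h3.le
  have e1 : U = 0 ∧ V = 0 := by
    have := hUu 0
    rcases hUV with e | ⟨e, -⟩ | ⟨e, -⟩
    · exact e
    · linarith
    · linarith
  have e2 : U' = 1 ∧ V' = 1 := by
    have := hVv' 0
    rcases hUV' with ⟨-, e⟩ | ⟨-, e⟩ | e
    · linarith
    · linarith
    · exact e
  rw [e1.1] at hU; rw [e1.2] at hV; rw [e2.1] at hU'; rw [e2.2] at hV'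
  exact ⟨tendsto_chart hx hU hV, tendsto_chart hx hU' hV'⟩

theorem isConnectedPlanarOpen_image_triangle : IsConnectedPlanarOpen (chart '' triangle) :=
  ⟨isOpenMap_chart _ isOpen_triangle, isConnected_triangle.image _ continuous_chart.continuousOn,
    exists_isOpenEmbedding (isOpenMap_chart _ isOpen_triangle) isOpen_triangle triangle_subset
      Subset.rfl⟩

end Moduli

end Basins

/-! ### The phase portrait -/

section PhasePortrait

open Filter Set

namespace Moduli

theorem pairwise_disjoint_image_chart {L : List (Set (ℝ × ℝ))} (hL : L.Pairwise Disjoint)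
    (h : ∀ S ∈ L, S ⊆ normalForms) : (L.map (chart '' ·)).Pairwise Disjoint := by
  rw [List.pairwise_map]
  exact hL.imp_of_mem fun hS hT hST => hST.image injOn_chart (h _ hS) (h _ hT)

theorem pairwise_disjoint_normalForms {P Q R : Set (ℝ × ℝ)} (hP : P ⊆ strip) (hQ : Q ⊆ strip)
    (hR : R ⊆ strip) (hPQ : Disjoint P Q) (hPR : Disjoint P R) (hQR : Disjoint Q R) :
    List.Pairwise Disjoint [{(0, 0)}, {(0, -1)}, {(1, 0)}, {(1, 1)},
      (fun s => ((0 : ℝ), s)) '' Ioo (-1) 0, (fun s => (s, (0 : ℝ))) '' Ioo 0 1,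
      (fun s => ((1 : ℝ), s)) '' Iio 0, (fun s => (s, s)) '' Ioo 0 1, P,
      (fun s => ((1 : ℝ), s)) '' Ioo 0 1, triangle, Q, R] := by
  have hP' : ∀ u v, (u, v) ∈ P → 0 < u ∧ u < 1 ∧ v < 0 := fun u v h =>
    ⟨(hP h).1.1, (hP h).1.2, (hP h).2⟩
  have hQ' : ∀ u v, (u, v) ∈ Q → 0 < u ∧ u < 1 ∧ v < 0 := fun u v h =>
    ⟨(hQ h).1.1, (hQ h).1.2, (hQ h).2⟩
  have hR' : ∀ u v, (u, v) ∈ R → 0 < u ∧ u < 1 ∧ v < 0 := fun u v h =>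
    ⟨(hR h).1.1, (hR h).1.2, (hR h).2⟩
  have ht : ∀ u v, (u, v) ∈ triangle → 0 < v ∧ v < u ∧ u < 1 := fun u v h => h
  simp only [List.pairwise_cons, List.forall_mem_cons, List.not_mem_nil, false_imp_iff,
    implies_true, and_true, List.Pairwise.nil, hPQ, hPR, hQR]
  clear hP hQ hR hPQ hPR hQR
  simp only [Set.disjoint_left, Prod.forall, mem_singleton_iff, Prod.mk.injEq, mem_image, mem_Ioo,
    mem_Iio]
  and_intros
  all_goals
    intro u v h h'
    grind

theorem mem_piece (x : Moduli) :
    x ∈ {chart (0, 0), chart (0, -1), chart (1, 0), chart (1, 1)} ∪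
      ((fun s => chart (0, s)) '' Ioo (-1) 0 ∪ (fun s => chart (s, 0)) '' Ioo 0 1 ∪
        (fun s => chart (1, s)) '' Iio 0 ∪ (fun s => chart (s, s)) '' Ioo 0 1 ∪ separatrix ∪
        (fun s => chart (1, s)) '' Ioo 0 1) ∪
      (chart '' triangle ∪ sweep nearRegion ∪ sweep farRegion) := by
  obtain ⟨⟨u, v⟩, ⟨h1, h2, h3, h4⟩, rfl⟩ := exists_chart_eq x
  dsimp only at h1 h2 h3 h4
  have hstrip := Set.ext_iff.1 image_strip_eq (chart (u, v))
  simp only [mem_union, mem_insert_iff, mem_singleton_iff] at hstrip ⊢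
  rcases h1.eq_or_lt with rfl | h1
  · rcases (h4 rfl).eq_or_lt with rfl | h4
    · simp
    · rcases h3.eq_or_lt with rfl | h3
      · simp
      · exact .inl <| .inr <| .inl <| .inl <| .inl <| .inl <| .inl ⟨v, ⟨h4, h3⟩, rfl⟩
  rcases h2.eq_or_lt with rfl | h2
  · rcases lt_trichotomy v 0 with h | rfl | h
    · exact .inl <| .inr <| .inl <| .inl <| .inl <| .inr ⟨v, h, rfl⟩
    · simp
    · rcases h3.eq_or_lt with rfl | h3
      · simp
      · exact .inl <| .inr <| .inr ⟨v, ⟨h, h3⟩, rfl⟩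
  rcases lt_trichotomy v 0 with h | rfl | h
  · rcases hstrip.1 ⟨(u, v), ⟨⟨h1, h2⟩, h⟩, rfl⟩ with h | h | h
    · exact .inl <| .inr <| .inl <| .inr h
    · exact .inr <| .inl <| .inr h
    · exact .inr <| .inr h
  · exact .inl <| .inr <| .inl <| .inl <| .inl <| .inl <| .inr ⟨u, ⟨h1, h2⟩, rfl⟩
  · rcases h3.eq_or_lt with rfl | h3
    · exact .inl <| .inr <| .inl <| .inl <| .inr ⟨v, ⟨h1, h2⟩, rfl⟩
    · exact .inr <| .inl <| .inl ⟨_, ⟨h, h3, h2⟩, rfl⟩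

/-- Disjointness is checked for sets of normal forms in the plane and transported by injectivity of
the chart. The sweeps and the separatrix enter as their preimages in the strip. -/
theorem pairwise_disjoint_pieces :
    List.Pairwise Disjoint [{chart (0, 0)}, {chart (0, -1)}, {chart (1, 0)}, {chart (1, 1)},
      (fun s => chart (0, s)) '' Ioo (-1) 0, (fun s => chart (s, 0)) '' Ioo 0 1,
      (fun s => chart (1, s)) '' Iio 0, (fun s => chart (s, s)) '' Ioo 0 1, separatrix,
      (fun s => chart (1, s)) '' Ioo 0 1, chart '' triangle, sweep nearRegion,
      sweep farRegion] := by
  have lift : ∀ B ⊆ chart '' strip, chart '' (strip ∩ chart ⁻¹' B) = B := fun B hB => by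
    rw [image_inter_preimage, inter_eq_right.2 hB]
  have hdis : ∀ {A B : Set Moduli}, Disjoint A B →
      Disjoint (strip ∩ chart ⁻¹' A) (strip ∩ chart ⁻¹' B) := fun h =>
    (h.preimage chart).mono inter_subset_right inter_subset_right
  have hsep : Disjoint separatrix (sweep nearRegion ∪ sweep farRegion) := disjoint_sdiff_left
  have h := pairwise_disjoint_image_chart (pairwise_disjoint_normalForms inter_subset_left
    inter_subset_left inter_subset_left (hdis (hsep.mono_right subset_union_left))
    (hdis (hsep.mono_right subset_union_right)) (hdis disjoint_sweep)) (by
      simp only [List.forall_mem_cons, List.not_mem_nil, false_imp_iff, implies_true, and_true,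
        singleton_subset_iff, image_subset_iff]
      refine ⟨?_, ?_, ?_, ?_, ?_, ?_, ?_, ?_, inter_subset_left.trans strip_subset, ?_,
        triangle_subset, inter_subset_left.trans strip_subset,
        inter_subset_left.trans strip_subset⟩
      iterate 4 norm_num [normalForms]
      all_goals
        intro s hs
        simp only [mem_Ioo, mem_Iio] at hs
        simp only [normalForms, mem_preimage, mem_ofPred_eq]
        grind)
  simpa only [List.map_cons, List.map_nil, image_singleton, image_image,
    lift separatrix sdiff_subset, lift _ (sweep_subset nearRegion_subset),
    lift _ (sweep_subset farRegion_subset)] using h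

/-! ### Transfer to an arbitrary normalized Ricci flow -/

variable {φ : Flow ℝ Moduli} {T : Set Moduli} {p q : Moduli}

theorem IsOrbitFromTo.isOneDimTrajectory (hT : IsOrbitFromTo T p q)
    (h : φ.IsReparametrization ricciFlow) (hp : ∀ t, ricciFlow t p = p)
    (hq : ∀ t, ricciFlow t q = q) (hpq : p ≠ q) (hpT : Disjoint {p} T) (hqT : Disjoint {q} T) :
    IsOneDimTrajectory φ T ∧ RunsFromTo φ T p q := by
  have key := fun x (hx : x ∈ T) => h.heteroclinic hp hq
    (fun e => disjoint_singleton_left.1 hpT (e ▸ hx))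
    (fun e => disjoint_singleton_left.1 hqT (e ▸ hx))
    (hT.runsFromTo x hx).1 (hT.runsFromTo x hx).2
  exact ⟨⟨hT.nonempty, fun x hx => ⟨(key x hx).1.trans (hT.orbit_eq x hx),
    Flow.isEmbedding_of_heteroclinic hpq (h.fixed hp) (h.fixed hq) (key x hx).2.1
      (key x hx).2.2⟩⟩, fun x hx => (key x hx).2⟩

theorem isInvariant_and_runsFromTo (hT : IsInvariant ricciFlow T)
    (hTpq : RunsFromTo ricciFlow T p q)
    (h : φ.IsReparametrization ricciFlow) (hp : ∀ t, ricciFlow t p = p)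
    (hq : ∀ t, ricciFlow t q = q) (hpT : Disjoint {p} T) (hqT : Disjoint {q} T) :
    IsInvariant φ T ∧ RunsFromTo φ T p q := by
  have key := fun x (hx : x ∈ T) => h.heteroclinic hp hq
    (fun e => disjoint_singleton_left.1 hpT (e ▸ hx))
    (fun e => disjoint_singleton_left.1 hqT (e ▸ hx)) (hTpq x hx).1 (hTpq x hx).2
  refine ⟨fun t x hx => ?_, fun x hx => (key x hx).2⟩
  obtain ⟨s, hs⟩ := (key x hx).1 ▸ φ.mem_orbit x t
  exact hs ▸ hT s hx

end Moduli

theorem theoremA :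
    ∃ (p₁ p₂ p₃ p₄ : Moduli) (T₁₂ T₁₃ T₁₃' T₁₄ T₂₃ T₃₄ B₁₄ B₁₃ B₁₃' : Set Moduli),
      List.Pairwise Disjoint
        [{p₁}, {p₂}, {p₃}, {p₄}, T₁₂, T₁₃, T₁₃', T₁₄, T₂₃, T₃₄, B₁₄, B₁₃, B₁₃'] ∧
      ({p₁, p₂, p₃, p₄} ∪ (T₁₂ ∪ T₁₃ ∪ T₁₃' ∪ T₁₄ ∪ T₂₃ ∪ T₃₄) ∪ (B₁₄ ∪ B₁₃ ∪ B₁₃')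
        = (Set.univ : Set Moduli)) ∧
      (IsConnectedPlanarOpen B₁₄ ∧ IsConnectedPlanarOpen B₁₃ ∧ IsConnectedPlanarOpen B₁₃') ∧
      (∃ φ : Flow ℝ Moduli, IsNormalizedRicciFlow φ) ∧
      ∀ φ : Flow ℝ Moduli, IsNormalizedRicciFlow φ →
        (∀ t, φ t p₁ = p₁ ∧ φ t p₂ = p₂ ∧ φ t p₃ = p₃ ∧ φ t p₄ = p₄) ∧
        (IsOneDimTrajectory φ T₁₂ ∧ RunsFromTo φ T₁₂ p₁ p₂) ∧
        (IsOneDimTrajectory φ T₁₃ ∧ RunsFromTo φ T₁₃ p₁ p₃) ∧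
        (IsOneDimTrajectory φ T₁₃' ∧ RunsFromTo φ T₁₃' p₁ p₃) ∧
        (IsOneDimTrajectory φ T₁₄ ∧ RunsFromTo φ T₁₄ p₁ p₄) ∧
        (IsOneDimTrajectory φ T₂₃ ∧ RunsFromTo φ T₂₃ p₂ p₃) ∧
        (IsOneDimTrajectory φ T₃₄ ∧ RunsFromTo φ T₃₄ p₃ p₄) ∧
        (IsInvariant φ B₁₄ ∧ RunsFromTo φ B₁₄ p₁ p₄) ∧
        (IsInvariant φ B₁₃ ∧ RunsFromTo φ B₁₃ p₁ p₃) ∧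
        (IsInvariant φ B₁₃' ∧ RunsFromTo φ B₁₃' p₁ p₃) ∧
        {x | Filter.Tendsto (fun t => φ t x) Filter.atTop (𝓝 p₂)} = {p₂} ∪ T₁₂ ∧
        {x | Filter.Tendsto (fun t => φ t x) Filter.atBot (𝓝 p₂)} = {p₂} ∪ T₂₃ := by
  have hd := Moduli.pairwise_disjoint_pieces
  -- The thirteen witnesses are read off from the list in `hd` by unification.
  refine ⟨_, _, _, _, _, _, _, _, _, _, _, _, _, hd, Set.eq_univ_of_forall Moduli.mem_piece,
    ⟨Moduli.isConnectedPlanarOpen_image_triangle,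
      Moduli.isConnectedPlanarOpen_sweep Moduli.isOpen_nearRegion Moduli.isConnected_nearRegion
        Moduli.nearRegion_subset,
      Moduli.isConnectedPlanarOpen_sweep Moduli.isOpen_farRegion Moduli.isConnected_farRegion
        Moduli.farRegion_subset⟩,
    ⟨_, Moduli.isNormalizedRicciFlow_ricciFlow⟩, fun φ hφ => ?_⟩
  have h : φ.IsReparametrization Moduli.ricciFlow := hφ.exists_reparametrization
  simp only [List.pairwise_cons, List.forall_mem_cons] at hd
  obtain ⟨⟨d12, d13, d14, d1a, d1b, d1c, d1d, -, -, d1e, d1f, d1g, -⟩,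
    ⟨d23, d24, d2a, -, -, -, d2d, -⟩,
    ⟨d34, -, d3b, d3c, -, d3d, d3e, -, d3f, d3g, -⟩,
    ⟨-, -, -, d4c, -, d4e, d4f, -⟩, -⟩ := hd
  have f1 := Moduli.fixed_zero_zero
  have f2 := Moduli.fixed_zero_neg_one
  have f3 := Moduli.fixed_one_zero
  have f4 := Moduli.fixed_one_one
  rw [Set.disjoint_singleton] at d12 d13 d14 d23 d24 d34
  have t12 := Moduli.isOrbit_edge12.isOneDimTrajectory h f1 f2 d12 d1a d2a
  have t13 := Moduli.isOrbit_edge13.isOneDimTrajectory h f1 f3 d13 d1b d3b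
  have t13' := Moduli.isOrbit_edge13'.isOneDimTrajectory h f1 f3 d13 d1c d3c
  have t14 := Moduli.isOrbit_edge14.isOneDimTrajectory h f1 f4 d14 d1d d4c
  have t23 := Moduli.isOrbit_separatrix.isOneDimTrajectory h f2 f3 d23 d2d d3d
  have t34 := Moduli.isOrbit_edge34.isOneDimTrajectory h f3 f4 d34 d3e d4e
  have b14 := Moduli.isInvariant_and_runsFromTo Moduli.isInvariant_image_triangle
    Moduli.runsFromTo_image_triangle h f1 f4 d1e d4f
  have b13 := Moduli.isInvariant_and_runsFromTo Moduli.isInvariant_sweep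
    Moduli.runsFromTo_sweep_nearRegion h f1 f3 d1f d3f
  have b13' := Moduli.isInvariant_and_runsFromTo Moduli.isInvariant_sweep
    Moduli.runsFromTo_sweep_farRegion h f1 f3 d1g d3g
  have c1 := h.fixed f1
  have c2 := h.fixed f2
  have c3 := h.fixed f3
  have c4 := h.fixed f4
  have rest : ∀ (l : Filter ℝ) {p : Moduli}, (∀ t, φ t p = p) →
      Tendsto (fun t => φ t p) l (𝓝 p) := fun l p hp =>
    tendsto_const_nhds.congr fun t => (hp t).symm
  refine ⟨fun t => ⟨c1 t, c2 t, c3 t, c4 t⟩, t12, t13, t13', t14, t23, t34, b14, b13, b13',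
    ?_, ?_⟩
  -- The pieces exhaust `𝓜`, and on every piece other than the two claimed the forward limit is
  -- another rest point; limits are unique because `𝓜` is Hausdorff. The unstable set is treated in
  -- the same way with backward limits.
  · refine Set.Subset.antisymm (fun x hx => ?_) ?_
    · have no : ∀ {q}, Tendsto (fun t => φ t x) atTop (𝓝 q) → Moduli.chart (0, -1) = q :=
        fun hq => tendsto_nhds_unique hx hq
      rcases Moduli.mem_piece x with ((rfl | rfl | rfl | rfl) |
        (((((hm | hm) | hm) | hm) | hm) | hm)) | ((hm | hm) | hm)
      · exact absurd (no (rest _ c1)).symm d12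
      · exact .inl rfl
      · exact absurd (no (rest _ c3)) d23
      · exact absurd (no (rest _ c4)) d24
      · exact .inr hm
      · exact absurd (no (t13.2 x hm).2) d23
      · exact absurd (no (t13'.2 x hm).2) d23
      · exact absurd (no (t14.2 x hm).2) d24
      · exact absurd (no (t23.2 x hm).2) d23
      · exact absurd (no (t34.2 x hm).2) d24
      · exact absurd (no (b14.2 x hm).2) d24
      · exact absurd (no (b13.2 x hm).2) d23
      · exact absurd (no (b13'.2 x hm).2) d23
    · rintro x (rfl | hm)
      · exact rest _ c2
      · exact (t12.2 x hm).2
  · refine Set.Subset.antisymm (fun x hx => ?_) ?_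
    · have no : ∀ {q}, Tendsto (fun t => φ t x) atBot (𝓝 q) → q = Moduli.chart (0, -1) :=
        fun hq => tendsto_nhds_unique hq hx
      rcases Moduli.mem_piece x with ((rfl | rfl | rfl | rfl) |
        (((((hm | hm) | hm) | hm) | hm) | hm)) | ((hm | hm) | hm)
      · exact absurd (no (rest _ c1)) d12
      · exact .inl rfl
      · exact absurd (no (rest _ c3)).symm d23
      · exact absurd (no (rest _ c4)).symm d24
      · exact absurd (no (t12.2 x hm).1) d12
      · exact absurd (no (t13.2 x hm).1) d12
      · exact absurd (no (t13'.2 x hm).1) d12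
      · exact absurd (no (t14.2 x hm).1) d12
      · exact .inr hm
      · exact absurd (no (t34.2 x hm).1).symm d23
      · exact absurd (no (b14.2 x hm).1) d12
      · exact absurd (no (b13.2 x hm).1) d12
      · exact absurd (no (b13'.2 x hm).1) d12
    · rintro x (rfl | hm)
      · exact rest _ c2
      · exact (t23.2 x hm).1

end PhasePortrait
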